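/- Let $A$ be a (not necessarily unital) $C^*$-algebra with multiplier algebra $M(A)$. A Hilbert $^*$-bimodule over $A$ is a Hilbert space $\mathfrak H$ with a $^*$-representation $\xi\mapsto a\cdot\xi$ and a $^*$-anti-representation $\xi\mapsto \xi\cdot a$ of $A$ on $\mathfrak H$ that commute; it is non-degenerate if $\{a\cdot\xi\}$ and $\{\xi\cdot a\}$ ($a\in A$, $\xi\in\mathfrak H$) both have dense linear span, and then both actions extend uniquely to $M(A)$. A net $(\xi_i)$ in $\mathfrak H$ is almost-$\mathfrak K_A$-central if $\sup_{x\in L}\|x\cdot\xi_i-\xi_i\cdot x\|\to_i 0$ for every subset $L$ of $M(A)$ that is compact for the strict topology (the weakest topology making $x\mapsto xa$ and $x\mapsto ax$ norm-continuous from $M(A)$ to $A$ for all $a\in A$). Let $\mathfrak H^A=\{\xi\in\mathfrak H: a\cdot\xi=\xi\cdot a\text{ for all }a\in A\}$ and let $P^A$ be the orthogonal projection of $\mathfrak H$ onto $\mathfrak H^A$. The $C^*$-algebra $A$ has Property $(T)$ (respectively, strong Property $(T)$) if for every non-degenerate Hilbert $^*$-bimodule $\mathfrak H$ over $A$ and every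 almost-$\mathfrak K_A$-central net $(\xi_i)$ of unit vectors in $\mathfrak H$, one has $\mathfrak H^A\neq\{0\}$ (respectively, $\|\xi_i-P^A\xi_i\|\to_i 0$). Corollary 1.5. Let $G$ be a non-compact (Hausdorff) locally compact group whose reduced group $C^*$-algebra $C^*_r(G)$ is nuclear. The following statements are equivalent: 1. $G$ is non-amenable; 2. $C^*_r(G)$ admits no tracial state, that is, no positive linear functional $\tau$ with $\|\tau\|=1$ and $\tau(ab)=\tau(ba)$ for all $a,b$; 3. $C^*_r(G)$ has Property $(T)$; 4. $C^*_r(G)$ has strong Property $(T)$. -/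

import Mathlib

open MeasureTheory Filter Topology MultiplierAlgebra MulOpposite
open scoped ComplexOrder TensorProduct ENNReal BoundedContinuousFunction CompactlySupported

universe u

noncomputable section

/-! ### Amenability -/

/-- Left translation `(s · f)(t) = f (s⁻¹ * t)` of a bounded continuous function on a group. -/
def leftTranslate {G : Type*} [Group G] [TopologicalSpace G] [IsTopologicalGroup G]
    (s : G) (f : G →ᵇ ℝ) : G →ᵇ ℝ :=
  f.compContinuous ⟨fun t => s⁻¹ * t, continuous_const.mul continuous_id⟩

/-- A (locally compact) group is amenable if there is a left-invariant mean, that is, a positive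
normalized left-translation-invariant linear functional, on the space of bounded continuous
functions on it. -/
def IsAmenableGroup (G : Type*) [Group G] [TopologicalSpace G] [IsTopologicalGroup G] : Prop :=
  ∃ m : (G →ᵇ ℝ) →ₗ[ℝ] ℝ,
    (∀ f : G →ᵇ ℝ, (∀ t, 0 ≤ f t) → 0 ≤ m f) ∧
    m (BoundedContinuousFunction.const G 1) = 1 ∧
    ∀ (s : G) (f : G →ᵇ ℝ), m (leftTranslate s f) = m f

/-! ### The reduced group C⋆-algebra -/

section ReducedGroupCStarAlgebra

variable {G : Type u} [Group G] [TopologicalSpace G] [IsTopologicalGroup G]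
  [MeasurableSpace G] [BorelSpace G]

/-- The left regular representation `(λ_s ξ)(t) = ξ (s⁻¹ * t)` of `G` on `L²(G, μ)`. -/
def leftRegular (μ : Measure G) [μ.IsHaarMeasure] (s : G) : Lp ℂ 2 μ →ₗᵢ[ℂ] Lp ℂ 2 μ :=
  Lp.compMeasurePreservingₗᵢ ℂ (fun t => s⁻¹ * t) (measurePreserving_mul_left μ s⁻¹)

variable [LocallyCompactSpace G]

theorem continuous_leftRegular (μ : Measure G) [μ.IsHaarMeasure] [μ.Regular] (ξ : Lp ℂ 2 μ) :
    Continuous fun s : G => leftRegular μ s ξ := by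
  let g : C(G, C(G, G)) :=
    (ContinuousMap.mk (fun a : G × G => a.1⁻¹ * a.2) (by fun_prop)).curry
  exact (continuous_const (y := ξ)).compMeasurePreservingLp g.continuous
    (fun s => measurePreserving_mul_left μ s⁻¹) (by simp)

theorem integrable_smul_leftRegular (μ : Measure G) [μ.IsHaarMeasure] [μ.Regular]
    (f : C_c(G, ℂ)) (ξ : Lp ℂ 2 μ) : Integrable (fun s => f s • leftRegular μ s ξ) μ :=
  (f.continuous.smul (continuous_leftRegular μ ξ)).integrable_of_hasCompactSupport
    (f.hasCompactSupport.smul_right)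

/-- The integrated form `λ(f) ξ = ∫ f(s) λ_s ξ ds` (that is, `ξ ↦ f * ξ`) of the left regular
representation, as a bounded operator on `L²(G, μ)`, for `f` continuous with compact support. -/
def leftConvolution (μ : Measure G) [μ.IsHaarMeasure] [μ.Regular] (f : C_c(G, ℂ)) :
    Lp ℂ 2 μ →L[ℂ] Lp ℂ 2 μ :=
  LinearMap.mkContinuous
    { toFun := fun ξ => ∫ s, f s • leftRegular μ s ξ ∂μ
      map_add' := fun ξ η => by
        simp only [map_add, smul_add]
        exact integral_add (integrable_smul_leftRegular μ f ξ) (integrable_smul_leftRegular μ f η)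
      map_smul' := fun c ξ => by
        simp only [map_smul, RingHom.id_apply, smul_comm _ c]
        exact integral_smul c _ }
    (∫ s, ‖f s‖ ∂μ)
    (fun ξ => by
      refine (norm_integral_le_integral_norm _).trans (le_of_eq ?_)
      simp only [norm_smul, LinearIsometry.norm_map]
      exact integral_mul_const _ _)

/-- The reduced group C⋆-algebra `C*_r(G)`: the C⋆-subalgebra of `B(L²(G))` generated by the
convolution operators `λ(f)`, `f ∈ C_c(G)`, for a fixed left Haar measure on `G`. -/
def reducedCStar (μ : Measure G) [μ.IsHaarMeasure] [μ.Regular] :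
    NonUnitalStarSubalgebra ℂ (Lp ℂ 2 μ →L[ℂ] Lp ℂ 2 μ) :=
  (NonUnitalStarAlgebra.adjoin ℂ (Set.range (leftConvolution μ))).topologicalClosure

instance (μ : Measure G) [μ.IsHaarMeasure] [μ.Regular] :
    NonUnitalCStarAlgebra (reducedCStar μ) :=
  NonUnitalStarSubalgebra.nonUnitalCStarAlgebra _
    (h_closed := NonUnitalStarSubalgebra.isClosed_topologicalClosure _)

end ReducedGroupCStarAlgebra

/-! ### Tracial states and nuclearity -/

section CStar

/-- `τ` is a tracial state of the (possibly non-unital) C⋆-algebra `A`: a positive linear functional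
of norm one with `τ (a b) = τ (b a)`. -/
def IsTracialState {A : Type*} [NonUnitalCStarAlgebra A] (τ : A →L[ℂ] ℂ) : Prop :=
  (∀ a, 0 ≤ τ (star a * a)) ∧ ‖τ‖ = 1 ∧ ∀ a b, τ (a * b) = τ (b * a)

/-- A C⋆-norm on the algebraic tensor product `A ⊗ B`. -/
structure IsCStarNorm {A B : Type*} [NonUnitalCStarAlgebra A] [NonUnitalCStarAlgebra B]
    (p : A ⊗[ℂ] B → ℝ) : Prop where
  add_le : ∀ x y, p (x + y) ≤ p x + p y
  smul : ∀ (c : ℂ) x, p (c • x) = ‖c‖ * p x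
  eq_zero : ∀ x, p x = 0 → x = 0
  mul_le : ∀ x y, p (x * y) ≤ p x * p y
  star_mul_self : ∀ x, p (star x * x) = p x ^ 2

/-- A C⋆-algebra `A` is nuclear if, for every C⋆-algebra `B`, the algebraic tensor product `A ⊗ B`
carries only one C⋆-norm (the maximal and the minimal one coincide). As this property can be tested
on separable `B`, nothing is lost by letting `B` range over the universe of `A`. -/
def IsNuclear (A : Type u) [NonUnitalCStarAlgebra A] : Prop :=
  ∀ (B : Type u) [NonUnitalCStarAlgebra B] (p q : A ⊗[ℂ] B → ℝ),
    IsCStarNorm p → IsCStarNorm q → p = q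

/-! ### Hilbert bimodules and Property (T) -/

/-- A Hilbert `*`-bimodule structure over `A` on the Hilbert space `H`: a `*`-representation and a
`*`-anti-representation of `A` on `H` which commute. -/
structure HilbertStarBimodule (A : Type*) [NonUnitalCStarAlgebra A] (H : Type*)
    [NormedAddCommGroup H] [InnerProductSpace ℂ H] [CompleteSpace H] where
  /-- `left a ξ` is `a · ξ`. -/
  left : A →⋆ₙₐ[ℂ] (H →L[ℂ] H)
  /-- `right (op a) ξ` is `ξ · a`. -/
  right : Aᵐᵒᵖ →⋆ₙₐ[ℂ] (H →L[ℂ] H)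
  comm : ∀ (a b : A) (ξ : H), left a (right (op b) ξ) = right (op b) (left a ξ)

/-- The strict topology on the multiplier algebra: the weakest topology making `x ↦ x a` and
`x ↦ a x` continuous from `M(A)` to `A` (with its norm topology) for all `a : A`. -/
@[reducible]
def strictTopology (A : Type*) [NonUnitalCStarAlgebra A] : TopologicalSpace 𝓜(ℂ, A) :=
  ⨅ a : A, (TopologicalSpace.induced (fun x : 𝓜(ℂ, A) => x.fst a) inferInstance ⊓
    TopologicalSpace.induced (fun x : 𝓜(ℂ, A) => x.snd a) inferInstance)

theorem eq_of_forall_mul_left {A : Type*} [NonUnitalCStarAlgebra A] {y z : A}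
    (h : ∀ c, c * y = c * z) : y = z := by
  have := h (star (y - z))
  rwa [← sub_eq_zero, ← mul_sub, CStarRing.star_mul_self_eq_zero_iff, sub_eq_zero] at this

theorem fst_mul_apply {A : Type*} [NonUnitalCStarAlgebra A] (x : 𝓜(ℂ, A)) (a b : A) :
    x.fst (a * b) = x.fst a * b :=
  eq_of_forall_mul_left fun c => by
    rw [← x.central, ← mul_assoc, x.central, mul_assoc]

theorem snd_mul_apply {A : Type*} [NonUnitalCStarAlgebra A] (x : 𝓜(ℂ, A)) (a b : A) :
    x.snd (a * b) = a * x.snd b := by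
  have h := fst_mul_apply (star x) (star b) (star a)
  rw [← star_mul, DoubleCentralizer.star_fst, DoubleCentralizer.star_fst, star_star, star_star,
    ← star_inj, star_star, star_mul, star_star, star_star] at h
  exact h

namespace HilbertStarBimodule

variable {A : Type*} [NonUnitalCStarAlgebra A] {H : Type*}
  [NormedAddCommGroup H] [InnerProductSpace ℂ H] [CompleteSpace H]

/-- Both the representation and the anti-representation are non-degenerate. -/
def Nondegenerate (X : HilbertStarBimodule A H) : Prop :=
  Dense (Submodule.span ℂ {η : H | ∃ (a : A) (ξ : H), X.left a ξ = η} : Set H) ∧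
  Dense (Submodule.span ℂ {η : H | ∃ (a : A) (ξ : H), X.right (op a) ξ = η} : Set H)

/-- The linear map `A ⊗ H → H`, `a ⊗ ξ ↦ (φ a) · ξ`. -/
def leftMap (X : HilbertStarBimodule A H) (φ : A →ₗ[ℂ] A) : A ⊗[ℂ] H →ₗ[ℂ] H :=
  TensorProduct.lift
    ((ContinuousLinearMap.coeLM ℂ).comp ((X.left : A →ₗ[ℂ] (H →L[ℂ] H)).comp φ))

/-- The linear map `A ⊗ H → H`, `a ⊗ ξ ↦ ξ · (φ a)`. -/
def rightMap (X : HilbertStarBimodule A H) (φ : A →ₗ[ℂ] A) : A ⊗[ℂ] H →ₗ[ℂ] H :=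
  TensorProduct.lift
    ((ContinuousLinearMap.coeLM ℂ).comp ((X.right : Aᵐᵒᵖ →ₗ[ℂ] (H →L[ℂ] H)).comp
      ((opLinearEquiv ℂ : A ≃ₗ[ℂ] Aᵐᵒᵖ).toLinearMap.comp φ)))

/-- The left action of a multiplier `x` on a non-degenerate bimodule: the bounded operator with
`x · (a · ξ) = (x a) · ξ`. -/
def mulLeft (X : HilbertStarBimodule A H) (x : 𝓜(ℂ, A)) : H →L[ℂ] H :=
  (X.leftMap x.fst.toLinearMap).extendOfNorm (X.leftMap LinearMap.id)

/-- The right action of a multiplier `x` on a non-degenerate bimodule: the bounded operator with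
`(ξ · a) · x = ξ · (a x)`. -/
def mulRight (X : HilbertStarBimodule A H) (x : 𝓜(ℂ, A)) : H →L[ℂ] H :=
  (X.rightMap x.snd.toLinearMap).extendOfNorm (X.rightMap LinearMap.id)

theorem denseRange_leftMap {X : HilbertStarBimodule A H} (hX : X.Nondegenerate) :
    DenseRange (X.leftMap LinearMap.id) := by
  refine hX.1.mono ?_
  change (_ : Set H) ⊆ (LinearMap.range (X.leftMap LinearMap.id) : Set H)
  rw [SetLike.coe_subset_coe, Submodule.span_le]
  rintro _ ⟨a, ξ, rfl⟩
  exact ⟨a ⊗ₜ ξ, by simp [leftMap]⟩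

theorem denseRange_rightMap {X : HilbertStarBimodule A H} (hX : X.Nondegenerate) :
    DenseRange (X.rightMap LinearMap.id) := by
  refine hX.2.mono ?_
  change (_ : Set H) ⊆ (LinearMap.range (X.rightMap LinearMap.id) : Set H)
  rw [SetLike.coe_subset_coe, Submodule.span_le]
  rintro _ ⟨a, ξ, rfl⟩
  exact ⟨a ⊗ₜ ξ, by simp [rightMap]⟩

theorem norm_leftMap_le (X : HilbertStarBimodule A H) (x : 𝓜(ℂ, A)) (t : A ⊗[ℂ] H) :
    ‖X.leftMap x.fst.toLinearMap t‖ ≤ ‖x‖ * ‖X.leftMap LinearMap.id t‖ := by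
  let _ := CStarAlgebra.spectralOrder A
  let _ := CStarAlgebra.spectralOrderedRing A
  have hu := CStarAlgebra.increasingApproximateUnit A
  have key : Tendsto (fun e => X.left (x.fst e) (X.leftMap LinearMap.id t))
      (CStarAlgebra.approximateUnit A) (𝓝 (X.leftMap x.fst.toLinearMap t)) := by
    induction t with
    | zero => simp
    | add s t hs ht => simpa only [map_add] using hs.add ht
    | tmul a ξ =>
      have h1 : Continuous fun b : A => X.left (x.fst b) ξ := by fun_prop
      have h2 := (h1.tendsto a).comp (hu.tendsto_mul_right a)
      refine (h2.congr fun e => ?_).trans (le_of_eq ?_)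
      · simp [leftMap, fst_mul_apply]
      · simp [leftMap]
  refine le_of_tendsto key.norm ?_
  filter_upwards [hu.eventually_norm] with e he
  refine (ContinuousLinearMap.le_opNorm _ _).trans ?_
  gcongr
  refine (NonUnitalStarAlgHom.norm_apply_le _ _).trans ?_
  refine (x.fst.le_opNorm e).trans ?_
  rw [DoubleCentralizer.norm_fst]
  exact mul_le_of_le_one_right (norm_nonneg _) he

theorem norm_rightMap_le (X : HilbertStarBimodule A H) (x : 𝓜(ℂ, A)) (t : A ⊗[ℂ] H) :
    ‖X.rightMap x.snd.toLinearMap t‖ ≤ ‖x‖ * ‖X.rightMap LinearMap.id t‖ := by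
  let _ := CStarAlgebra.spectralOrder A
  let _ := CStarAlgebra.spectralOrderedRing A
  have hu := CStarAlgebra.increasingApproximateUnit A
  have key : Tendsto (fun e => X.right (op (x.snd e)) (X.rightMap LinearMap.id t))
      (CStarAlgebra.approximateUnit A) (𝓝 (X.rightMap x.snd.toLinearMap t)) := by
    induction t with
    | zero => simp
    | add s t hs ht => simpa only [map_add] using hs.add ht
    | tmul a ξ =>
      have h1 : Continuous fun b : A => X.right (op (x.snd b)) ξ := by fun_prop
      have h2 := (h1.tendsto a).comp (hu.tendsto_mul_left a)
      refine (h2.congr fun e => ?_).trans (le_of_eq ?_)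
      · simp [rightMap, snd_mul_apply]
      · simp [rightMap]
  refine le_of_tendsto key.norm ?_
  filter_upwards [hu.eventually_norm] with e he
  refine (ContinuousLinearMap.le_opNorm _ _).trans ?_
  gcongr
  refine (NonUnitalStarAlgHom.norm_apply_le _ _).trans ?_
  rw [norm_op]
  refine (x.snd.le_opNorm e).trans ?_
  rw [DoubleCentralizer.norm_snd]
  exact mul_le_of_le_one_right (norm_nonneg _) he

/-- The characterization `x · (a · ξ) = (x a) · ξ` of the left action of multipliers. -/
theorem mulLeft_apply {X : HilbertStarBimodule A H} (hX : X.Nondegenerate) (x : 𝓜(ℂ, A))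
    (a : A) (ξ : H) : X.mulLeft x (X.left a ξ) = X.left (x.fst a) ξ := by
  have h := LinearMap.extendOfNorm_eq (denseRange_leftMap hX) ⟨‖x‖, X.norm_leftMap_le x⟩ (a ⊗ₜ ξ)
  simpa [leftMap, mulLeft] using h

/-- The characterization `(ξ · a) · x = ξ · (a x)` of the right action of multipliers. -/
theorem mulRight_apply {X : HilbertStarBimodule A H} (hX : X.Nondegenerate) (x : 𝓜(ℂ, A))
    (a : A) (ξ : H) : X.mulRight x (X.right (op a) ξ) = X.right (op (x.snd a)) ξ := by
  have h := LinearMap.extendOfNorm_eq (denseRange_rightMap hX) ⟨‖x‖, X.norm_rightMap_le x⟩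
    (a ⊗ₜ ξ)
  simpa [rightMap, mulRight] using h

/-- The closed subspace of central vectors, `{ξ | a · ξ = ξ · a for all a ∈ A}`. -/
def centralVectors (X : HilbertStarBimodule A H) : Submodule ℂ H where
  carrier := {ξ | ∀ a : A, X.left a ξ = X.right (op a) ξ}
  add_mem' := fun hx hy a => by simp [hx a, hy a]
  zero_mem' := fun a => by simp
  smul_mem' := fun c x hx a => by simp [hx a]

theorem isClosed_centralVectors (X : HilbertStarBimodule A H) :
    IsClosed (X.centralVectors : Set H) := by
  have : (X.centralVectors : Set H) = ⋂ a : A, {ξ | X.left a ξ = X.right (op a) ξ} := by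
    ext ξ
    simp [centralVectors]
  rw [this]
  exact isClosed_iInter fun a => isClosed_eq (X.left a).continuous (X.right (op a)).continuous

instance (X : HilbertStarBimodule A H) : CompleteSpace X.centralVectors :=
  X.isClosed_centralVectors.completeSpace_coe

/-- A net `ξ` is almost-`𝔎_A`-central: `sup_{x ∈ L} ‖x · ξ i - ξ i · x‖ → 0` for every subset `L`
of the multiplier algebra `M(A)` which is compact for the strict topology. -/
def IsAlmostCentral (X : HilbertStarBimodule A H) {I : Type*} [Preorder I] (ξ : I → H) : Prop :=
  ∀ L : Set 𝓜(ℂ, A), @IsCompact _ (strictTopology A) L → ∀ ε > (0 : ℝ),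
    ∀ᶠ i in atTop, ∀ x ∈ L, ‖X.mulLeft x (ξ i) - X.mulRight x (ξ i)‖ ≤ ε

end HilbertStarBimodule

/-- Property (T) of a C⋆-algebra: every non-degenerate Hilbert `*`-bimodule with an
almost-`𝔎_A`-central net of unit vectors has a non-zero central vector. -/
def HasPropertyT (A : Type u) [NonUnitalCStarAlgebra A] : Prop :=
  ∀ (H : Type u) [NormedAddCommGroup H] [InnerProductSpace ℂ H] [CompleteSpace H]
    (X : HilbertStarBimodule A H), X.Nondegenerate →
    ∀ (I : Type u) [Preorder I] [IsDirectedOrder I] [Nonempty I] (ξ : I → H),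
      (∀ i, ‖ξ i‖ = 1) → X.IsAlmostCentral ξ → X.centralVectors ≠ ⊥

/-- Strong Property (T) of a C⋆-algebra: in every non-degenerate Hilbert `*`-bimodule, each
almost-`𝔎_A`-central net of unit vectors satisfies `‖ξ i - P (ξ i)‖ → 0`, where `P` is the
orthogonal projection onto the space of central vectors. -/
def HasStrongPropertyT (A : Type u) [NonUnitalCStarAlgebra A] : Prop :=
  ∀ (H : Type u) [NormedAddCommGroup H] [InnerProductSpace ℂ H] [CompleteSpace H]
    (X : HilbertStarBimodule A H), X.Nondegenerate →
    ∀ (I : Type u) [Preorder I] [IsDirectedOrder I] [Nonempty I] (ξ : I → H),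
      (∀ i, ‖ξ i‖ = 1) → X.IsAlmostCentral ξ →
      Tendsto (fun i => ‖ξ i - X.centralVectors.starProjection (ξ i)‖) atTop (𝓝 0)

end CStar

end

/-! Let `A = C*_r(G)` and let λ be the left regular representation; each λ_s is a unitary multiplier
of `A`. Everything turns on amenability. If `G` is not amenable, nuclearity excludes almost central
unit vectors altogether. If `G` is amenable, the trivial representation of `G` gives a character of
`A`, which is a trace and obstructs Property (T).

Non-amenable side: suppose that a non-degenerate bimodule contains unit vectors that are almost
central for each finite set of multipliers. For finite S ⊆ G, the operator ξ ↦ ∑ λ_s · ξ · λ_{s⁻¹}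
almost multiplies them by |S|, so its norm is at least |S|. The bimodule represents A ⊗ Aᵐᵒᵖ, and by
nuclearity (`IsNuclear.norm_tensorRep_le`) its norms are dominated by those of the faithful spatial
representation on L²(G) ⊗ L²(G). Hence ∑ λ_s ⊗ (λ_{s⁻¹})ᵗ also has norm at least |S|, and uniform
convexity (`exists_unit_norm_sub_le`) produces unit vectors almost fixed by every summand.
Evaluating the operators φ ⊗ 1 at these vectors and passing to a limit gives an invariant mean: this
is `isAmenableGroup_of_almost_central`. A tracial state supplies such vectors through the central
vector of its GNS bimodule, and an almost central net supplies them directly. So without amenability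
there is no tracial state, and strong Property (T) holds vacuously.

Amenable side: a convexity argument with Hahn–Banach in L¹(G), followed by a square root, gives
Reiter vectors in L²(G), almost invariant uniformly on compact sets. They are approximate
eigenvectors of all elements of `A`, and the eigenvalues form the trivial character χ, a tracial
state. In the bimodule L²(G), with convolution on the left and χ on the right, the Reiter net is
almost central, while a central vector is translation invariant and therefore zero when `G` is
non-compact. So Property (T) fails. -/

/-! ### C⋆-norms from commuting representations -/

section TensorRepresentation

variable {A B K : Type*} [NonUnitalRing A] [StarRing A] [Module ℂ A] [NonUnitalRing B]
  [StarRing B] [Module ℂ B] [NormedAddCommGroup K] [InnerProductSpace ℂ K]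

/-- The linear map `a ⊗ b ↦ π a ∘ σ b`. -/
noncomputable def tensorRep (π : A →ₗ[ℂ] K →L[ℂ] K) (σ : B →ₗ[ℂ] K →L[ℂ] K) :
    A ⊗[ℂ] B →ₗ[ℂ] K →L[ℂ] K :=
  LinearMap.mul' ℂ (K →L[ℂ] K) ∘ₗ TensorProduct.map π σ

omit [StarRing A] [StarRing B] in
@[simp]
theorem tensorRep_tmul (π : A →ₗ[ℂ] K →L[ℂ] K) (σ : B →ₗ[ℂ] K →L[ℂ] K) (a : A) (b : B) :
    tensorRep π σ (a ⊗ₜ b) = π a * σ b := by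
  simp [tensorRep]

/-- `π` and `σ` are commuting `*`-representations by bounded operators on the pre-Hilbert space
`K`. -/
structure IsCommutingStarPair (π : A →ₗ[ℂ] K →L[ℂ] K) (σ : B →ₗ[ℂ] K →L[ℂ] K) : Prop where
  left_mul : ∀ a b, π (a * b) = π a * π b
  right_mul : ∀ a b, σ (a * b) = σ a * σ b
  comm : ∀ a b, π a * σ b = σ b * π a
  left_star : ∀ a x y, inner ℂ (π a x) y = inner ℂ x (π (star a) y)
  right_star : ∀ b x y, inner ℂ (σ b x) y = inner ℂ x (σ (star b) y)

namespace IsCommutingStarPair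

variable {A B : Type*} [NonUnitalCStarAlgebra A] [NonUnitalCStarAlgebra B]
  {π : A →ₗ[ℂ] K →L[ℂ] K} {σ : B →ₗ[ℂ] K →L[ℂ] K}

theorem tensorRep_mul (h : IsCommutingStarPair π σ) (s t : A ⊗[ℂ] B) :
    tensorRep π σ (s * t) = tensorRep π σ s * tensorRep π σ t := by
  induction s with
  | zero => simp
  | add s s' hs hs' => simp only [add_mul, map_add, hs, hs']
  | tmul a b =>
    induction t with
    | zero => simp
    | add t t' ht ht' => simp only [mul_add, map_add, ht, ht']
    | tmul c d =>
      simp only [Algebra.TensorProduct.tmul_mul_tmul, tensorRep_tmul, h.left_mul, h.right_mul]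
      rw [mul_assoc, mul_assoc, ← mul_assoc (π c), h.comm c b, mul_assoc]

theorem inner_tensorRep (h : IsCommutingStarPair π σ) (t : A ⊗[ℂ] B) (x y : K) :
    inner ℂ (tensorRep π σ t x) y = inner ℂ x (tensorRep π σ (star t) y) := by
  induction t with
  | zero => simp
  | add s t hs ht => simp only [map_add, star_add, _root_.add_apply, inner_add_left,
      inner_add_right, hs, ht]
  | tmul a b =>
    rw [TensorProduct.star_tmul, tensorRep_tmul, tensorRep_tmul, h.comm, h.comm,
      ← h.comm, mul_apply_eq_comp, h.left_star, h.right_star, ← h.comm, h.comm]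
    rfl

/-- `K` is not assumed complete, because it will be an algebraic tensor product. The operators may
thus lack adjoints, and the C⋆-identity is derived from the formal adjoint `tensorRep π σ (star t)`
and Cauchy–Schwarz. -/
theorem sq_norm_tensorRep_le (h : IsCommutingStarPair π σ) (t : A ⊗[ℂ] B) :
    ‖tensorRep π σ t‖ ^ 2 ≤ ‖tensorRep π σ (star t * t)‖ := by
  have h0 : ‖tensorRep π σ t‖ ≤ √‖tensorRep π σ (star t * t)‖ := by
    refine ContinuousLinearMap.opNorm_le_bound _ (Real.sqrt_nonneg _) fun x => ?_
    refine le_of_sq_le_sq ?_ (by positivity)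
    rw [mul_pow, Real.sq_sqrt (norm_nonneg _)]
    have h1 : inner ℂ (tensorRep π σ t x) (tensorRep π σ t x)
        = inner ℂ x (tensorRep π σ (star t * t) x) := by
      rw [h.inner_tensorRep, h.tensorRep_mul]
      rfl
    have h2 := congrArg norm h1
    rw [inner_self_eq_norm_sq_to_K, norm_pow, RCLike.norm_ofReal, abs_norm] at h2
    rw [h2, sq, mul_left_comm]
    exact (norm_inner_le_norm _ _).trans
      (mul_le_mul_of_nonneg_left (ContinuousLinearMap.le_opNorm _ _) (norm_nonneg _))
  calc _ ≤ (√‖tensorRep π σ (star t * t)‖) ^ 2 := by gcongr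
    _ = _ := Real.sq_sqrt (norm_nonneg _)

theorem norm_tensorRep_le_star (h : IsCommutingStarPair π σ) (t : A ⊗[ℂ] B) :
    ‖tensorRep π σ t‖ ≤ ‖tensorRep π σ (star t)‖ := by
  have h1 := h.sq_norm_tensorRep_le t
  rw [h.tensorRep_mul, sq] at h1
  rcases (norm_nonneg (tensorRep π σ t)).eq_or_lt' with h0 | h0
  · rw [h0]
    exact norm_nonneg _
  · exact le_of_mul_le_mul_right (h1.trans (norm_mul_le _ _)) h0

theorem norm_tensorRep_star_mul_self (h : IsCommutingStarPair π σ) (t : A ⊗[ℂ] B) :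
    ‖tensorRep π σ (star t * t)‖ = ‖tensorRep π σ t‖ ^ 2 := by
  refine le_antisymm ?_ (h.sq_norm_tensorRep_le t)
  have h1 := h.norm_tensorRep_le_star (star t)
  rw [star_star] at h1
  rw [h.tensorRep_mul, sq]
  exact (norm_mul_le _ _).trans (mul_le_mul_of_nonneg_right h1 (norm_nonneg _))

/-- The second pair need not be faithful: the maximum inherits definiteness from the first pair and
still dominates the second. -/
theorem isCStarNorm_max (h : IsCommutingStarPair π σ)
    (hinj : Function.Injective (tensorRep π σ)) {K' : Type*}
    [NormedAddCommGroup K'] [InnerProductSpace ℂ K'] {π' : A →ₗ[ℂ] K' →L[ℂ] K'}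
    {σ' : B →ₗ[ℂ] K' →L[ℂ] K'} (h' : IsCommutingStarPair π' σ') :
    IsCStarNorm fun t : A ⊗[ℂ] B => max ‖tensorRep π σ t‖ ‖tensorRep π' σ' t‖ where
  add_le x y := by
    simp only [map_add]
    exact max_le ((norm_add_le _ _).trans (add_le_add (le_max_left _ _) (le_max_left _ _)))
      ((norm_add_le _ _).trans (add_le_add (le_max_right _ _) (le_max_right _ _)))
  smul c x := by
    simp only [map_smul, norm_smul, mul_max_of_nonneg _ _ (norm_nonneg c)]
  eq_zero x hx := hinj <| by
    rw [map_zero, ← norm_le_zero_iff, ← hx]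
    exact le_max_left _ _
  mul_le x y := by
    simp only [h.tensorRep_mul, h'.tensorRep_mul]
    refine max_le ((norm_mul_le _ _).trans ?_) ((norm_mul_le _ _).trans ?_)
    · gcongr <;> exact le_max_left _ _
    · gcongr <;> exact le_max_right _ _
  star_mul_self x := by
    simp only [h.norm_tensorRep_star_mul_self, h'.norm_tensorRep_star_mul_self]
    rcases le_total ‖tensorRep π σ x‖ ‖tensorRep π' σ' x‖ with hle | hle
    · rw [max_eq_right hle, max_eq_right (by gcongr)]
    · rw [max_eq_left hle, max_eq_left (by gcongr)]

end IsCommutingStarPair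

/-- Over a nuclear C⋆-algebra, every commuting pair of representations is dominated by a faithful
one. -/
theorem IsNuclear.norm_tensorRep_le {A B : Type u} [NonUnitalCStarAlgebra A]
    [NonUnitalCStarAlgebra B] (hA : IsNuclear A) {K K' : Type*}
    [NormedAddCommGroup K] [InnerProductSpace ℂ K]
    [NormedAddCommGroup K'] [InnerProductSpace ℂ K']
    {π : A →ₗ[ℂ] K →L[ℂ] K} {σ : B →ₗ[ℂ] K →L[ℂ] K} (h : IsCommutingStarPair π σ)
    (hinj : Function.Injective (tensorRep π σ)) {π' : A →ₗ[ℂ] K' →L[ℂ] K'}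
    {σ' : B →ₗ[ℂ] K' →L[ℂ] K'} (h' : IsCommutingStarPair π' σ') (t : A ⊗[ℂ] B) :
    ‖tensorRep π' σ' t‖ ≤ ‖tensorRep π σ t‖ := by
  -- Uniqueness identifies max(p, p) = p with max(p, p'), where p comes from the faithful pair and
  -- p' from the other.
  have := congrFun (hA B _ _ (h.isCStarNorm_max hinj h) (h.isCStarNorm_max hinj h')) t
  simp only [max_self] at this
  rw [this]
  exact le_max_right _ _

end TensorRepresentation

/-! ### The spatial representation on the algebraic Hilbert space tensor product -/

section SpatialRepresentation

variable {H : Type*} [NormedAddCommGroup H] [InnerProductSpace ℂ H] [CompleteSpace H]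

/-- A conjugation of a Hilbert space: an antiunitary involution. -/
structure IsConjugation (J : H →L⋆[ℂ] H) : Prop where
  apply_apply : ∀ x, J (J x) = x
  inner_map : ∀ x y, inner ℂ (J x) (J y) = inner ℂ y x

omit [CompleteSpace H] in
theorem IsConjugation.norm_map {J : H →L⋆[ℂ] H} (hJ : IsConjugation J) (x : H) : ‖J x‖ = ‖x‖ := by
  rw [@norm_eq_sqrt_re_inner ℂ, @norm_eq_sqrt_re_inner ℂ _ _ _ _ x, hJ.inner_map]

/-- The transpose `J T⋆ J` of a bounded operator with respect to a conjugation `J`. -/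
noncomputable def transposeOp (J : H →L⋆[ℂ] H) : (H →L[ℂ] H) →ₗ[ℂ] (H →L[ℂ] H) where
  toFun T := J ∘SL (star T) ∘SL J
  map_add' S T := by
    ext x
    simp
  map_smul' c T := by
    ext x
    simp

theorem transposeOp_apply (J : H →L⋆[ℂ] H) (T : H →L[ℂ] H) (x : H) :
    transposeOp J T x = J (star T (J x)) := rfl

theorem IsConjugation.transposeOp_injective {J : H →L⋆[ℂ] H} (hJ : IsConjugation J) :
    Function.Injective (transposeOp J) := by
  intro S T h
  rw [← star_inj]
  ext x
  have := congrArg J (DFunLike.congr_fun h (J x))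
  simpa only [transposeOp_apply, hJ.apply_apply] using this

/-- Composing the conjugate-linear adjoint with `J` on both sides is linear again but reverses
products, which is why it represents `Aᵐᵒᵖ`. -/
theorem IsConjugation.transposeOp_mul {J : H →L⋆[ℂ] H} (hJ : IsConjugation J) (S T : H →L[ℂ] H) :
    transposeOp J (S * T) = transposeOp J T * transposeOp J S := by
  ext x
  simp only [transposeOp_apply, mul_apply_eq_comp, star_mul, hJ.apply_apply]

theorem IsConjugation.inner_transposeOp {J : H →L⋆[ℂ] H} (hJ : IsConjugation J) (T : H →L[ℂ] H)
    (x y : H) : inner ℂ (transposeOp J T x) y = inner ℂ x (transposeOp J (star T) y) := by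
  rw [transposeOp_apply, transposeOp_apply, star_star]
  conv_lhs => rw [← hJ.apply_apply y]
  conv_rhs => rw [← hJ.apply_apply x]
  rw [hJ.inner_map, hJ.inner_map, ContinuousLinearMap.star_eq_adjoint,
    ContinuousLinearMap.adjoint_inner_right]

variable {A : Type*} [NonUnitalCStarAlgebra A] (i : A →⋆ₙₐ[ℂ] (H →L[ℂ] H))

/-- The representation `a ↦ i(a) ⊗ 1` on `H ⊗ H` given by a representation `i` on `H`. -/
noncomputable def spatialLeft : A →ₗ[ℂ] (H ⊗[ℂ] H →L[ℂ] H ⊗[ℂ] H) where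
  toFun a := (i a).rTensor H
  map_add' a b := by simp
  map_smul' c a := by simp

/-- The representation `b ↦ 1 ⊗ i(b)ᵗ` of the opposite algebra on `H ⊗ H` given by a
representation `i` on `H`. -/
noncomputable def spatialRight (J : H →L⋆[ℂ] H) : Aᵐᵒᵖ →ₗ[ℂ] (H ⊗[ℂ] H →L[ℂ] H ⊗[ℂ] H) where
  toFun b := (transposeOp J (i b.unop)).lTensor H
  map_add' a b := by simp
  map_smul' c b := by simp

variable {i}

@[simp]
theorem spatialLeft_tmul (a : A) (x y : H) : spatialLeft i a (x ⊗ₜ y) = i a x ⊗ₜ y := rfl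

@[simp]
theorem spatialRight_tmul (J : H →L⋆[ℂ] H) (b : Aᵐᵒᵖ) (x y : H) :
    spatialRight i J b (x ⊗ₜ y) = x ⊗ₜ transposeOp J (i b.unop) y := rfl

omit [CompleteSpace H] in
theorem clm_tmul_ext {S T : H ⊗[ℂ] H →L[ℂ] H ⊗[ℂ] H}
    (h : ∀ x y, S (x ⊗ₜ y) = T (x ⊗ₜ y)) : S = T :=
  ContinuousLinearMap.coe_inj.1 (TensorProduct.ext' h)

omit [CompleteSpace H] in
theorem inner_eq_of_tmul {S T : H ⊗[ℂ] H →L[ℂ] H ⊗[ℂ] H}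
    (h : ∀ x y x' y', inner ℂ (S (x ⊗ₜ y)) (x' ⊗ₜ y') = inner ℂ (x ⊗ₜ y) (T (x' ⊗ₜ y')))
    (s t : H ⊗[ℂ] H) : inner ℂ (S s) t = inner ℂ s (T t) := by
  induction s with
  | zero => simp
  | add s s' hs hs' => rw [map_add, inner_add_left, inner_add_left, hs, hs']
  | tmul x y =>
    induction t with
    | zero => simp
    | add s s' hs hs' => rw [map_add, inner_add_right, inner_add_right, hs, hs']
    | tmul x' y' => exact h x y x' y'

theorem isCommutingStarPair_spatial {J : H →L⋆[ℂ] H} 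
    (hJ : IsConjugation J) : IsCommutingStarPair (spatialLeft i) (spatialRight i J) where
  left_mul a b := clm_tmul_ext fun x y => by simp
  right_mul a b := clm_tmul_ext fun x y => by simp [hJ.transposeOp_mul]
  comm a b := clm_tmul_ext fun x y => by simp
  left_star a := inner_eq_of_tmul fun x y x' y' => by
    simp [map_star, ContinuousLinearMap.star_eq_adjoint, ContinuousLinearMap.adjoint_inner_right]
  right_star b := inner_eq_of_tmul fun x y x' y' => by
    simp [map_star, hJ.inner_transposeOp]

/-- Write t = ∑ c_j ⊗ e_j with e a basis of `Aᵐᵒᵖ`. Slicing the first leg by the functional ⟨x', ·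
x⟩ leaves ∑ ⟨x', i(c_j) x⟩ e_j = 0, and linear independence forces every matrix coefficient of
i(c_j) to vanish. -/
theorem tensorRep_spatial_injective (hi : Function.Injective i) {J : H →L⋆[ℂ] H}
    (hJ : IsConjugation J) :
    Function.Injective (tensorRep (spatialLeft i) (spatialRight i J)) := by
  rw [injective_iff_map_eq_zero]
  intro t ht
  let e := Module.Basis.ofVectorSpace ℂ Aᵐᵒᵖ
  obtain ⟨c, rfl⟩ := TensorProduct.eq_repr_basis_right e t
  have key (x x' : H) : ∑ j ∈ c.support, inner ℂ x' (i (c j) x) • e j = 0 := by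
    suffices h : transposeOp J (i (∑ j ∈ c.support, inner ℂ x' (i (c j) x) • e j).unop) = 0 from
      unop_injective (hi (hJ.transposeOp_injective
        (h.trans ((congrArg _ (map_zero i)).trans (map_zero _)).symm)))
    ext y
    refine ext_inner_left ℂ fun y' => ?_
    have h := congrArg (inner ℂ (x' ⊗ₜ[ℂ] y')) (DFunLike.congr_fun ht (x ⊗ₜ[ℂ] y))
    simpa [Finsupp.sum, inner_sum, Finset.unop_sum, inner_smul_right] using h
  have hc : c = 0 := by
    ext j : 1
    by_contra hj
    refine hj (hi (ContinuousLinearMap.ext fun x => ext_inner_left ℂ fun x' => ?_))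
    have := linearIndependent_iff'.1 e.linearIndependent c.support _ (key x x') j
      (Finsupp.mem_support_iff.2 hj)
    simpa using this
  simp [hc]

end SpatialRepresentation

/-! ### The left regular representation and the reduced group C⋆-algebra -/

section LeftRegular

variable {G : Type u} [Group G] [TopologicalSpace G] [IsTopologicalGroup G]
  [MeasurableSpace G] [BorelSpace G] (μ : Measure G) [μ.IsHaarMeasure]

theorem leftRegular_mul_apply (s t : G) (ξ : Lp ℂ 2 μ) :
    leftRegular μ (s * t) ξ = leftRegular μ s (leftRegular μ t ξ) := by
  have h := Lp.compMeasurePreserving_comp_apply (p := 2) ξ (measurePreserving_mul_left μ t⁻¹)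
    (measurePreserving_mul_left μ s⁻¹)
  refine Eq.trans ?_ h
  change Lp.compMeasurePreserving _ _ ξ = _
  congr 2
  ext x
  simp [mul_assoc]

@[simp]
theorem leftRegular_one_apply (ξ : Lp ℂ 2 μ) : leftRegular μ 1 ξ = ξ := by
  have h := Lp.compMeasurePreserving_id_apply ξ
  refine Eq.trans ?_ h
  change Lp.compMeasurePreserving _ _ ξ = _
  congr 2
  ext x
  simp

@[simp]
theorem leftRegular_inv_apply_apply (s : G) (ξ : Lp ℂ 2 μ) :
    leftRegular μ s⁻¹ (leftRegular μ s ξ) = ξ := by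
  rw [← leftRegular_mul_apply, inv_mul_cancel, leftRegular_one_apply]

@[simp]
theorem leftRegular_apply_inv_apply (s : G) (ξ : Lp ℂ 2 μ) :
    leftRegular μ s (leftRegular μ s⁻¹ ξ) = ξ := by
  rw [← leftRegular_mul_apply, mul_inv_cancel, leftRegular_one_apply]

theorem inner_leftRegular (s : G) (ξ η : Lp ℂ 2 μ) :
    inner ℂ (leftRegular μ s ξ) η = inner ℂ ξ (leftRegular μ s⁻¹ η) := by
  rw [← (leftRegular μ s).inner_map_map ξ, leftRegular_apply_inv_apply]

/-- The left regular representation with values in the bounded operators. -/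
noncomputable def leftRegularL (s : G) : Lp ℂ 2 μ →L[ℂ] Lp ℂ 2 μ :=
  (leftRegular μ s).toContinuousLinearMap

@[simp]
theorem leftRegularL_apply (s : G) (ξ : Lp ℂ 2 μ) : leftRegularL μ s ξ = leftRegular μ s ξ := rfl

theorem leftRegularL_mul (s t : G) : leftRegularL μ (s * t) = leftRegularL μ s * leftRegularL μ t :=
  ContinuousLinearMap.ext fun ξ => leftRegular_mul_apply μ s t ξ

theorem leftRegularL_one : leftRegularL μ 1 = 1 :=
  ContinuousLinearMap.ext fun ξ => leftRegular_one_apply μ ξ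

theorem star_leftRegularL (s : G) : star (leftRegularL μ s) = leftRegularL μ s⁻¹ := by
  rw [ContinuousLinearMap.star_eq_adjoint, eq_comm, ContinuousLinearMap.eq_adjoint_iff]
  intro ξ η
  rw [leftRegularL_apply, inner_leftRegular, inv_inv, leftRegularL_apply]

/-- Left translation `(s · f)(t) = f (s⁻¹ * t)` of a compactly supported continuous function. -/
def compactLeftTranslate {E : Type*} [Zero E] [TopologicalSpace E] (s : G) (f : C_c(G, E)) :
    C_c(G, E) where
  toFun t := f (s⁻¹ * t)
  continuous_toFun := f.continuous.comp (continuous_const_mul _)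
  hasCompactSupport' := f.hasCompactSupport.comp_homeomorph (Homeomorph.mulLeft s⁻¹)

/-- Right translation `t ↦ f (t * s)` of a compactly supported continuous function. -/
def compactRightTranslate {E : Type*} [Zero E] [TopologicalSpace E] (s : G) (f : C_c(G, E)) :
    C_c(G, E) where
  toFun t := f (t * s)
  continuous_toFun := f.continuous.comp (continuous_mul_const _)
  hasCompactSupport' := f.hasCompactSupport.comp_homeomorph (Homeomorph.mulRight s)

omit [IsTopologicalGroup G] [MeasurableSpace G] [BorelSpace G] in
@[simp]
theorem compactLeftTranslate_apply [IsTopologicalGroup G] {E : Type*} [Zero E] [TopologicalSpace E]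
    (s : G) (f : C_c(G, E)) (t : G) : compactLeftTranslate s f t = f (s⁻¹ * t) := rfl

omit [IsTopologicalGroup G] [MeasurableSpace G] [BorelSpace G] in
@[simp]
theorem compactRightTranslate_apply [IsTopologicalGroup G] {E : Type*} [Zero E]
    [TopologicalSpace E] (s : G) (f : C_c(G, E)) (t : G) :
    compactRightTranslate s f t = f (t * s) := rfl

variable [LocallyCompactSpace G] [μ.Regular]

theorem leftConvolution_apply (f : C_c(G, ℂ)) (ξ : Lp ℂ 2 μ) :
    leftConvolution μ f ξ = ∫ s, f s • leftRegular μ s ξ ∂μ := rfl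

theorem leftRegularL_mul_leftConvolution (s : G) (f : C_c(G, ℂ)) :
    leftRegularL μ s * leftConvolution μ f = leftConvolution μ (compactLeftTranslate s f) := by
  ext1 ξ
  rw [mul_apply_eq_comp, leftConvolution_apply, leftConvolution_apply,
    ← ContinuousLinearMap.integral_comp_comm _ (integrable_smul_leftRegular μ f ξ),
    ← integral_mul_left_eq_self (fun t => compactLeftTranslate s f t • leftRegular μ t ξ) s]
  refine integral_congr_ae (.of_forall fun t => ?_)
  simp [leftRegular_mul_apply]

/-- By uniqueness of Haar measure, right translation multiplies `μ` by a constant. Its value does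
not matter, since only membership in C*_r(G) will be used. -/
theorem exists_leftConvolution_mul_leftRegularL (s : G) (f : C_c(G, ℂ)) :
    ∃ c : ℂ, leftConvolution μ f * leftRegularL μ s =
      c • leftConvolution μ (compactRightTranslate s⁻¹ f) := by
  have : (μ.map (· * s)).Regular := Measure.Regular.map (Homeomorph.mulRight s)
  have h := Measure.isMulLeftInvariant_eq_smul_of_regular (μ.map (· * s)) μ
  refine ⟨((μ.map (· * s)).haarScalarFactor μ : ℝ), ?_⟩
  ext1 ξ
  rw [mul_apply_eq_comp, leftConvolution_apply, _root_.smul_apply,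
    leftConvolution_apply]
  have h2 := integral_smul_nnreal_measure (μ := μ)
    (fun t => f (t * s⁻¹) • leftRegular μ t ξ) ((μ.map (· * s)).haarScalarFactor μ)
  rw [← h, integral_map (by fun_prop)] at h2
  · simp only [mul_inv_cancel_right, leftRegular_mul_apply] at h2
    simp only [leftRegularL_apply, h2]
    rw [Complex.coe_smul]
    rfl
  · rw [h]
    exact (integrable_smul_leftRegular μ (compactRightTranslate s⁻¹ f) ξ).aestronglyMeasurable.mono_ac
      Measure.smul_absolutelyContinuous

theorem leftConvolution_mem_reducedCStar (f : C_c(G, ℂ)) :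
    leftConvolution μ f ∈ reducedCStar μ :=
  subset_closure (NonUnitalStarAlgebra.subset_adjoin ℂ _ ⟨f, rfl⟩)

theorem isClosed_reducedCStar :
    IsClosed (reducedCStar μ : Set (Lp ℂ 2 μ →L[ℂ] Lp ℂ 2 μ)) :=
  NonUnitalStarSubalgebra.isClosed_topologicalClosure _

/-- This makes λ_s a multiplier of C*_r(G). Both sides and all `s` are treated together because the
adjoint exchanges left and right and replaces s by s⁻¹. -/
theorem leftRegularL_mul_mem_and (s : G) {T : Lp ℂ 2 μ →L[ℂ] Lp ℂ 2 μ} (hT : T ∈ reducedCStar μ) :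
    leftRegularL μ s * T ∈ reducedCStar μ ∧ T * leftRegularL μ s ∈ reducedCStar μ := by
  revert s
  have hcl := isClosed_reducedCStar μ
  refine closure_minimal (t := {T | ∀ s, leftRegularL μ s * T ∈ reducedCStar μ ∧
    T * leftRegularL μ s ∈ reducedCStar μ}) ?_ ?_ hT
  · intro T hT
    induction hT using NonUnitalStarAlgebra.adjoin_induction with
    | mem x hx =>
      obtain ⟨f, rfl⟩ := hx
      intro s
      refine ⟨?_, ?_⟩
      · rw [leftRegularL_mul_leftConvolution]
        exact leftConvolution_mem_reducedCStar μ _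
      · obtain ⟨c, hc⟩ := exists_leftConvolution_mul_leftRegularL μ s f
        rw [hc]
        exact SMulMemClass.smul_mem c (leftConvolution_mem_reducedCStar μ _)
    | add x y hx hy h1 h2 =>
      intro s
      rw [mul_add, add_mul]
      exact ⟨add_mem (h1 s).1 (h2 s).1, add_mem (h1 s).2 (h2 s).2⟩
    | zero =>
      intro s
      simp
    | mul x y hx hy h1 h2 =>
      intro s
      rw [← mul_assoc, mul_assoc x y]
      exact ⟨mul_mem (h1 s).1 (subset_closure hy), mul_mem (subset_closure hx) (h2 s).2⟩
    | smul c x hx h1 =>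
      intro s
      rw [mul_smul_comm, smul_mul_assoc]
      exact ⟨SMulMemClass.smul_mem c (h1 s).1, SMulMemClass.smul_mem c (h1 s).2⟩
    | star x hx h1 =>
      intro s
      have h2 := star_mem (h1 s⁻¹).1
      have h3 := star_mem (h1 s⁻¹).2
      rw [star_mul, star_leftRegularL, inv_inv] at h2 h3
      exact ⟨h3, h2⟩
  · simp only [Set.ofPred_forall, Set.ofPred_and]
    exact isClosed_iInter fun s => (hcl.preimage (by fun_prop)).inter (hcl.preimage (by fun_prop))

/-- Left multiplication by `λ_s` on `C*_r(G)`. -/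
noncomputable def reducedCStarMulLeft (s : G) : reducedCStar μ →L[ℂ] reducedCStar μ :=
  LinearMap.mkContinuous
    { toFun := fun a => ⟨leftRegularL μ s * a, (leftRegularL_mul_mem_and μ s a.2).1⟩
      map_add' := fun _ _ => Subtype.ext (mul_add _ _ _)
      map_smul' := fun _ _ => Subtype.ext (mul_smul_comm _ _ _) } ‖leftRegularL μ s‖
    fun a => norm_mul_le (leftRegularL μ s) (a : Lp ℂ 2 μ →L[ℂ] Lp ℂ 2 μ)

/-- Right multiplication by `λ_s` on `C*_r(G)`. -/
noncomputable def reducedCStarMulRight (s : G) : reducedCStar μ →L[ℂ] reducedCStar μ :=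
  LinearMap.mkContinuous
    { toFun := fun a => ⟨a * leftRegularL μ s, (leftRegularL_mul_mem_and μ s a.2).2⟩
      map_add' := fun _ _ => Subtype.ext (add_mul _ _ _)
      map_smul' := fun _ _ => Subtype.ext (smul_mul_assoc _ _ _) } ‖leftRegularL μ s‖
    fun a => (norm_mul_le (a : Lp ℂ 2 μ →L[ℂ] Lp ℂ 2 μ) (leftRegularL μ s)).trans_eq
      (mul_comm _ _)

theorem reducedCStarMulRight_mul (s : G) (a b : reducedCStar μ) :
    reducedCStarMulRight μ s a * b = a * reducedCStarMulLeft μ s b :=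
  Subtype.ext (mul_assoc (a : Lp ℂ 2 μ →L[ℂ] Lp ℂ 2 μ) (leftRegularL μ s) b)

/-- The multiplier of `C*_r(G)` given by the left translation operator by `s`. -/
noncomputable def groupMultiplier (s : G) : 𝓜(ℂ, reducedCStar μ) where
  fst := reducedCStarMulLeft μ s
  snd := reducedCStarMulRight μ s
  central := reducedCStarMulRight_mul μ s

end LeftRegular

/-! ### Complex conjugation on L² -/

section LpConj

variable {α : Type*} [MeasurableSpace α] (μ : Measure α)

/-- Pointwise complex conjugation on `L²(G, μ)`. -/
noncomputable def lpConj : Lp ℂ 2 μ →L⋆[ℂ] Lp ℂ 2 μ :=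
  (starL ℂ : ℂ ≃L⋆[ℂ] ℂ).toContinuousLinearMap.compLpL 2 μ

theorem coeFn_lpConj (ξ : Lp ℂ 2 μ) : lpConj μ ξ =ᵐ[μ] fun x => star (ξ x) :=
  ContinuousLinearMap.coeFn_compLpL _ ξ

theorem isConjugation_lpConj : IsConjugation (lpConj μ) where
  apply_apply ξ := by
    refine Lp.ext ?_
    filter_upwards [coeFn_lpConj μ ξ, coeFn_lpConj μ (lpConj μ ξ)] with x h1 h2
    rw [h2, h1, star_star]
  inner_map ξ η := by
    rw [L2.inner_def, L2.inner_def]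
    refine integral_congr_ae ?_
    filter_upwards [coeFn_lpConj μ ξ, coeFn_lpConj μ η] with x h1 h2
    rw [h1, h2]
    simp [mul_comm]

end LpConj

/-! ### Multipliers acting on non-degenerate bimodules -/

theorem exists_approximateUnit (A : Type*) [NonUnitalCStarAlgebra A] :
    ∃ l : Filter A, l.NeBot ∧ (∀ᶠ e in l, ‖e‖ ≤ 1) ∧ (∀ a, Tendsto (· * a) l (𝓝 a)) ∧
      ∀ a, Tendsto (a * ·) l (𝓝 a) := by
  let _ := CStarAlgebra.spectralOrder A
  let _ := CStarAlgebra.spectralOrderedRing A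
  have hu := CStarAlgebra.increasingApproximateUnit A
  exact ⟨_, hu.neBot, hu.eventually_norm, hu.tendsto_mul_right, hu.tendsto_mul_left⟩

theorem tendsto_apply_of_dense_span {H ι : Type*} [NormedAddCommGroup H] [NormedSpace ℂ H]
    {l : Filter ι} {F : ι → H →L[ℂ] H} (hF : ∀ᶠ i in l, ‖F i‖ ≤ 1) {s : Set H}
    (hs : Dense (Submodule.span ℂ s : Set H)) (h : ∀ x ∈ s, Tendsto (fun i => F i x) l (𝓝 x))
    (x : H) : Tendsto (fun i => F i x) l (𝓝 x) := by
  have hspan : ∀ y ∈ Submodule.span ℂ s, Tendsto (fun i => F i y) l (𝓝 y) := by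
    intro y hy
    induction hy using Submodule.span_induction with
    | mem y hy => exact h y hy
    | zero => simpa only [map_zero] using tendsto_const_nhds
    | add y z _ _ hy hz => simpa only [map_add] using hy.add hz
    | smul c y _ hy => simpa only [map_smul] using hy.const_smul c
  rw [Metric.tendsto_nhds]
  intro ε hε
  obtain ⟨y, hy, hxy⟩ := Metric.dense_iff.1 hs x (ε / 3) (by positivity)
  rw [Metric.mem_ball, dist_eq_norm] at hy
  filter_upwards [hF, Metric.tendsto_nhds.1 (hspan y hxy) (ε / 3) (by positivity)] with i hi hyi
  rw [dist_eq_norm] at hyi ⊢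
  calc ‖F i x - x‖ = ‖(F i y - y) - F i (y - x) + (y - x)‖ := by
        rw [map_sub]
        congr 1
        abel
    _ ≤ ‖F i y - y‖ + ‖F i (y - x)‖ + ‖y - x‖ :=
        (norm_add_le _ _).trans (by gcongr; exact norm_sub_le _ _)
    _ ≤ ‖F i y - y‖ + 1 * ‖y - x‖ + ‖y - x‖ := by
        gcongr
        exact (F i).le_of_opNorm_le hi _
    _ < ε := by linarith


namespace HilbertStarBimodule

variable {A : Type*} [NonUnitalCStarAlgebra A] {H : Type*}
  [NormedAddCommGroup H] [InnerProductSpace ℂ H] [CompleteSpace H] {X : HilbertStarBimodule A H}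

theorem Nondegenerate.ext_left (hX : X.Nondegenerate) {S T : H →L[ℂ] H}
    (h : ∀ a ξ, S (X.left a ξ) = T (X.left a ξ)) : S = T :=
  ContinuousLinearMap.ext_on hX.1 <| by
    rintro _ ⟨a, ξ, rfl⟩
    exact h a ξ

theorem Nondegenerate.ext_right (hX : X.Nondegenerate) {S T : H →L[ℂ] H}
    (h : ∀ a ξ, S (X.right (op a) ξ) = T (X.right (op a) ξ)) : S = T :=
  ContinuousLinearMap.ext_on hX.2 <| by
    rintro _ ⟨a, ξ, rfl⟩
    exact h a ξ

theorem mulRight_left_apply (hX : X.Nondegenerate) (x : 𝓜(ℂ, A)) (a : A) (ξ : H) :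
    X.mulRight x (X.left a ξ) = X.left a (X.mulRight x ξ) := by
  have : X.mulRight x * X.left a = X.left a * X.mulRight x := hX.ext_right fun b η => by
    simp only [mul_apply_eq_comp]
    rw [X.comm, mulRight_apply hX, mulRight_apply hX, X.comm]
  exact DFunLike.congr_fun this ξ

theorem mulLeft_mulRight_comm (hX : X.Nondegenerate) (x y : 𝓜(ℂ, A)) (ξ : H) :
    X.mulLeft x (X.mulRight y ξ) = X.mulRight y (X.mulLeft x ξ) := by
  have : X.mulLeft x * X.mulRight y = X.mulRight y * X.mulLeft x := hX.ext_left fun a η => by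
    simp only [mul_apply_eq_comp]
    rw [mulRight_left_apply hX, mulLeft_apply hX, mulLeft_apply hX, mulRight_left_apply hX]
  exact DFunLike.congr_fun this ξ

theorem mulRight_mul_apply (hX : X.Nondegenerate) (x y : 𝓜(ℂ, A)) (ξ : H) :
    X.mulRight (x * y) ξ = X.mulRight y (X.mulRight x ξ) := by
  have : X.mulRight (x * y) = X.mulRight y * X.mulRight x := hX.ext_right fun a η => by
    simp only [mul_apply_eq_comp]
    rw [mulRight_apply hX, mulRight_apply hX, mulRight_apply hX, DoubleCentralizer.mul_snd]
    rfl
  exact DFunLike.congr_fun this ξ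

theorem mulRight_one_apply (hX : X.Nondegenerate) (ξ : H) : X.mulRight 1 ξ = ξ := by
  have : X.mulRight 1 = 1 := hX.ext_right fun a η => by
    rw [mulRight_apply hX, DoubleCentralizer.one_snd]
    rfl
  exact DFunLike.congr_fun this ξ

theorem norm_mulLeft_le (hX : X.Nondegenerate) (x : 𝓜(ℂ, A)) : ‖X.mulLeft x‖ ≤ ‖x‖ :=
  LinearMap.opNorm_extendOfNorm_le (denseRange_leftMap hX) (norm_nonneg _) (X.norm_leftMap_le x)

/-- A central vector is also central for the multipliers. -/
theorem mulLeft_eq_mulRight_of_mem_centralVectors (hX : X.Nondegenerate) {ξ : H}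
    (hξ : ξ ∈ X.centralVectors) (x : 𝓜(ℂ, A)) : X.mulLeft x ξ = X.mulRight x ξ := by
  -- The chain is a·(x·ξ) = (ax)·ξ = ξ·(ax) = (ξ·a)·x = (a·ξ)·x = a·(ξ·x).
  have key (a : A) : X.left a (X.mulLeft x ξ - X.mulRight x ξ) = 0 := by
    have h1 : X.left a (X.mulLeft x ξ) = X.left (x.snd a) ξ := by
      have : X.left a * X.mulLeft x = X.left (x.snd a) := hX.ext_left fun b η => by
        simp only [mul_apply_eq_comp]
        rw [mulLeft_apply hX, ← mul_apply_eq_comp, ← mul_apply_eq_comp, ← map_mul, ← map_mul,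
          x.central]
      exact DFunLike.congr_fun this ξ
    rw [map_sub, h1, ← mulRight_left_apply hX, hξ a, mulRight_apply hX, hξ (x.snd a), sub_self]
  rw [← sub_eq_zero, ← inner_self_eq_zero (𝕜 := ℂ)]
  -- A vector killed by the whole left action is orthogonal to the dense span of all a·η.
  have : innerSL ℂ (X.mulLeft x ξ - X.mulRight x ξ) = 0 := ContinuousLinearMap.ext_on hX.1 <| by
    rintro _ ⟨a, η, rfl⟩
    have h2 := congrArg (inner ℂ · η) (key (star a))
    simp only [inner_zero_left, map_star, ContinuousLinearMap.star_eq_adjoint,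
      ContinuousLinearMap.adjoint_inner_left] at h2
    simpa only [innerSL_apply_apply, zero_apply] using h2
  exact DFunLike.congr_fun this _

theorem continuous_left_apply (X : HilbertStarBimodule A H) (ξ : H) :
    Continuous fun a => X.left a ξ :=
  (ContinuousLinearMap.apply ℂ H ξ).continuous.comp
    (AddMonoidHomClass.continuous_of_bound X.left 1 fun a =>
      (NonUnitalStarAlgHom.norm_apply_le X.left a).trans_eq (one_mul _).symm)

theorem continuous_right_apply (X : HilbertStarBimodule A H) (ξ : H) :
    Continuous fun a => X.right (op a) ξ :=
  (ContinuousLinearMap.apply ℂ H ξ).continuous.comp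
    ((AddMonoidHomClass.continuous_of_bound X.right 1 fun a =>
      (NonUnitalStarAlgHom.norm_apply_le X.right a).trans_eq (one_mul _).symm).comp continuous_op)

theorem tendsto_left_approximateUnit (hX : X.Nondegenerate) {l : Filter A}
    (hl : ∀ᶠ e in l, ‖e‖ ≤ 1) (hmul : ∀ a, Tendsto (· * a) l (𝓝 a)) (ξ : H) :
    Tendsto (fun e => X.left e ξ) l (𝓝 ξ) := by
  refine tendsto_apply_of_dense_span (F := fun e => X.left e) ?_ hX.1 ?_ ξ
  · filter_upwards [hl] with e he using (NonUnitalStarAlgHom.norm_apply_le _ _).trans he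
  · rintro _ ⟨a, η, rfl⟩
    refine (((continuous_left_apply X η).tendsto a).comp (hmul a)).congr fun e => ?_
    simp

theorem tendsto_right_approximateUnit (hX : X.Nondegenerate) {l : Filter A}
    (hl : ∀ᶠ e in l, ‖e‖ ≤ 1) (hmul : ∀ a, Tendsto (a * ·) l (𝓝 a)) (ξ : H) :
    Tendsto (fun e => X.right (op e) ξ) l (𝓝 ξ) := by
  refine tendsto_apply_of_dense_span (F := fun e => X.right (op e)) ?_ hX.2 ?_ ξ
  · filter_upwards [hl] with e he using (NonUnitalStarAlgHom.norm_apply_le _ _).trans he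
  · rintro _ ⟨a, η, rfl⟩
    refine (((continuous_right_apply X η).tendsto a).comp (hmul a)).congr fun e => ?_
    simp

/-- The norm of an operator can be tested on vectors `a · ξ · b`. -/
theorem Nondegenerate.opNorm_le (hX : X.Nondegenerate) (T : H →L[ℂ] H) {C : ℝ} (hC : 0 ≤ C)
    (h : ∀ a b ξ, ‖T (X.left a (X.right (op b) ξ))‖ ≤ C * ‖a‖ * ‖b‖ * ‖ξ‖) : ‖T‖ ≤ C := by
  obtain ⟨l, hl, h1, hr, hr'⟩ := exists_approximateUnit A
  refine T.opNorm_le_bound hC fun ξ => ?_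
  have h2 (b : A) : ‖T (X.right (op b) ξ)‖ ≤ C * ‖b‖ * ‖ξ‖ := by
    refine le_of_tendsto ((T.continuous.tendsto _).comp
      (tendsto_left_approximateUnit hX h1 hr (X.right (op b) ξ))).norm ?_
    filter_upwards [h1] with e he
    refine (h e b ξ).trans ?_
    gcongr
    exact mul_le_of_le_one_right hC he
  refine le_of_tendsto ((T.continuous.tendsto _).comp
    (tendsto_right_approximateUnit hX h1 hr' ξ)).norm ?_
  filter_upwards [h1] with e he
  refine (h2 e).trans ?_
  gcongr
  exact mul_le_of_le_one_right hC he

theorem isCommutingStarPair (X : HilbertStarBimodule A H) :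
    IsCommutingStarPair (X.left : A →ₗ[ℂ] (H →L[ℂ] H)) (X.right : Aᵐᵒᵖ →ₗ[ℂ] (H →L[ℂ] H)) where
  left_mul a b := map_mul X.left a b
  right_mul a b := map_mul X.right a b
  comm a b := ContinuousLinearMap.ext fun ξ => X.comm a b.unop ξ
  left_star a x y := by
    change inner ℂ (X.left a x) y = inner ℂ x (X.left (star a) y)
    rw [map_star, ContinuousLinearMap.star_eq_adjoint, ContinuousLinearMap.adjoint_inner_right]
  right_star a x y := by
    change inner ℂ (X.right a x) y = inner ℂ x (X.right (star a) y)
    rw [map_star, ContinuousLinearMap.star_eq_adjoint, ContinuousLinearMap.adjoint_inner_right]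

end HilbertStarBimodule

/-! ### Almost central nets over a nuclear reduced group C⋆-algebra -/

section Spatial

variable {H : Type*} [NormedAddCommGroup H] [InnerProductSpace ℂ H] [CompleteSpace H]

theorem IsConjugation.norm_transposeOp_le {J : H →L⋆[ℂ] H} (hJ : IsConjugation J)
    (T : H →L[ℂ] H) : ‖transposeOp J T‖ ≤ ‖T‖ :=
  ContinuousLinearMap.opNorm_le_bound _ (norm_nonneg _) fun x => by
    rw [transposeOp_apply, hJ.norm_map, ← norm_star T, ← hJ.norm_map x]
    exact ContinuousLinearMap.le_opNorm _ _

/-- If a sum of `n` contractions has norm at least `n`, then these contractions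
almost coincide on some unit vector. -/
theorem exists_unit_norm_sub_le {K ι : Type*} [NormedAddCommGroup K] [InnerProductSpace ℂ K]
    (S : Finset ι) (hS : S.Nonempty) (u : ι → K →L[ℂ] K) (hu : ∀ s x, ‖u s x‖ ≤ ‖x‖)
    (h : (S.card : ℝ) ≤ ‖∑ s ∈ S, u s‖) {ε : ℝ} (hε : 0 < ε) :
    ∃ x : K, ‖x‖ = 1 ∧ ∀ s ∈ S, ∀ t ∈ S, ‖u s x - u t x‖ ≤ ε := by
  classical
  have hcard : (1 : ℝ) ≤ S.card := by exact_mod_cast hS.card_pos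
  -- If ‖u_s x + u_t x‖ > 2 - δ, the parallelogram law gives ‖u_s x - u_t x‖² ≤ 4 - (2 - δ)² ≤ 4δ ≤
  -- ε². The bound δ ≤ 1 keeps |S| - δ nonnegative, so that the vector `y` below is nonzero.
  set δ : ℝ := min 1 (ε ^ 2 / 4) with hδ
  have hδ0 : 0 < δ := lt_min one_pos (by positivity)
  have hδ1 : δ ≤ 1 := min_le_left _ _
  have hδε : δ ≤ ε ^ 2 / 4 := min_le_right _ _
  obtain ⟨y, hy1, hy⟩ := ContinuousLinearMap.exists_lt_apply_of_lt_opNorm (∑ s ∈ S, u s)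
    (show S.card - δ < ‖∑ s ∈ S, u s‖ by linarith)
  have hy0 : 0 < ‖y‖ := by
    rw [norm_pos_iff]
    rintro rfl
    rw [map_zero, norm_zero] at hy
    linarith
  set x : K := ((‖y‖⁻¹ : ℝ) : ℂ) • y with hx
  have hxn : ‖x‖ = 1 := by
    rw [hx, norm_smul, Complex.norm_real, norm_inv, norm_norm, inv_mul_cancel₀ hy0.ne']
  have hxS : S.card - δ < ‖(∑ s ∈ S, u s) x‖ := by
    rw [hx, map_smul, norm_smul, Complex.norm_real, norm_inv, norm_norm]
    refine hy.trans_le ?_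
    exact le_mul_of_one_le_left (norm_nonneg _) ((one_le_inv₀ hy0).2 hy1.le)
  refine ⟨x, hxn, fun s hs t ht => ?_⟩
  rcases eq_or_ne s t with rfl | hst
  · simpa using hε.le
  have h1 : 2 - δ < ‖u s x + u t x‖ := by
    have hsplit : (∑ r ∈ S, u r) x = (u s x + u t x) + ∑ r ∈ (S.erase s).erase t, u r x := by
      rw [_root_.sum_apply, ← Finset.add_sum_erase S _ hs,
        ← Finset.add_sum_erase (S.erase s) _ (Finset.mem_erase.2 ⟨hst.symm, ht⟩), add_assoc]
    have hrest : ‖∑ r ∈ (S.erase s).erase t, u r x‖ ≤ S.card - 2 := by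
      refine (norm_sum_le_of_le _ fun r _ => (hu r x).trans_eq hxn).trans_eq ?_
      have h2 := Finset.card_erase_add_one hs
      have h3 := Finset.card_erase_add_one (Finset.mem_erase.2 ⟨hst.symm, ht⟩)
      simp only [Finset.sum_const, nsmul_eq_mul, mul_one]
      rw [← h2, ← h3]
      push_cast
      ring
    rw [hsplit] at hxS
    have := norm_add_le (u s x + u t x) (∑ r ∈ (S.erase s).erase t, u r x)
    linarith
  have h2 := parallelogram_law_with_norm ℂ (u s x) (u t x)
  have h3 := hu s x
  have h4 := hu t x
  rw [hxn] at h3 h4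
  refine le_of_sq_le_sq ?_ hε.le
  nlinarith [norm_nonneg (u s x), norm_nonneg (u t x)]

/-- Over a nuclear C⋆-algebra, operators `∑ x_s · ξ · y_s` with multipliers `x_s`, `y_s` on a
bimodule are bounded by the corresponding operator in a spatial representation. -/
theorem IsNuclear.norm_sum_mulLeft_mul_mulRight_le {A : Type u} [NonUnitalCStarAlgebra A]
    (hnuc : IsNuclear A) {i : A →⋆ₙₐ[ℂ] (H →L[ℂ] H)} (hi : Function.Injective i)
    {J : H →L⋆[ℂ] H} (hJ : IsConjugation J) {H' : Type*} [NormedAddCommGroup H']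
    [InnerProductSpace ℂ H'] [CompleteSpace H'] {X : HilbertStarBimodule A H'}
    (hX : X.Nondegenerate) {ι : Type*} (S : Finset ι) (x y : ι → 𝓜(ℂ, A)) (u v : ι → H →L[ℂ] H)
    (hu : ∀ s a, i ((x s).fst a) = u s * i a) (hv : ∀ s b, i ((y s).snd b) = i b * v s) :
    ‖∑ s ∈ S, X.mulLeft (x s) * X.mulRight (y s)‖ ≤
      ‖∑ s ∈ S, (u s).rTensor H * (transposeOp J (v s)).lTensor H‖ := by
  refine hX.opNorm_le _ (ContinuousLinearMap.opNorm_nonneg _) fun a b ξ => ?_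
  -- Nuclearity speaks of A ⊗ Aᵐᵒᵖ only. Testing on vectors a·ξ·b absorbs the multipliers into this
  -- element of it.
  set t : A ⊗[ℂ] Aᵐᵒᵖ := ∑ s ∈ S, (x s).fst a ⊗ₜ op ((y s).snd b) with ht
  have h1 : (∑ s ∈ S, X.mulLeft (x s) * X.mulRight (y s)) (X.left a (X.right (op b) ξ)) = tensorRep
      (X.left : A →ₗ[ℂ] (H' →L[ℂ] H')) (X.right : Aᵐᵒᵖ →ₗ[ℂ] (H' →L[ℂ] H')) t ξ := by
    rw [ht, map_sum, _root_.sum_apply, _root_.sum_apply]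
    refine Finset.sum_congr rfl fun s _ => ?_
    rw [tensorRep_tmul, mul_apply_eq_comp, mul_apply_eq_comp,
      HilbertStarBimodule.mulRight_left_apply hX, HilbertStarBimodule.mulRight_apply hX,
      HilbertStarBimodule.mulLeft_apply hX]
    rfl
  have h2 : tensorRep (spatialLeft i) (spatialRight i J) t =
      (∑ s ∈ S, (u s).rTensor H * (transposeOp J (v s)).lTensor H) *
        (spatialLeft i a * spatialRight i J (op b)) := by
    rw [ht, map_sum, Finset.sum_mul]
    refine Finset.sum_congr rfl fun s _ => clm_tmul_ext fun ξ η => ?_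
    simp [hu, hv, hJ.transposeOp_mul]
  have h3 : ‖spatialLeft i a‖ ≤ ‖a‖ :=
    (ContinuousLinearMap.norm_rTensor_le _ _).trans (NonUnitalStarAlgHom.norm_apply_le i a)
  have h4 : ‖spatialRight i J (op b)‖ ≤ ‖b‖ :=
    (ContinuousLinearMap.norm_lTensor_le _ _).trans
      ((hJ.norm_transposeOp_le _).trans (NonUnitalStarAlgHom.norm_apply_le i b))
  rw [h1]
  refine ContinuousLinearMap.le_of_opNorm_le _ ?_ ξ
  refine (hnuc.norm_tensorRep_le (isCommutingStarPair_spatial hJ)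
    (tensorRep_spatial_injective hi hJ) X.isCommutingStarPair t).trans ?_
  rw [h2, mul_assoc]
  exact (norm_mul_le _ _).trans (mul_le_mul_of_nonneg_left ((norm_mul_le _ _).trans
    (mul_le_mul h3 h4 (ContinuousLinearMap.opNorm_nonneg _) (norm_nonneg _)))
    (ContinuousLinearMap.opNorm_nonneg _))

/-- On an almost central unit vector, x·ξ·y is close to ξ·(xy) = ξ, so the sum sends ξ close to |S|
ξ. -/
theorem card_le_norm_sum_mulLeft_mul_mulRight {A : Type*} [NonUnitalCStarAlgebra A]
    {X : HilbertStarBimodule A H} (hX : X.Nondegenerate)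
    (hcent : ∀ (F : Finset 𝓜(ℂ, A)) (ε : ℝ), 0 < ε →
      ∃ ξ : H, ‖ξ‖ = 1 ∧ ∀ x ∈ F, ‖X.mulLeft x ξ - X.mulRight x ξ‖ ≤ ε)
    {ι : Type*} (S : Finset ι) (x y : ι → 𝓜(ℂ, A)) (hxy : ∀ s, x s * y s = 1) :
    (S.card : ℝ) ≤ ‖∑ s ∈ S, X.mulLeft (x s) * X.mulRight (y s)‖ := by
  classical
  set T : H →L[ℂ] H := ∑ s ∈ S, X.mulLeft (x s) * X.mulRight (y s) with hT
  set C : ℝ := ∑ s ∈ S, ‖X.mulRight (y s)‖ with hC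
  refine le_of_forall_pos_le_add fun δ hδ => ?_
  have hC0 : 0 ≤ C := Finset.sum_nonneg fun _ _ => norm_nonneg _
  obtain ⟨ξ, hξ1, hξ⟩ := hcent (S.image x) (δ / (C + 1)) (by positivity)
  have hdiff : ‖T ξ - (S.card : ℂ) • ξ‖ ≤ δ := by
    have h1 : T ξ - (S.card : ℂ) • ξ = ∑ s ∈ S, X.mulRight (y s)
        (X.mulLeft (x s) ξ - X.mulRight (x s) ξ) := by
      rw [Nat.cast_smul_eq_nsmul, ← Finset.sum_const, hT, _root_.sum_apply,
        ← Finset.sum_sub_distrib]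
      refine Finset.sum_congr rfl fun s _ => ?_
      rw [map_sub, ← HilbertStarBimodule.mulRight_mul_apply hX, hxy,
        HilbertStarBimodule.mulRight_one_apply hX, ← HilbertStarBimodule.mulLeft_mulRight_comm hX]
      rfl
    rw [h1]
    refine (norm_sum_le_of_le _ fun s hs => (ContinuousLinearMap.le_opNorm _ _).trans
      (mul_le_mul_of_nonneg_left (hξ _ (Finset.mem_image_of_mem _ hs)) (norm_nonneg _))).trans ?_
    rw [← Finset.sum_mul, ← hC, mul_div_assoc', div_le_iff₀ (by positivity)]
    nlinarith
  have h6 : ‖(S.card : ℂ) • ξ‖ = S.card := by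
    rw [norm_smul, hξ1, mul_one, Complex.norm_natCast]
  have h7 := T.le_opNorm ξ
  rw [hξ1, mul_one] at h7
  have h8 := norm_sub_norm_le ((S.card : ℂ) • ξ) (T ξ)
  rw [norm_sub_rev, h6] at h8
  linarith

end Spatial

/-! ### The unitaries λ_s ⊗ (λ_{s⁻¹})ᵗ and the norm of their sums -/

section AlmostCentral

variable {G : Type u} [Group G] [TopologicalSpace G] [IsTopologicalGroup G]
  [MeasurableSpace G] [BorelSpace G] (μ : Measure G) [μ.IsHaarMeasure]

/-- The unitary `λ_s ⊗ (λ_{s⁻¹})ᵗ` on the algebraic tensor product `L²(G) ⊗ L²(G)`. -/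
noncomputable def spatialConj (s : G) :
    Lp ℂ 2 μ ⊗[ℂ] Lp ℂ 2 μ →L[ℂ] Lp ℂ 2 μ ⊗[ℂ] Lp ℂ 2 μ :=
  (leftRegularL μ s).rTensor _ * (transposeOp (lpConj μ) (leftRegularL μ s⁻¹)).lTensor _

theorem norm_spatialConj_apply_le (s : G) (x : Lp ℂ 2 μ ⊗[ℂ] Lp ℂ 2 μ) :
    ‖spatialConj μ s x‖ ≤ ‖x‖ := by
  have h1 (t : G) : ‖leftRegularL μ t‖ ≤ 1 :=
    ContinuousLinearMap.opNorm_le_bound _ zero_le_one fun ξ => by simp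
  have h2 : ‖(leftRegularL μ s).rTensor (Lp ℂ 2 μ)‖ ≤ 1 :=
    (ContinuousLinearMap.norm_rTensor_le _ _).trans (h1 s)
  have h3 : ‖(transposeOp (lpConj μ) (leftRegularL μ s⁻¹)).lTensor (Lp ℂ 2 μ)‖ ≤ 1 :=
    (ContinuousLinearMap.norm_lTensor_le _ _).trans
      (((isConjugation_lpConj μ).norm_transposeOp_le _).trans (h1 _))
  have h4 : ‖spatialConj μ s‖ ≤ 1 := (ContinuousLinearMap.opNorm_comp_le _ _).trans
    ((mul_le_mul h2 h3 (ContinuousLinearMap.opNorm_nonneg _) zero_le_one).trans_eq (one_mul 1))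
  simpa using (spatialConj μ s).le_of_opNorm_le h4 x

theorem spatialConj_one_apply (x : Lp ℂ 2 μ ⊗[ℂ] Lp ℂ 2 μ) : spatialConj μ 1 x = x := by
  have : transposeOp (lpConj μ) 1 = 1 := by
    ext1 ξ
    simp [transposeOp_apply, (isConjugation_lpConj μ).apply_apply]
  simp [spatialConj, leftRegularL_one, this]

variable [LocallyCompactSpace G] [μ.Regular]

theorem groupMultiplier_mul_inv (s : G) : groupMultiplier μ s * groupMultiplier μ s⁻¹ = 1 := by
  refine DoubleCentralizer.ext ℂ _ _ _ (Prod.ext ?_ ?_)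
  · refine ContinuousLinearMap.ext fun a => Subtype.ext ?_
    change leftRegularL μ s * (leftRegularL μ s⁻¹ * (a : Lp ℂ 2 μ →L[ℂ] Lp ℂ 2 μ)) = a
    rw [← mul_assoc, ← leftRegularL_mul, mul_inv_cancel, leftRegularL_one, one_mul]
  · refine ContinuousLinearMap.ext fun a => Subtype.ext ?_
    change ((a : Lp ℂ 2 μ →L[ℂ] Lp ℂ 2 μ) * leftRegularL μ s) * leftRegularL μ s⁻¹ = a
    rw [mul_assoc, ← leftRegularL_mul, mul_inv_cancel, leftRegularL_one, mul_one]

/-- The inclusion of `C*_r(G)` into the bounded operators on `L²(G)`. -/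
noncomputable def reducedCStarInclusion :
    reducedCStar μ →⋆ₙₐ[ℂ] (Lp ℂ 2 μ →L[ℂ] Lp ℂ 2 μ) :=
  NonUnitalStarSubalgebraClass.subtype (reducedCStar μ)

theorem reducedCStarInclusion_injective : Function.Injective (reducedCStarInclusion μ) :=
  Subtype.val_injective

/-- Almost central vectors give the lower bound inside the bimodule, and nuclearity transfers it to
the spatial representation. -/
theorem card_le_norm_sum_spatialConj (hnuc : IsNuclear (reducedCStar μ)) {H : Type u}
    [NormedAddCommGroup H] [InnerProductSpace ℂ H] [CompleteSpace H]
    {X : HilbertStarBimodule (reducedCStar μ) H} (hX : X.Nondegenerate)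
    (hcent : ∀ (F : Finset 𝓜(ℂ, reducedCStar μ)) (ε : ℝ), 0 < ε →
      ∃ ξ : H, ‖ξ‖ = 1 ∧ ∀ x ∈ F, ‖X.mulLeft x ξ - X.mulRight x ξ‖ ≤ ε) (S : Finset G) :
    (S.card : ℝ) ≤ ‖∑ s ∈ S, spatialConj μ s‖ :=
  (card_le_norm_sum_mulLeft_mul_mulRight hX hcent S (groupMultiplier μ)
    (fun s => groupMultiplier μ s⁻¹) (groupMultiplier_mul_inv μ)).trans
  (hnuc.norm_sum_mulLeft_mul_mulRight_le (i := reducedCStarInclusion μ)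
    (reducedCStarInclusion_injective μ) (isConjugation_lpConj μ) hX S
    (groupMultiplier μ) (fun s => groupMultiplier μ s⁻¹) (leftRegularL μ)
    (fun s => leftRegularL μ s⁻¹) (fun _ _ => rfl) (fun _ _ => rfl))

end AlmostCentral

/-! ### Invariant means from almost invariant vectors -/

section MultiplicationOperator

variable {α : Type*} [TopologicalSpace α] [MeasurableSpace α] [BorelSpace α] (μ : Measure α)

theorem memLp_boundedContinuous_mul (φ : α →ᵇ ℝ) (ξ : Lp ℂ 2 μ) :
    MemLp (fun x => (φ x : ℂ) * ξ x) 2 μ := by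
  refine MemLp.of_le_mul (c := ‖φ‖) (Lp.memLp ξ) ?_ (.of_forall fun x => ?_)
  · exact (Complex.measurable_ofReal.comp φ.continuous.measurable).aestronglyMeasurable.mul
      (Lp.aestronglyMeasurable ξ)
  · rw [norm_mul, Complex.norm_real]
    gcongr
    exact φ.norm_coe_le_norm x

/-- Multiplication by a bounded continuous function on `L²`. -/
noncomputable def mulOp (φ : α →ᵇ ℝ) : Lp ℂ 2 μ →L[ℂ] Lp ℂ 2 μ :=
  LinearMap.mkContinuous
    { toFun := fun ξ => (memLp_boundedContinuous_mul μ φ ξ).toLp _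
      map_add' := fun ξ η => by
        refine Lp.ext ?_
        filter_upwards [(memLp_boundedContinuous_mul μ φ (ξ + η)).coeFn_toLp,
          (memLp_boundedContinuous_mul μ φ ξ).coeFn_toLp,
          (memLp_boundedContinuous_mul μ φ η).coeFn_toLp, Lp.coeFn_add ξ η,
          Lp.coeFn_add ((memLp_boundedContinuous_mul μ φ ξ).toLp _)
            ((memLp_boundedContinuous_mul μ φ η).toLp _)] with x h1 h2 h3 h4 h5
        rw [h1, h5, Pi.add_apply, h2, h3, h4, Pi.add_apply, mul_add]
      map_smul' := fun c ξ => by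
        refine Lp.ext ?_
        filter_upwards [(memLp_boundedContinuous_mul μ φ (c • ξ)).coeFn_toLp,
          (memLp_boundedContinuous_mul μ φ ξ).coeFn_toLp, Lp.coeFn_smul c ξ,
          Lp.coeFn_smul c ((memLp_boundedContinuous_mul μ φ ξ).toLp _)] with x h1 h2 h3 h4
        rw [h1, RingHom.id_apply, h4, Pi.smul_apply, h2, h3, Pi.smul_apply, smul_eq_mul,
          smul_eq_mul, mul_left_comm] }
    ‖φ‖ fun ξ => by
      refine Lp.norm_le_mul_norm_of_ae_le_mul ?_
      filter_upwards [(memLp_boundedContinuous_mul μ φ ξ).coeFn_toLp] with x hx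
      change ‖((memLp_boundedContinuous_mul μ φ ξ).toLp _ : α → ℂ) x‖ ≤ _
      rw [hx, norm_mul, Complex.norm_real]
      gcongr
      exact φ.norm_coe_le_norm x

theorem coeFn_mulOp (φ : α →ᵇ ℝ) (ξ : Lp ℂ 2 μ) :
    mulOp μ φ ξ =ᵐ[μ] fun x => (φ x : ℂ) * ξ x :=
  (memLp_boundedContinuous_mul μ φ ξ).coeFn_toLp

theorem norm_mulOp_le (φ : α →ᵇ ℝ) : ‖mulOp μ φ‖ ≤ ‖φ‖ :=
  LinearMap.mkContinuous_norm_le _ (norm_nonneg _) _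

theorem mulOp_add (φ ψ : α →ᵇ ℝ) : mulOp μ (φ + ψ) = mulOp μ φ + mulOp μ ψ := by
  refine ContinuousLinearMap.ext fun ξ => Lp.ext ?_
  filter_upwards [coeFn_mulOp μ (φ + ψ) ξ, coeFn_mulOp μ φ ξ, coeFn_mulOp μ ψ ξ,
    Lp.coeFn_add (mulOp μ φ ξ) (mulOp μ ψ ξ)] with x h1 h2 h3 h4
  rw [h1, BoundedContinuousFunction.add_apply, Complex.ofReal_add, add_mul, ← h2, ← h3]
  exact h4.symm

theorem mulOp_smul (c : ℝ) (φ : α →ᵇ ℝ) : mulOp μ (c • φ) = (c : ℂ) • mulOp μ φ := by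
  refine ContinuousLinearMap.ext fun ξ => Lp.ext ?_
  filter_upwards [coeFn_mulOp μ (c • φ) ξ, coeFn_mulOp μ φ ξ,
    Lp.coeFn_smul (c : ℂ) (mulOp μ φ ξ)] with x h1 h2 h3
  rw [h1, BoundedContinuousFunction.smul_apply, smul_eq_mul, Complex.ofReal_mul, mul_assoc, ← h2]
  exact h3.symm

theorem mulOp_mul (φ ψ : α →ᵇ ℝ) : mulOp μ (φ * ψ) = mulOp μ φ * mulOp μ ψ := by
  refine ContinuousLinearMap.ext fun ξ => Lp.ext ?_
  filter_upwards [coeFn_mulOp μ (φ * ψ) ξ, coeFn_mulOp μ φ (mulOp μ ψ ξ),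
    coeFn_mulOp μ ψ ξ] with x h1 h2 h3
  rw [h1, mul_apply_eq_comp, h2, h3, BoundedContinuousFunction.mul_apply, Complex.ofReal_mul,
    mul_assoc]

theorem mulOp_one : mulOp μ (1 : α →ᵇ ℝ) = 1 := by
  refine ContinuousLinearMap.ext fun ξ => Lp.ext ?_
  filter_upwards [coeFn_mulOp μ 1 ξ] with x h1
  simpa using h1

theorem inner_mulOp (φ : α →ᵇ ℝ) (ξ η : Lp ℂ 2 μ) :
    inner ℂ (mulOp μ φ ξ) η = inner ℂ ξ (mulOp μ φ η) := by
  rw [L2.inner_def, L2.inner_def]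
  refine integral_congr_ae ?_
  filter_upwards [coeFn_mulOp μ φ ξ, coeFn_mulOp μ φ η] with x h1 h2
  rw [h1, h2]
  simp only [RCLike.inner_apply, map_mul, Complex.conj_ofReal]
  ring

end MultiplicationOperator

/-- Each bounded real family converges along an ultrafilter by compactness of an interval, and
uniqueness of limits gives linearity. The invariant mean will be such a limit of vector functionals.
-/
theorem exists_linear_ultrafilter_limit {V I : Type*} [AddCommGroup V] [Module ℝ V]
    (U : Ultrafilter I) (F : I → V →ₗ[ℝ] ℝ) (hF : ∀ v, ∃ C : ℝ, ∀ i, |F i v| ≤ C) :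
    ∃ m : V →ₗ[ℝ] ℝ, ∀ v, Tendsto (fun i => F i v) U (𝓝 (m v)) := by
  have h (v : V) : ∃ l : ℝ, Tendsto (fun i => F i v) U (𝓝 l) := by
    obtain ⟨C, hC⟩ := hF v
    obtain ⟨l, -, hl⟩ := (isCompact_Icc (a := -C) (b := C)).ultrafilter_le_nhds
      (U.map fun i => F i v) (by
        rw [le_principal_iff]
        exact Eventually.of_forall (f := (U : Filter I)) fun i => abs_le.1 (hC i))
    exact ⟨l, hl⟩
  choose m hm using h
  refine ⟨⟨⟨m, fun v w => ?_⟩, fun c v => ?_⟩, hm⟩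
  · refine tendsto_nhds_unique (hm _) ?_
    simpa only [map_add] using (hm v).add (hm w)
  · refine tendsto_nhds_unique (hm _) ?_
    simpa only [map_smul, RingHom.id_apply] using (hm v).const_smul c

/-! ### Invariant means from covariant pairs -/

section CovariantPair

variable {G : Type*} [Group G] [TopologicalSpace G] [IsTopologicalGroup G]
  {K : Type*} [NormedAddCommGroup K] [InnerProductSpace ℂ K]

/-- A `*`-representation `M` of the bounded continuous functions on `G` and a family of isometries
`u s` implementing the left translations. -/
structure IsCovariantPair (M : (G →ᵇ ℝ) → K →L[ℂ] K) (u : G → K →L[ℂ] K) : Prop where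
  add : ∀ φ ψ, M (φ + ψ) = M φ + M ψ
  smul : ∀ (c : ℝ) φ, M (c • φ) = (c : ℂ) • M φ
  mul : ∀ φ ψ, M (φ * ψ) = M φ * M ψ
  one : M 1 = 1
  norm_le : ∀ φ, ‖M φ‖ ≤ ‖φ‖
  symm : ∀ φ x y, inner ℂ (M φ x) y = inner ℂ x (M φ y)
  inner_map : ∀ s x y, inner ℂ (u s x) (u s y) = inner ℂ x y
  covariant : ∀ s φ x, u s (M φ x) = M (leftTranslate s φ) (u s x)

namespace IsCovariantPair

variable {M : (G →ᵇ ℝ) → K →L[ℂ] K} {u : G → K →L[ℂ] K} (h : IsCovariantPair M u)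

include h in
theorem norm_map (s : G) (x : K) : ‖u s x‖ = ‖x‖ := by
  rw [@norm_eq_sqrt_re_inner ℂ, @norm_eq_sqrt_re_inner ℂ _ _ _ _ x, h.inner_map]

/-- The functional on bounded continuous functions given by a vector. -/
noncomputable def vectorMean (x : K) : (G →ᵇ ℝ) →ₗ[ℝ] ℝ where
  toFun φ := (inner ℂ x (M φ x)).re
  map_add' φ ψ := by
    rw [h.add, _root_.add_apply, inner_add_right, Complex.add_re]
  map_smul' c φ := by
    rw [h.smul, _root_.smul_apply, inner_smul_right, Complex.re_ofReal_mul]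
    rfl

theorem vectorMean_apply (x : K) (φ : G →ᵇ ℝ) :
    h.vectorMean x φ = (inner ℂ x (M φ x)).re := rfl

/-- With ψ = √φ, the value is ⟨x, M(ψ)² x⟩ = ‖M(ψ) x‖². -/
theorem vectorMean_nonneg (x : K) {φ : G →ᵇ ℝ} (hφ : ∀ t, 0 ≤ φ t) :
    0 ≤ h.vectorMean x φ := by
  let ψ : G →ᵇ ℝ := BoundedContinuousFunction.ofNormedAddCommGroup (fun t => √(φ t))
    (by fun_prop) (√‖φ‖) fun t => by
      rw [Real.norm_of_nonneg (Real.sqrt_nonneg _)]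
      exact Real.sqrt_le_sqrt ((le_abs_self _).trans (φ.norm_coe_le_norm t))
  have hψ : φ = ψ * ψ := by
    ext t
    exact (Real.mul_self_sqrt (hφ t)).symm
  rw [vectorMean_apply, hψ, h.mul, mul_apply_eq_comp, ← h.symm]
  exact inner_self_nonneg (𝕜 := ℂ) (x := M ψ x)

theorem vectorMean_one {x : K} (hx : ‖x‖ = 1) :
    h.vectorMean x (BoundedContinuousFunction.const G 1) = 1 := by
  have h1 : (BoundedContinuousFunction.const G 1 : G →ᵇ ℝ) = 1 := rfl
  rw [vectorMean_apply, h1, h.one]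
  change (inner ℂ x x).re = 1
  rw [inner_self_eq_norm_sq_to_K, hx]
  simp

theorem abs_vectorMean_le {x : K} (hx : ‖x‖ = 1) (φ : G →ᵇ ℝ) :
    |h.vectorMean x φ| ≤ ‖φ‖ := by
  refine (Complex.abs_re_le_norm _).trans ((norm_inner_le_norm _ _).trans ?_)
  rw [hx, one_mul]
  simpa [hx] using (M φ).le_of_opNorm_le (h.norm_le φ) x

/-- Covariance gives ⟨x, M(φ) x⟩ = ⟨u_s x, M(s·φ) u_s x⟩, so both values come from the same
operator, taken at the nearby vectors `x` and `u s x`. -/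
theorem abs_vectorMean_leftTranslate_sub_le {x : K} (hx : ‖x‖ = 1) (φ : G →ᵇ ℝ) (s : G) :
    |h.vectorMean x (leftTranslate s φ) - h.vectorMean x φ| ≤ 2 * ‖φ‖ * ‖u s x - x‖ := by
  set T := M (leftTranslate s φ) with hT
  have hTn : ‖T‖ ≤ ‖φ‖ := by
    refine (h.norm_le _).trans ?_
    exact (BoundedContinuousFunction.norm_le (norm_nonneg _)).2 fun t => φ.norm_coe_le_norm _
  have h1 : inner ℂ x (M φ x) = inner ℂ (u s x) (T (u s x)) := by
    rw [hT, ← h.covariant, h.inner_map]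
  rw [vectorMean_apply, vectorMean_apply, h1, ← Complex.sub_re]
  refine (Complex.abs_re_le_norm _).trans ?_
  have h2 : inner ℂ x (T x) - inner ℂ (u s x) (T (u s x)) =
      -(inner ℂ (u s x - x) (T x) + inner ℂ (u s x) (T (u s x - x))) := by
    simp only [inner_sub_left, inner_sub_right, map_sub]
    ring
  rw [h2, norm_neg]
  refine (norm_add_le _ _).trans ?_
  have h3 : ‖inner ℂ (u s x - x) (T x)‖ ≤ ‖u s x - x‖ * (‖φ‖ * 1) := by
    refine (norm_inner_le_norm _ _).trans ?_
    gcongr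
    exact hx ▸ T.le_of_opNorm_le hTn x
  have h4 : ‖inner ℂ (u s x) (T (u s x - x))‖ ≤ 1 * (‖φ‖ * ‖u s x - x‖) := by
    refine (norm_inner_le_norm _ _).trans ?_
    gcongr
    · exact ((h.norm_map s x).trans hx).le
    · exact T.le_of_opNorm_le hTn _
  linarith

include h in
/-- A group with a covariant pair admitting almost invariant unit vectors is amenable. -/
theorem isAmenableGroup
    (hinv : ∀ (S : Finset G) (ε : ℝ), 0 < ε → ∃ x : K, ‖x‖ = 1 ∧ ∀ s ∈ S, ‖u s x - x‖ ≤ ε) :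
    IsAmenableGroup G := by
  classical
  choose ζ hζ1 hζ using fun i : Finset G × ℕ => hinv i.1 (1 / (i.2 + 1)) (by positivity)
  obtain ⟨m, hm⟩ := exists_linear_ultrafilter_limit (Ultrafilter.of atTop)
    (fun i => h.vectorMean (ζ i)) fun φ => ⟨‖φ‖, fun i => h.abs_vectorMean_le (hζ1 i) φ⟩
  refine ⟨m, fun φ hφ => ?_, ?_, fun s φ => ?_⟩
  · exact ge_of_tendsto' (hm φ) fun i => h.vectorMean_nonneg (ζ i) hφ
  · refine tendsto_nhds_unique (hm _) ?_
    simp only [h.vectorMean_one (hζ1 _)]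
    exact tendsto_const_nhds
  · rw [← sub_eq_zero]
    refine tendsto_nhds_unique ((hm _).sub (hm _)) ?_
    refine Tendsto.mono_left ?_ (Ultrafilter.of_le _)
    have h0 : Tendsto (fun i : Finset G × ℕ => 2 * ‖φ‖ * (1 / ((i.2 : ℝ) + 1))) atTop (𝓝 0) := by
      have := (tendsto_one_div_add_atTop_nhds_zero_nat (𝕜 := ℝ)).comp
        (tendsto_snd (f := (atTop : Filter (Finset G))) (g := atTop))
      rw [prod_atTop_atTop_eq] at this
      simpa using this.const_mul (2 * ‖φ‖)
    refine squeeze_zero_norm' ?_ h0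
    -- The first coordinate only has to contain `s`; the decay comes from the second one.
    filter_upwards [eventually_ge_atTop (({s}, 0) : Finset G × ℕ)] with i hi
    refine (h.abs_vectorMean_leftTranslate_sub_le (hζ1 i) φ s).trans ?_
    gcongr
    exact hζ i s (hi.1 (Finset.mem_singleton_self s))

end IsCovariantPair

end CovariantPair

/-! ### Amenability from almost central vectors -/

section InvariantMean

variable {G : Type u} [Group G] [TopologicalSpace G] [IsTopologicalGroup G]
  [MeasurableSpace G] [BorelSpace G] (μ : Measure G) [μ.IsHaarMeasure]

theorem leftRegular_mulOp (s : G) (φ : G →ᵇ ℝ) (ξ : Lp ℂ 2 μ) :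
    leftRegular μ s (mulOp μ φ ξ) = mulOp μ (leftTranslate s φ) (leftRegular μ s ξ) := by
  have hmp := measurePreserving_mul_left μ s⁻¹
  refine Lp.ext ?_
  filter_upwards [coeFn_mulOp μ (leftTranslate s φ) (leftRegular μ s ξ),
    Lp.coeFn_compMeasurePreserving (mulOp μ φ ξ) hmp, Lp.coeFn_compMeasurePreserving ξ hmp,
    hmp.quasiMeasurePreserving.ae (coeFn_mulOp μ φ ξ)] with x h1 h2 h3 h4
  rw [h1]
  refine h2.trans ?_
  change _ = ((φ (s⁻¹ * x) : ℝ) : ℂ) * (Lp.compMeasurePreserving _ hmp ξ : G → ℂ) x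
  rw [h3]
  exact h4

/-- The operator `φ ⊗ 1` on `L²(G) ⊗ L²(G)`. -/
noncomputable def spatialMulOp (φ : G →ᵇ ℝ) :
    Lp ℂ 2 μ ⊗[ℂ] Lp ℂ 2 μ →L[ℂ] Lp ℂ 2 μ ⊗[ℂ] Lp ℂ 2 μ :=
  (mulOp μ φ).rTensor _

omit [Group G] [IsTopologicalGroup G] [μ.IsHaarMeasure] in
theorem norm_spatialMulOp_le (φ : G →ᵇ ℝ) : ‖spatialMulOp μ φ‖ ≤ ‖φ‖ :=
  (ContinuousLinearMap.norm_rTensor_le _ _).trans (norm_mulOp_le μ φ)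

theorem spatialConj_spatialMulOp (s : G) (φ : G →ᵇ ℝ) (ζ : Lp ℂ 2 μ ⊗[ℂ] Lp ℂ 2 μ) :
    spatialConj μ s (spatialMulOp μ φ ζ) =
      spatialMulOp μ (leftTranslate s φ) (spatialConj μ s ζ) := by
  have : spatialConj μ s * spatialMulOp μ φ =
      spatialMulOp μ (leftTranslate s φ) * spatialConj μ s := clm_tmul_ext fun ξ η => by
    simp [spatialConj, spatialMulOp, leftRegular_mulOp]
  exact DFunLike.congr_fun this ζ

/-- Translation covariance takes place in the first leg; the second leg of the unitaries commutes
with φ ⊗ 1. -/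
theorem isCovariantPair_spatial : IsCovariantPair (spatialMulOp μ) (spatialConj μ) where
  add φ ψ := by simp [spatialMulOp, mulOp_add]
  smul c φ := by
    rw [spatialMulOp, mulOp_smul, ContinuousLinearMap.rTensor_smul]
    rfl
  mul φ ψ := by
    rw [spatialMulOp, mulOp_mul, ContinuousLinearMap.rTensor_mul]
    rfl
  one := by
    rw [spatialMulOp, mulOp_one, ContinuousLinearMap.rTensor_one]
  norm_le := norm_spatialMulOp_le μ
  symm φ := inner_eq_of_tmul fun ξ η ξ' η' => by simp [spatialMulOp, inner_mulOp]
  inner_map s x y := by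
    have h1 : inner ℂ (spatialConj μ s x) (spatialConj μ s y) =
        inner ℂ x (spatialConj μ s⁻¹ (spatialConj μ s y)) :=
      inner_eq_of_tmul (fun ξ η ξ' η' => by
        simp [spatialConj, inner_leftRegular, (isConjugation_lpConj μ).inner_transposeOp,
          star_leftRegularL]) x (spatialConj μ s y)
    have h2 : spatialConj μ s⁻¹ * spatialConj μ s = 1 := clm_tmul_ext fun ξ η => by
      simp [spatialConj, transposeOp_apply, star_leftRegularL,
        (isConjugation_lpConj μ).apply_apply]
    exact h1.trans (congrArg (inner ℂ x) (DFunLike.congr_fun h2 y))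
  covariant := spatialConj_spatialMulOp μ

variable [LocallyCompactSpace G] [μ.Regular]

/-- If `C*_r(G)` is nuclear and some non-degenerate bimodule over it contains unit vectors which are
almost central for finitely many multipliers, then `G` is amenable. -/
theorem isAmenableGroup_of_almost_central (hnuc : IsNuclear (reducedCStar μ)) {H : Type u}
    [NormedAddCommGroup H] [InnerProductSpace ℂ H] [CompleteSpace H]
    {X : HilbertStarBimodule (reducedCStar μ) H} (hX : X.Nondegenerate)
    (hcent : ∀ (F : Finset 𝓜(ℂ, reducedCStar μ)) (ε : ℝ), 0 < ε →
      ∃ ξ : H, ‖ξ‖ = 1 ∧ ∀ x ∈ F, ‖X.mulLeft x ξ - X.mulRight x ξ‖ ≤ ε) :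
    IsAmenableGroup G := by
  classical
  refine (isCovariantPair_spatial μ).isAmenableGroup fun S ε hε => ?_
  -- Since the unitary at 1 is the identity, adding 1 to `S` turns near coincidence of the images
  -- into near invariance of the vector.
  obtain ⟨ζ, hζ1, hζ⟩ := exists_unit_norm_sub_le (insert 1 S) (Finset.insert_nonempty _ _)
    (spatialConj μ) (norm_spatialConj_apply_le μ)
    (card_le_norm_sum_spatialConj μ hnuc hX hcent (insert 1 S)) hε
  refine ⟨ζ, hζ1, fun s hs => ?_⟩
  have := hζ s (Finset.mem_insert_of_mem hs) 1 (Finset.mem_insert_self _ _)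
  rwa [spatialConj_one_apply] at this

end InvariantMean

/-! ### The bimodule of a tracial state -/

section Tracial

variable {A H : Type*} [NonUnitalCStarAlgebra A] [NormedAddCommGroup H] [InnerProductSpace ℂ H]
  [CompleteSpace H]

/-- A realization of the GNS space of a tracial functional `τ`: a linear map `a ↦ â` with dense
range into a Hilbert space such that `⟪â, b̂⟫ = τ (a⋆ b)`. -/
structure IsTracialGNS (τ : A →L[ℂ] ℂ) (ι : A →ₗ[ℂ] H) : Prop where
  tracial : IsTracialState τ
  dense : DenseRange ι
  inner_map : ∀ a b, inner ℂ (ι a) (ι b) = τ (star a * b)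
  norm_mul_le : ∀ a b, ‖ι (a * b)‖ ≤ ‖a‖ * ‖ι b‖

namespace IsTracialGNS

variable {τ : A →L[ℂ] ℂ} {ι : A →ₗ[ℂ] H}

-- The trace property τ(a a⋆) = τ(a⋆ a) makes the involution isometric, and this carries boundedness
-- of left multiplication over to right multiplication.
omit [CompleteSpace H] in
theorem norm_star (h : IsTracialGNS τ ι) (a : A) : ‖ι (star a)‖ = ‖ι a‖ := by
  rw [@norm_eq_sqrt_re_inner ℂ, @norm_eq_sqrt_re_inner ℂ _ _ _ _ (ι a), h.inner_map, h.inner_map,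
    star_star, h.tracial.2.2]

omit [CompleteSpace H] in
theorem norm_mul_le' (h : IsTracialGNS τ ι) (a b : A) : ‖ι (a * b)‖ ≤ ‖b‖ * ‖ι a‖ := by
  rw [← h.norm_star, star_mul]
  simpa [h.norm_star] using h.norm_mul_le (star b) (star a)

omit [CompleteSpace H] in
theorem norm_apply_le (h : IsTracialGNS τ ι) (a : A) : ‖ι a‖ ≤ ‖a‖ := by
  refine le_of_sq_le_sq ?_ (norm_nonneg _)
  have h1 := congrArg norm (h.inner_map a a)
  rw [inner_self_eq_norm_sq_to_K, norm_pow, RCLike.norm_ofReal, abs_norm] at h1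
  rw [h1]
  refine (τ.le_opNorm _).trans ?_
  rw [h.tracial.2.1, one_mul, CStarRing.norm_star_mul_self, sq]

omit [CompleteSpace H] in
theorem continuous (h : IsTracialGNS τ ι) : Continuous ι :=
  AddMonoidHomClass.continuous_of_bound ι 1 fun a => (h.norm_apply_le a).trans_eq (one_mul _).symm

omit [CompleteSpace H] in
theorem clm_ext (h : IsTracialGNS τ ι) {S T : H →L[ℂ] H} (hST : ∀ a, S (ι a) = T (ι a)) : S = T :=
  DFunLike.coe_injective (h.dense.equalizer S.continuous T.continuous (funext hST))

omit [CompleteSpace H] in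
theorem inner_ext (h : IsTracialGNS τ ι) {x y : H}
    (hxy : ∀ a, inner ℂ x (ι a) = inner ℂ y (ι a)) : x = y := by
  have : innerSL ℂ x = innerSL ℂ y := DFunLike.coe_injective
    (h.dense.equalizer (innerSL ℂ x).continuous (innerSL ℂ y).continuous (funext hxy))
  exact ext_inner_right ℂ fun z => DFunLike.congr_fun this z

/-- Left multiplication on the GNS space. -/
noncomputable def leftOp (_ : IsTracialGNS τ ι) (a : A) : H →L[ℂ] H :=
  (ι ∘ₗ LinearMap.mulLeft ℂ a).extendOfNorm ι

/-- Right multiplication on the GNS space. -/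
noncomputable def rightOp (_ : IsTracialGNS τ ι) (a : A) : H →L[ℂ] H :=
  (ι ∘ₗ LinearMap.mulRight ℂ a).extendOfNorm ι

theorem leftOp_apply (h : IsTracialGNS τ ι) (a b : A) : h.leftOp a (ι b) = ι (a * b) :=
  LinearMap.extendOfNorm_eq h.dense ⟨‖a‖, fun b => h.norm_mul_le a b⟩ b

theorem rightOp_apply (h : IsTracialGNS τ ι) (a b : A) : h.rightOp a (ι b) = ι (b * a) :=
  LinearMap.extendOfNorm_eq h.dense ⟨‖a‖, fun b => h.norm_mul_le' b a⟩ b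

theorem adjoint_ext (h : IsTracialGNS τ ι) {S T : H →L[ℂ] H}
    (hST : ∀ a b, inner ℂ (S (ι a)) (ι b) = inner ℂ (ι a) (T (ι b))) : S = star T := by
  rw [ContinuousLinearMap.star_eq_adjoint]
  refine h.clm_ext fun a => h.inner_ext fun b => ?_
  rw [hST, ContinuousLinearMap.adjoint_inner_left]

/-- The Hilbert bimodule of a tracial state. -/
noncomputable def bimodule (h : IsTracialGNS τ ι) : HilbertStarBimodule A H where
  left :=
    { toFun := h.leftOp
      map_smul' := fun c a => h.clm_ext fun b => by
        rw [MonoidHom.id_apply, _root_.smul_apply, h.leftOp_apply, h.leftOp_apply, smul_mul_assoc,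
          map_smul]
      map_zero' := h.clm_ext fun b => by
        rw [h.leftOp_apply, zero_mul, map_zero, _root_.zero_apply]
      map_add' := fun a a' => h.clm_ext fun b => by
        rw [_root_.add_apply, h.leftOp_apply, h.leftOp_apply, h.leftOp_apply, add_mul, map_add]
      map_mul' := fun a a' => h.clm_ext fun b => by
        rw [mul_apply_eq_comp, h.leftOp_apply, h.leftOp_apply, h.leftOp_apply, mul_assoc]
      map_star' := fun a => h.adjoint_ext fun b c => by
        rw [h.leftOp_apply, h.leftOp_apply, h.inner_map, h.inner_map, star_mul, star_star,
          mul_assoc] }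
  right :=
    { toFun := fun a => h.rightOp a.unop
      map_smul' := fun c a => h.clm_ext fun b => by
        rw [MonoidHom.id_apply, _root_.smul_apply, h.rightOp_apply, h.rightOp_apply, unop_smul,
          mul_smul_comm, map_smul]
      map_zero' := h.clm_ext fun b => by
        rw [h.rightOp_apply, unop_zero, mul_zero, map_zero, _root_.zero_apply]
      map_add' := fun a a' => h.clm_ext fun b => by
        rw [_root_.add_apply, h.rightOp_apply, h.rightOp_apply, h.rightOp_apply, unop_add, mul_add,
          map_add]
      map_mul' := fun a a' => h.clm_ext fun b => by
        rw [mul_apply_eq_comp, h.rightOp_apply, h.rightOp_apply, h.rightOp_apply, unop_mul,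
          mul_assoc]
      map_star' := fun a => h.adjoint_ext fun b c => by
        rw [h.rightOp_apply, h.rightOp_apply, h.inner_map, h.inner_map, star_mul, unop_star,
          star_star, mul_assoc, h.tracial.2.2, mul_assoc] }
  comm a b ξ := by
    have : h.leftOp a * h.rightOp b = h.rightOp b * h.leftOp a := h.clm_ext fun c => by
      rw [mul_apply_eq_comp, mul_apply_eq_comp, h.leftOp_apply, h.rightOp_apply, h.leftOp_apply,
        h.rightOp_apply, mul_assoc]
    exact DFunLike.congr_fun this ξ

theorem bimodule_left_apply (h : IsTracialGNS τ ι) (a b : A) :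
    h.bimodule.left a (ι b) = ι (a * b) := h.leftOp_apply a b

theorem bimodule_right_apply (h : IsTracialGNS τ ι) (a b : A) :
    h.bimodule.right (op a) (ι b) = ι (b * a) := h.rightOp_apply a b

theorem nondegenerate_bimodule (h : IsTracialGNS τ ι) : h.bimodule.Nondegenerate := by
  obtain ⟨l, hl, -, hr, hr'⟩ := exists_approximateUnit A
  constructor
  · refine (dense_closure.1 (h.dense.mono ?_))
    rintro _ ⟨a, rfl⟩
    exact mem_closure_of_tendsto ((h.continuous.tendsto _).comp (hr a))
      (.of_forall fun e => Submodule.subset_span ⟨e, ι a, h.bimodule_left_apply e a⟩)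
  · refine (dense_closure.1 (h.dense.mono ?_))
    rintro _ ⟨a, rfl⟩
    exact mem_closure_of_tendsto ((h.continuous.tendsto _).comp (hr' a))
      (.of_forall fun e => Submodule.subset_span ⟨e, ι a, h.bimodule_right_apply e a⟩)

-- Along an approximate unit, τ(a) is the limit of τ(ea), the inner product of `ι (star e)`, of norm
-- at most 1, with `ι a`. Hence τ descends to a bounded functional on the GNS space although `A` may
-- lack a unit.
omit [CompleteSpace H] in
theorem norm_apply_le_norm_map (h : IsTracialGNS τ ι) (a : A) : ‖τ a‖ ≤ ‖ι a‖ := by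
  obtain ⟨l, hl, h1, hr, -⟩ := exists_approximateUnit A
  refine le_of_tendsto ((τ.continuous.tendsto _).comp (hr a)).norm ?_
  filter_upwards [h1] with e he
  have h2 := h.inner_map (star e) a
  rw [star_star] at h2
  change ‖τ (e * a)‖ ≤ _
  rw [← h2]
  refine (norm_inner_le_norm _ _).trans (mul_le_of_le_one_left (norm_nonneg _) ?_)
  rw [h.norm_star]
  exact (h.norm_apply_le e).trans he

/-- The Riesz vector ξ of τ stands in for the class of the unit: a·ξ = ι(a) = ξ·a, the second
equality by the trace property. It is nonzero because τ is. -/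
theorem exists_central_unit_vector (h : IsTracialGNS τ ι) :
    ∃ ξ ∈ h.bimodule.centralVectors, ‖ξ‖ = 1 := by
  let F : H →L[ℂ] ℂ := (τ : A →ₗ[ℂ] ℂ).extendOfNorm ι
  have hF (a : A) : F (ι a) = τ a := LinearMap.extendOfNorm_eq h.dense
    ⟨1, fun a => (h.norm_apply_le_norm_map a).trans_eq (one_mul _).symm⟩ a
  let ξ : H := (InnerProductSpace.toDual ℂ H).symm F
  have hξ (a : A) : inner ℂ ξ (ι a) = τ a := by
    rw [← hF]
    exact InnerProductSpace.toDual_symm_apply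
  have hl (a : A) : h.bimodule.left a ξ = ι a := h.inner_ext fun b => by
    rw [h.inner_map, ← hξ, ← h.bimodule_left_apply, map_star, ContinuousLinearMap.star_eq_adjoint,
      ContinuousLinearMap.adjoint_inner_right]
  have hr (a : A) : h.bimodule.right (op a) ξ = ι a := h.inner_ext fun b => by
    rw [h.inner_map, h.tracial.2.2, ← hξ, ← h.bimodule_right_apply, op_star, map_star,
      ContinuousLinearMap.star_eq_adjoint, ContinuousLinearMap.adjoint_inner_right]
  have hξ0 : ξ ≠ 0 := by
    intro h0
    have : τ = 0 := by
      ext a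
      rw [← hξ, h0, inner_zero_left]
      rfl
    have h1 := h.tracial.2.1
    rw [this, norm_zero] at h1
    exact zero_ne_one h1
  refine ⟨((‖ξ‖⁻¹ : ℝ) : ℂ) • ξ, Submodule.smul_mem _ _ fun a => (hl a).trans (hr a).symm, ?_⟩
  rw [norm_smul, Complex.norm_real, norm_inv, norm_norm, inv_mul_cancel₀ (norm_ne_zero_iff.2 hξ0)]

end IsTracialGNS

theorem IsTracialState.isTracialGNS_toComplL {A : Type*} [NonUnitalCStarAlgebra A]
    [PartialOrder A] [StarOrderedRing A] (f : A →ₚ[ℂ] ℂ) {τ : A →L[ℂ] ℂ} (hτ : IsTracialState τ)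
    (hf : ∀ a, f a = τ a) :
    IsTracialGNS τ ((UniformSpace.Completion.toComplL (𝕜 := ℂ) (E := f.PreGNS)).toLinearMap ∘ₗ
      f.toPreGNS.toLinearMap) where
  tracial := hτ
  dense := UniformSpace.Completion.denseRange_coe (α := f.PreGNS)
  inner_map a b := by
    rw [← hf]
    exact UniformSpace.Completion.inner_coe _ _
  norm_mul_le a b := by
    refine (UniformSpace.Completion.norm_coe (E := f.PreGNS) (f.toPreGNS (a * b))).trans_le ?_
    refine le_trans ?_ (mul_le_mul_of_nonneg_left
      (UniformSpace.Completion.norm_coe (E := f.PreGNS) (f.toPreGNS b)).ge (norm_nonneg a))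
    exact (f.leftMulMapPreGNS a).le_of_opNorm_le
      (LinearMap.mkContinuous_norm_le _ (norm_nonneg a) _) (f.toPreGNS b)

/-- Every tracial state has a GNS realization. -/
theorem IsTracialState.exists_isTracialGNS {A : Type u} [NonUnitalCStarAlgebra A] {τ : A →L[ℂ] ℂ}
    (hτ : IsTracialState τ) :
    ∃ (H : Type u) (_ : NormedAddCommGroup H) (_ : InnerProductSpace ℂ H) (_ : CompleteSpace H)
      (ι : A →ₗ[ℂ] H), IsTracialGNS τ ι := by
  let _ := CStarAlgebra.spectralOrder A
  let _ := CStarAlgebra.spectralOrderedRing A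
  let f : A →ₚ[ℂ] ℂ := PositiveLinearMap.mk₀ (τ : A →ₗ[ℂ] ℂ) fun a ha => by
    obtain ⟨b, rfl⟩ := CStarAlgebra.nonneg_iff_eq_star_mul_self.1 ha
    exact hτ.1 b
  exact ⟨f.GNS, inferInstance, inferInstance, inferInstance, _,
    hτ.isTracialGNS_toComplL f fun _ => rfl⟩

end Tracial

/-! ### Amenability from tracial states and from almost central nets -/

section

variable {G : Type u} [Group G] [TopologicalSpace G] [IsTopologicalGroup G]
  [LocallyCompactSpace G] [MeasurableSpace G] [BorelSpace G] (μ : Measure G) [μ.IsHaarMeasure]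
  [μ.Regular]

/-- If `C*_r(G)` is nuclear and has a tracial state, then `G` is amenable. -/
theorem isAmenableGroup_of_isTracialState (hnuc : IsNuclear (reducedCStar μ))
    {τ : reducedCStar μ →L[ℂ] ℂ} (hτ : IsTracialState τ) : IsAmenableGroup G := by
  obtain ⟨H, _, _, _, ι, hι⟩ := hτ.exists_isTracialGNS
  obtain ⟨ξ, hξ, hξ1⟩ := hι.exists_central_unit_vector
  refine isAmenableGroup_of_almost_central μ hnuc hι.nondegenerate_bimodule fun F ε hε =>
    ⟨ξ, hξ1, fun x _ => ?_⟩
  rw [HilbertStarBimodule.mulLeft_eq_mulRight_of_mem_centralVectors hι.nondegenerate_bimodule hξ,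
    sub_self, norm_zero]
  exact hε.le

/-- If `C*_r(G)` is nuclear and `G` is not amenable, then there are no almost central nets of unit
vectors in non-degenerate bimodules. -/
theorem isAmenableGroup_of_isAlmostCentral (hnuc : IsNuclear (reducedCStar μ)) {H : Type u}
    [NormedAddCommGroup H] [InnerProductSpace ℂ H] [CompleteSpace H]
    {X : HilbertStarBimodule (reducedCStar μ) H} (hX : X.Nondegenerate) {I : Type*} [Preorder I]
    [IsDirectedOrder I] [Nonempty I] {ξ : I → H} (hξ : ∀ i, ‖ξ i‖ = 1)
    (hcent : X.IsAlmostCentral ξ) : IsAmenableGroup G := by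
  refine isAmenableGroup_of_almost_central μ hnuc hX fun F ε hε => ?_
  -- Only finite sets of multipliers are needed, and these are compact in any topology.
  have hF : @IsCompact _ (strictTopology (reducedCStar μ))
      (F : Set 𝓜(ℂ, reducedCStar μ)) :=
    @Set.Finite.isCompact _ (strictTopology (reducedCStar μ)) _ F.finite_toSet
  obtain ⟨i, hi⟩ := (hcent F hF ε hε).exists
  exact ⟨ξ i, hξ i, hi⟩

end

/-! ### Almost invariant vectors of isometric representations of amenable groups -/

/-- A strongly continuous representation of a group by contractions of a Banach space. -/
structure ContractiveRep (G E : Type*) [Group G] [TopologicalSpace G] [NormedAddCommGroup E]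
    [NormedSpace ℝ E] where
  /-- The underlying homomorphism. -/
  toHom : G →* (E →L[ℝ] E)
  norm_apply_le : ∀ s v, ‖toHom s v‖ ≤ ‖v‖
  continuous_apply : ∀ v, Continuous fun s => toHom s v

section Translates

variable {G : Type u} [Group G] [TopologicalSpace G] [IsTopologicalGroup G]
  [LocallyCompactSpace G] [MeasurableSpace G] [BorelSpace G]

omit [Group G] [IsTopologicalGroup G] [LocallyCompactSpace G] in
theorem continuous_integral_norm_sub_of_locally_compactSupport {X : Type*} [TopologicalSpace X]
    (ν : Measure G) [IsFiniteMeasureOnCompacts ν] (F : X → G → ℝ)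
    (hF : Continuous (Function.uncurry F)) {x₀ : X}
    (hs : ∃ N ∈ 𝓝 x₀, ∃ k : Set G, IsCompact k ∧ ∀ x ∈ N, ∀ y ∉ k, F x y = 0) :
    Tendsto (fun x => ∫ y, ‖F x y - F x₀ y‖ ∂ν) (𝓝 x₀) (𝓝 0) := by
  obtain ⟨N, hN, k, hk, h0⟩ := hs
  have h1 : ContinuousOn (fun x => ∫ y, ‖F x y - F x₀ y‖ ∂ν) N := by
    refine continuousOn_integral_of_compact_support hk ?_ fun x y hx hy => ?_
    · refine Continuous.continuousOn (Continuous.norm (hF.sub ?_))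
      exact hF.comp (continuous_const.prodMk continuous_snd)
    · simp [h0 x hx y hy, h0 x₀ (mem_of_mem_nhds hN) y hy]
  have h2 := (h1.continuousAt hN).tendsto
  simpa using h2

-- For t in a compact neighbourhood N of s, all the translates vanish outside the compact set N ·
-- supp f, so the integral is continuous in t.
open scoped Pointwise in
theorem tendsto_integral_norm_compactLeftTranslate_sub (ν : Measure G)
    [IsFiniteMeasureOnCompacts ν] (f : C_c(G, ℝ)) (s : G) :
    Tendsto (fun t => ∫ y, ‖compactLeftTranslate t f y - compactLeftTranslate s f y‖ ∂ν) (𝓝 s)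
      (𝓝 0) := by
  refine continuous_integral_norm_sub_of_locally_compactSupport ν
    (fun t y => compactLeftTranslate t f y)
    (f.continuous.comp (continuous_fst.inv.mul continuous_snd)) ?_
  obtain ⟨N, hN, hNs⟩ := exists_compact_mem_nhds s
  refine ⟨N, hNs, N * tsupport f, hN.mul f.hasCompactSupport, fun t ht y hy => ?_⟩
  by_contra h
  exact hy ⟨t, ht, t⁻¹ * y, subset_tsupport _ h, mul_inv_cancel_left t y⟩

open scoped Pointwise in
theorem tendsto_integral_norm_compactRightTranslate_sub (ν : Measure G)
    [IsFiniteMeasureOnCompacts ν] (f : C_c(G, ℝ)) (s : G) :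
    Tendsto (fun t => ∫ y, ‖compactRightTranslate t f y - compactRightTranslate s f y‖ ∂ν) (𝓝 s)
      (𝓝 0) := by
  refine continuous_integral_norm_sub_of_locally_compactSupport ν
    (fun t y => compactRightTranslate t f y)
    (f.continuous.comp (continuous_snd.mul continuous_fst)) ?_
  obtain ⟨N, hN, hNs⟩ := exists_compact_mem_nhds s
  refine ⟨N, hNs, tsupport f * N⁻¹, (f.hasCompactSupport : IsCompact _).mul hN.inv,
    fun t ht y hy => ?_⟩
  by_contra h
  exact hy ⟨y * t, subset_tsupport _ h, t⁻¹, Set.inv_mem_inv.2 ht, mul_inv_cancel_right y t⟩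

omit [MeasurableSpace G] [BorelSpace G] in
/-- Every neighbourhood of a point supports a normalized bump function. -/
theorem exists_compactlySupported_integral_eq_one [MeasurableSpace G] [BorelSpace G] (ν : Measure G)
    [IsFiniteMeasureOnCompacts ν] [ν.IsOpenPosMeasure] {U : Set G} {x : G} (hU : U ∈ 𝓝 x) :
    ∃ f : C_c(G, ℝ), (∀ y, 0 ≤ f y) ∧ (∀ y ∉ U, f y = 0) ∧ ∫ y, f y ∂ν = 1 := by
  obtain ⟨V, hVU, hV, hx⟩ := mem_nhds_iff.1 hU
  obtain ⟨f, hf1, hfc, hfV, hf⟩ := exists_continuousMap_one_of_isCompact_subset_isOpen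
    (isCompact_singleton (x := x)) hV (Set.singleton_subset_iff.2 hx)
  have hpos : 0 < ∫ y, f y ∂ν := f.continuous.integral_pos_of_hasCompactSupport_nonneg_nonzero hfc
    (fun y => (hf y).1) (x := x) (by rw [hf1 rfl]; exact one_ne_zero)
  refine ⟨(∫ y, f y ∂ν)⁻¹ • ⟨f, hfc⟩, fun y => ?_, fun y hy => ?_, ?_⟩
  · exact mul_nonneg (inv_nonneg.2 hpos.le) (hf y).1
  · have : f y = 0 := by
      by_contra h
      exact hy (hVU (hfV (subset_tsupport _ h)))
    change (∫ y, f y ∂ν)⁻¹ • f y = 0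
    rw [this, smul_zero]
  · change ∫ y, (∫ y, f y ∂ν)⁻¹ • f y ∂ν = 1
    rw [integral_smul, smul_eq_mul, inv_mul_cancel₀ hpos.ne']

end Translates

/-- Positivity at ‖f‖·1 ± f gives |m f| ≤ ‖f‖. Continuity is what allows the mean to be exchanged
with vector-valued integrals. -/
theorem IsAmenableGroup.exists_clm {G : Type*} [Group G] [TopologicalSpace G]
    [IsTopologicalGroup G] (hG : IsAmenableGroup G) :
    ∃ m : (G →ᵇ ℝ) →L[ℝ] ℝ, (∀ f : G →ᵇ ℝ, (∀ t, 0 ≤ f t) → 0 ≤ m f) ∧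
      m (BoundedContinuousFunction.const G 1) = 1 ∧
      ∀ (s : G) (f : G →ᵇ ℝ), m (leftTranslate s f) = m f := by
  obtain ⟨m, hm0, hm1, hm⟩ := hG
  refine ⟨m.mkContinuous 1 fun f => ?_, hm0, hm1, hm⟩
  have h1 := hm0 (‖f‖ • BoundedContinuousFunction.const G 1 - f) fun t => by
    simpa using (le_abs_self _).trans (f.norm_coe_le_norm t)
  have h2 := hm0 (‖f‖ • BoundedContinuousFunction.const G 1 + f) fun t => by
    have := (neg_le_abs _).trans (f.norm_coe_le_norm t)
    simp only [BoundedContinuousFunction.add_apply, BoundedContinuousFunction.smul_apply,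
      BoundedContinuousFunction.const_apply, smul_eq_mul, mul_one]
    linarith
  rw [map_sub, map_smul, hm1, smul_eq_mul, mul_one] at h1
  rw [map_add, map_smul, hm1, smul_eq_mul, mul_one] at h2
  rw [one_mul, Real.norm_eq_abs, abs_le]
  constructor <;> linarith

namespace ContractiveRep

variable {G : Type u} {E : Type*} [Group G] [TopologicalSpace G]
  [MeasurableSpace G] [BorelSpace G] [NormedAddCommGroup E]
  [NormedSpace ℝ E] (π : ContractiveRep G E) (ν : Measure G)
  [IsFiniteMeasureOnCompacts ν]

theorem integrable_smul (f : C_c(G, ℝ)) (v : E) : Integrable (fun s => f s • π.toHom s v) ν :=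
  (f.continuous.smul (π.continuous_apply v)).integrable_of_hasCompactSupport
    (f.hasCompactSupport.smul_right)

/-- The integrated form `v ↦ ∫ f(s) π(s) v dν(s)`. -/
noncomputable def integratedForm (f : C_c(G, ℝ)) : E →L[ℝ] E :=
  LinearMap.mkContinuous
    { toFun := fun v => ∫ s, f s • π.toHom s v ∂ν
      map_add' := fun v w => by
        simp only [map_add, smul_add]
        exact integral_add (π.integrable_smul ν f v) (π.integrable_smul ν f w)
      map_smul' := fun c v => by
        simp only [map_smul, RingHom.id_apply, smul_comm _ c]
        exact integral_smul c _ }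
    (∫ s, ‖f s‖ ∂ν)
    (fun v => by
      refine (norm_integral_le_integral_norm _).trans ?_
      rw [← integral_mul_const]
      refine integral_mono (π.integrable_smul ν f v).norm
        ((f.continuous.integrable_of_hasCompactSupport f.hasCompactSupport).norm.mul_const _)
        fun s => ?_
      rw [norm_smul]
      exact mul_le_mul_of_nonneg_left (π.norm_apply_le s v) (norm_nonneg _))

theorem integratedForm_apply (f : C_c(G, ℝ)) (v : E) :
    π.integratedForm ν f v = ∫ s, f s • π.toHom s v ∂ν := rfl

theorem norm_integratedForm_le (f : C_c(G, ℝ)) : ‖π.integratedForm ν f‖ ≤ ∫ s, ‖f s‖ ∂ν :=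
  LinearMap.mkContinuous_norm_le _ (integral_nonneg fun _ => norm_nonneg _) _

theorem integratedForm_sub (f g : C_c(G, ℝ)) :
    π.integratedForm ν (f - g) = π.integratedForm ν f - π.integratedForm ν g := by
  ext v
  rw [_root_.sub_apply, integratedForm_apply, integratedForm_apply, integratedForm_apply,
    ← integral_sub (π.integrable_smul ν f v) (π.integrable_smul ν g v)]
  simp [sub_smul]

theorem norm_integratedForm_sub_le (f g : C_c(G, ℝ)) :
    ‖π.integratedForm ν f - π.integratedForm ν g‖ ≤ ∫ s, ‖f s - g s‖ ∂ν := by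
  rw [← integratedForm_sub]
  exact π.norm_integratedForm_le ν (f - g)

variable [IsTopologicalGroup G]

theorem toHom_mul_integratedForm [ν.IsMulLeftInvariant] (s : G) (f : C_c(G, ℝ)) :
    π.toHom s * π.integratedForm ν f = π.integratedForm ν (compactLeftTranslate s f) := by
  ext v
  by_cases hE : CompleteSpace E
  · rw [mul_apply_eq_comp, integratedForm_apply, integratedForm_apply,
      ← ContinuousLinearMap.integral_comp_comm _ (π.integrable_smul ν f v),
      ← integral_mul_left_eq_self (fun t => compactLeftTranslate s f t • π.toHom t v) s]
    refine integral_congr_ae (.of_forall fun t => ?_)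
    simp
  -- In an incomplete space the Bochner integral is 0 by convention, so both sides vanish.
  · simp [integratedForm_apply, integral, hE]

theorem integratedForm_mul_toHom [ν.IsMulRightInvariant] (s : G) (f : C_c(G, ℝ)) :
    π.integratedForm ν f * π.toHom s = π.integratedForm ν (compactRightTranslate s⁻¹ f) := by
  ext v
  rw [mul_apply_eq_comp, integratedForm_apply, integratedForm_apply,
    ← integral_mul_right_eq_self (fun t => compactRightTranslate s⁻¹ f t • π.toHom t v) s]
  refine integral_congr_ae (.of_forall fun t => ?_)
  simp

variable [LocallyCompactSpace G]

/-- Smoothing upgrades strong continuity to norm continuity: π(s)π(f) is the integrated form of a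
translate of f, translates vary continuously in L¹, and the L¹ norm dominates the operator norm. -/
theorem continuous_toHom_mul_integratedForm [ν.IsMulLeftInvariant] (f : C_c(G, ℝ)) :
    Continuous fun s => π.toHom s * π.integratedForm ν f := by
  simp only [toHom_mul_integratedForm]
  refine continuous_iff_continuousAt.2 fun s => tendsto_iff_norm_sub_tendsto_zero.2 ?_
  exact squeeze_zero (fun _ => norm_nonneg _) (fun t => π.norm_integratedForm_sub_le ν _ _)
    (tendsto_integral_norm_compactLeftTranslate_sub ν f s)

theorem continuous_integratedForm_mul_toHom [ν.IsMulRightInvariant] (f : C_c(G, ℝ)) :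
    Continuous fun s => π.integratedForm ν f * π.toHom s := by
  simp only [integratedForm_mul_toHom]
  refine continuous_iff_continuousAt.2 fun s => tendsto_iff_norm_sub_tendsto_zero.2 ?_
  exact squeeze_zero (fun _ => norm_nonneg _) (fun t => π.norm_integratedForm_sub_le ν _ _)
    ((tendsto_integral_norm_compactRightTranslate_sub ν f s⁻¹).comp (continuous_inv.tendsto s))

/-- Smoothing operators near the identity. -/
theorem exists_norm_integratedForm_mul_sub_le [CompleteSpace E] [ν.IsOpenPosMeasure]
    {S : E →L[ℝ] E}
    (hS : Continuous fun s => π.toHom s * S) {ε : ℝ} (hε : 0 < ε) :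
    ∃ e : C_c(G, ℝ), ‖π.integratedForm ν e * S - S‖ ≤ ε := by
  -- A normalized bump function supported in this neighbourhood averages operators π(s)S that are
  -- all ε-close to S.
  have hU : {s | ‖π.toHom s * S - S‖ < ε} ∈ 𝓝 (1 : G) := by
    refine (hS.sub continuous_const).norm.continuousAt.eventually_lt continuousAt_const ?_
    simpa using hε
  obtain ⟨e, he0, heU, he1⟩ := exists_compactlySupported_integral_eq_one ν hU
  refine ⟨e, ContinuousLinearMap.opNorm_le_bound _ hε.le fun v => ?_⟩
  have he : Integrable e ν := e.continuous.integrable_of_hasCompactSupport e.hasCompactSupport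
  have h1 : (π.integratedForm ν e * S - S) v = ∫ s, e s • (π.toHom s (S v) - S v) ∂ν := by
    simp only [smul_sub]
    rw [integral_sub (π.integrable_smul ν e (S v)) (he.smul_const _), integral_smul_const, he1,
      one_smul]
    rfl
  rw [h1]
  have h2 : ∫ s, e s * (ε * ‖v‖) ∂ν = ε * ‖v‖ := by rw [integral_mul_const, he1, one_mul]
  rw [← h2]
  refine norm_integral_le_of_norm_le (he.mul_const _) (.of_forall fun s => ?_)
  rw [norm_smul, Real.norm_of_nonneg (he0 s)]
  by_cases hs : s ∈ {s | ‖π.toHom s * S - S‖ < ε}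
  · refine mul_le_mul_of_nonneg_left ?_ (he0 s)
    exact (π.toHom s * S - S).le_of_opNorm_le (le_of_lt hs) v
  · rw [heU s hs, zero_mul, zero_mul]

omit [LocallyCompactSpace G] [MeasurableSpace G] [BorelSpace G] [IsTopologicalGroup G] in
theorem norm_coefficient_le (Φ : E →L[ℝ] ℝ) (S : E →L[ℝ] E) (v : E) (t : G) :
    ‖Φ (S (π.toHom t v))‖ ≤ ‖Φ‖ * ‖v‖ * ‖S‖ := by
  refine (Φ.le_opNorm _).trans ?_
  rw [mul_assoc, mul_comm ‖v‖]
  gcongr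
  exact (S.le_opNorm _).trans (by gcongr; exact π.norm_apply_le t v)

/-- The coefficient function `t ↦ Φ (S π(t) v)`. -/
noncomputable def coefficient (Φ : E →L[ℝ] ℝ) (v : E) (S : E →L[ℝ] E) : G →ᵇ ℝ :=
  BoundedContinuousFunction.ofNormedAddCommGroup (fun t => Φ (S (π.toHom t v)))
    (by have := π.continuous_apply v; fun_prop) _ (π.norm_coefficient_le Φ S v)

/-- The coefficient function as a continuous linear function of the operator. -/
noncomputable def coefficientL (Φ : E →L[ℝ] ℝ) (v : E) : (E →L[ℝ] E) →L[ℝ] (G →ᵇ ℝ) :=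
  LinearMap.mkContinuous
    { toFun := π.coefficient Φ v
      map_add' := fun S T => by ext t; simp [coefficient]
      map_smul' := fun c S => by ext t; simp [coefficient] } (‖Φ‖ * ‖v‖) fun S =>
    BoundedContinuousFunction.norm_ofNormedAddCommGroup_le _ (by positivity)
      (π.norm_coefficient_le Φ S v)

/-- The average over `t` of `Φ (S π(t) v)`, as a function of the operator `S`. -/
noncomputable def meanCoefficient (m : (G →ᵇ ℝ) →L[ℝ] ℝ) (Φ : E →L[ℝ] ℝ) (v : E) :
    (E →L[ℝ] E) →L[ℝ] ℝ :=
  m.comp (π.coefficientL Φ v)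

omit [IsTopologicalGroup G] [LocallyCompactSpace G] [MeasurableSpace G] [BorelSpace G] in
theorem meanCoefficient_apply (m : (G →ᵇ ℝ) →L[ℝ] ℝ) (Φ : E →L[ℝ] ℝ) (v : E) (S : E →L[ℝ] E) :
    π.meanCoefficient m Φ v S = m (π.coefficient Φ v S) := rfl

-- Replacing S by Sπ(s) left-translates the coefficient function by s⁻¹, which the mean does not
-- see.
omit [LocallyCompactSpace G] [MeasurableSpace G] [BorelSpace G] in
theorem meanCoefficient_mul_toHom {m : (G →ᵇ ℝ) →L[ℝ] ℝ}
    (hm : ∀ (s : G) (f : G →ᵇ ℝ), m (leftTranslate s f) = m f) (Φ : E →L[ℝ] ℝ) (v : E)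
    (S : E →L[ℝ] E) (s : G) :
    π.meanCoefficient m Φ v (S * π.toHom s) = π.meanCoefficient m Φ v S := by
  rw [meanCoefficient_apply, meanCoefficient_apply, ← hm s⁻¹ (π.coefficient Φ v S)]
  congr 1
  ext t
  simp [coefficient, leftTranslate]

/-- Formally the value is (∫ k) M(1) = 0, where M denotes the averaged functional, but s ↦ π(s) need
not be norm continuous, so M cannot be taken under the integral directly. Inserting a smoothing
operator π(e) on the left makes the integrand norm continuous, and e can be chosen with π(e)π(k)
close to π(k) in norm. -/
theorem meanCoefficient_integratedForm_eq_zero [CompleteSpace E] (μ : Measure G) [μ.IsHaarMeasure]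
    {m : (G →ᵇ ℝ) →L[ℝ] ℝ}
    (hm : ∀ (s : G) (f : G →ᵇ ℝ), m (leftTranslate s f) = m f) (Φ : E →L[ℝ] ℝ) (v : E)
    {k : C_c(G, ℝ)} (hk : ∫ s, k s ∂μ = 0) :
    π.meanCoefficient m Φ v (π.integratedForm μ k) = 0 := by
  set M := π.meanCoefficient m Φ v
  -- The smoothing on the left uses `μ.inv`, because norm continuity of s ↦ π(e)π(s) needs a
  -- right-invariant measure.
  have hopen : μ.inv.IsOpenPosMeasure := ⟨fun U hU hne => by
    rw [Measure.inv_apply]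
    exact hU.inv.measure_ne_zero μ hne.inv⟩
  have hfin : IsFiniteMeasureOnCompacts μ.inv := ⟨fun K hK => by
    rw [Measure.inv_apply]
    exact hK.inv.measure_lt_top⟩
  have h1 (e : C_c(G, ℝ)) : M (π.integratedForm μ.inv e * π.integratedForm μ k) = 0 := by
    have hint : Integrable (fun s => k s • (π.integratedForm μ.inv e * π.toHom s)) μ :=
      (k.continuous.smul (π.continuous_integratedForm_mul_toHom μ.inv
        e)).integrable_of_hasCompactSupport k.hasCompactSupport.smul_right
    have h2 : π.integratedForm μ.inv e * π.integratedForm μ k =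
        ∫ s, k s • (π.integratedForm μ.inv e * π.toHom s) ∂μ := by
      ext w
      rw [ContinuousLinearMap.integral_apply hint, mul_apply_eq_comp, π.integratedForm_apply μ,
        ← ContinuousLinearMap.integral_comp_comm _ (π.integrable_smul μ k w)]
      simp
    rw [h2, ← ContinuousLinearMap.integral_comp_comm _ hint]
    simp only [map_smul]
    rw [← zero_smul ℝ (M (π.integratedForm μ.inv e)), ← hk, ← integral_smul_const]
    refine integral_congr_ae (.of_forall fun s => ?_)
    exact congrArg (k s • ·) (π.meanCoefficient_mul_toHom hm Φ v _ s)
  refine norm_le_zero_iff.1 (le_of_forall_pos_le_add fun ε hε => ?_)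
  obtain ⟨e, he⟩ := π.exists_norm_integratedForm_mul_sub_le μ.inv
    (π.continuous_toHom_mul_integratedForm μ k) (ε := ε / (‖M‖ + 1)) (by positivity)
  have h3 : M (π.integratedForm μ k) =
      -M (π.integratedForm μ.inv e * π.integratedForm μ k - π.integratedForm μ k) := by
    rw [map_sub, h1, zero_sub, neg_neg]
  rw [h3, norm_neg, zero_add]
  refine (M.le_opNorm _).trans ?_
  calc ‖M‖ * _ ≤ (‖M‖ + 1) * (ε / (‖M‖ + 1)) := by gcongr; linarith
    _ = ε := by field_simp


/-- Amenable groups have almost invariant vectors, uniformly on compact sets, on which a given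
invariant functional is normalized. -/
theorem exists_norm_toHom_sub_le [CompleteSpace E] (hG : IsAmenableGroup G) (μ : Measure G)
    [μ.IsHaarMeasure] {I : E →L[ℝ] ℝ} (hI : ∀ s v, I (π.toHom s v) = I v) (hI1 : ∃ v, I v = 1)
    {K : Set G} (hK : IsCompact K) {ε : ℝ} (hε : 0 < ε) :
    ∃ h : E, I h = 1 ∧ ∀ s ∈ K, ‖π.toHom s h - h‖ ≤ ε := by
  classical
  obtain ⟨m, hm0, hm1, hm⟩ := hG.exists_clm
  obtain ⟨v, hv⟩ := hI1
  obtain ⟨f, -, -, hf⟩ := exists_compactlySupported_integral_eq_one μ (univ_mem (f := 𝓝 (1 : G)))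
  set S := π.integratedForm μ f
  have hS : Continuous fun s => π.toHom s * S := π.continuous_toHom_mul_integratedForm μ f
  -- Vectors q in the convex hull of the orbit of v satisfy ‖q‖ ≤ ‖v‖, so δ‖q‖ ≤ ε/2; the summand 1
  -- covers v = 0.
  set δ : ℝ := ε / (2 * (‖v‖ + 1)) with hδ
  have hδ0 : 0 < δ := by positivity
  -- Norm continuity of s ↦ π(s)S reduces the compact set K to the finite set T.
  obtain ⟨T, -, hT⟩ := hK.elim_nhds_subcover (fun s => {t | ‖π.toHom t * S - π.toHom s * S‖ < δ})
    fun s _ => by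
      refine (hS.sub continuous_const).norm.continuousAt.eventually_lt continuousAt_const ?_
      simpa using hδ0
  let Λ : E →L[ℝ] (T → E) := ContinuousLinearMap.pi fun j => π.toHom (j : G) * S - S
  let C : Set E := convexHull ℝ (Set.range fun t => π.toHom t v)
  have hCI : ∀ q ∈ C, I q = 1 ∧ ‖q‖ ≤ ‖v‖ := by
    intro q hq
    refine convexHull_min (t := {q | I q = 1} ∩ {q | ‖q‖ ≤ ‖v‖}) ?_ ?_ hq
    · rintro _ ⟨t, rfl⟩
      exact ⟨(hI t v).trans hv, π.norm_apply_le t v⟩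
    · refine Convex.inter (convex_hyperplane I.isLinear 1) ?_
      simpa [Metric.closedBall, dist_zero_right] using convex_closedBall (0 : E) ‖v‖
  -- Day–Namioka argument: if 0 were not in the closure, Hahn–Banach would give a functional that is
  -- at least u > 0 on the orbit. The resulting function U ≥ u has mean zero, against positivity of
  -- the mean.
  have hmem : (0 : T → E) ∈ closure (Λ '' C) := by
    by_contra h0
    obtain ⟨F, u, hu0, hu⟩ := geometric_hahn_banach_point_closed
      (((convex_convexHull ℝ _).linear_image Λ.toLinearMap).closure) isClosed_closure h0
    rw [map_zero] at hu0
    let Φ (j : T) : E →L[ℝ] ℝ := F.comp (ContinuousLinearMap.single ℝ (fun _ => E) j)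
    let U : G →ᵇ ℝ := ∑ j : T, π.coefficient (Φ j) v (π.toHom (j : G) * S - S)
    have hU (t : G) : u ≤ U t := by
      refine (hu (Λ (π.toHom t v)) (subset_closure ⟨_, subset_convexHull ℝ _ ⟨t, rfl⟩, rfl⟩)).le.trans
        (le_of_eq ?_)
      rw [BoundedContinuousFunction.sum_apply]
      conv_lhs => rw [← Finset.univ_sum_single (Λ (π.toHom t v)), map_sum]
      rfl
    have hmU : m U = 0 := by
      rw [map_sum]
      refine Finset.sum_eq_zero fun j _ => ?_
      -- This difference is the integrated form of a function with integral zero, so its averaged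
      -- coefficient vanishes.
      have h1 : π.toHom (j : G) * S - S =
          π.integratedForm μ (compactLeftTranslate (j : G) f - f) := by
        rw [integratedForm_sub, toHom_mul_integratedForm]
      have h2 : ∫ s, (compactLeftTranslate (j : G) f - f) s ∂μ = 0 := by
        have h3 : ∫ s, compactLeftTranslate (j : G) f s ∂μ = ∫ s, f s ∂μ :=
          integral_mul_left_eq_self f (j : G)⁻¹
        simp only [CompactlySupportedContinuousMap.sub_apply]
        rw [integral_sub, h3, sub_self]
        · exact (compactLeftTranslate (j : G) f).continuous.integrable_of_hasCompactSupport
            (compactLeftTranslate (j : G) f).hasCompactSupport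
        · exact f.continuous.integrable_of_hasCompactSupport f.hasCompactSupport
      rw [h1]
      exact π.meanCoefficient_integratedForm_eq_zero μ hm (Φ j) v h2
    have h4 : 0 ≤ m (U - u • BoundedContinuousFunction.const G 1) := hm0 _ fun t => by
      simpa using hU t
    rw [map_sub, hmU, map_smul, hm1, smul_eq_mul, mul_one] at h4
    linarith
  obtain ⟨_, ⟨q, hq, rfl⟩, hqδ⟩ := Metric.mem_closure_iff.1 hmem (ε / 2) (by positivity)
  rw [dist_zero_left] at hqδ
  obtain ⟨hq1, hqv⟩ := hCI q hq
  -- Smoothing preserves the normalization, since I(Sq) = (∫ f) I(q).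
  refine ⟨S q, ?_, fun s hs => ?_⟩
  · change I (∫ s, f s • π.toHom s q ∂μ) = 1
    rw [← ContinuousLinearMap.integral_comp_comm _ (π.integrable_smul μ f q)]
    simp [hI, hq1, hf]
  · obtain ⟨j, hj, hsj⟩ := Set.mem_iUnion₂.1 (hT hs)
    have h1 : ‖(π.toHom s * S - π.toHom j * S) q‖ ≤ ε / 2 := by
      refine ((π.toHom s * S - π.toHom j * S).le_of_opNorm_le (le_of_lt hsj) q).trans ?_
      calc δ * ‖q‖ ≤ δ * (‖v‖ + 1) := by gcongr; linarith
        _ = ε / 2 := by rw [hδ]; field_simp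
    have h2 : ‖(π.toHom j * S - S) q‖ ≤ ε / 2 := (norm_le_pi_norm (Λ q) ⟨j, hj⟩).trans hqδ.le
    have h3 : π.toHom s (S q) - S q =
        (π.toHom s * S - π.toHom j * S) q + (π.toHom j * S - S) q := by simp
    rw [h3]
    exact (norm_add_le _ _).trans (by linarith)

end ContractiveRep

/-! ### Almost invariant vectors of the regular representation -/

section Reiter

variable {G : Type u} [Group G] [TopologicalSpace G] [IsTopologicalGroup G]
  [MeasurableSpace G] [BorelSpace G] (μ : Measure G) [μ.IsHaarMeasure]

/-- Left translation on `L¹(G)`. -/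
noncomputable def leftTranslateL1 (s : G) : Lp ℝ 1 μ →ₗᵢ[ℝ] Lp ℝ 1 μ :=
  Lp.compMeasurePreservingₗᵢ ℝ (fun t => s⁻¹ * t) (measurePreserving_mul_left μ s⁻¹)

theorem coeFn_leftTranslateL1 (s : G) (v : Lp ℝ 1 μ) :
    leftTranslateL1 μ s v =ᵐ[μ] fun t => v (s⁻¹ * t) :=
  Lp.coeFn_compMeasurePreserving v (measurePreserving_mul_left μ s⁻¹)

theorem coeFn_leftRegular (s : G) (ξ : Lp ℂ 2 μ) :
    leftRegular μ s ξ =ᵐ[μ] fun t => ξ (s⁻¹ * t) :=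
  Lp.coeFn_compMeasurePreserving ξ (measurePreserving_mul_left μ s⁻¹)

theorem integral_leftTranslateL1 (s : G) (v : Lp ℝ 1 μ) :
    ∫ t, leftTranslateL1 μ s v t ∂μ = ∫ t, v t ∂μ := by
  rw [integral_congr_ae (coeFn_leftTranslateL1 μ s v)]
  exact integral_mul_left_eq_self v s⁻¹

/-- The square root of the absolute value of an integrable function. -/
noncomputable def sqrtAbs {α : Type*} (h : α → ℝ) (t : α) : ℂ := (√|h t| : ℝ)

theorem norm_sqrtAbs_sq {α : Type*} (h : α → ℝ) (t : α) : ‖sqrtAbs h t‖ ^ 2 = |h t| := by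
  rw [sqrtAbs, Complex.norm_real, Real.norm_of_nonneg (Real.sqrt_nonneg _),
    Real.sq_sqrt (abs_nonneg _)]

/-- From |√a - √b| ≤ √a + √b follows (√a - √b)² ≤ |a - b|. This turns almost invariance in L¹ into
almost invariance in L². -/
theorem norm_sqrtAbs_sub_sq_le {α : Type*} (h : α → ℝ) (s t : α) :
    ‖sqrtAbs h s - sqrtAbs h t‖ ^ 2 ≤ |h s - h t| := by
  rw [sqrtAbs, sqrtAbs, ← Complex.ofReal_sub, Complex.norm_real, Real.norm_eq_abs, sq_abs]
  refine le_trans ?_ (abs_abs_sub_abs_le_abs_sub (h s) (h t))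
  have h1 := Real.sq_sqrt (abs_nonneg (h s))
  have h2 := Real.sq_sqrt (abs_nonneg (h t))
  have h3 := Real.sqrt_nonneg |h s|
  have h4 := Real.sqrt_nonneg |h t|
  rw [← h1, ← h2, sq_sub_sq, abs_mul, Real.sqrt_sq h3, Real.sqrt_sq h4, ← sq_abs, sq]
  refine mul_le_mul_of_nonneg_right ?_ (abs_nonneg _)
  rw [abs_of_nonneg (add_nonneg h3 h4), abs_le]
  constructor <;> linarith

theorem memLp_sqrtAbs {α : Type*} [MeasurableSpace α] {ν : Measure α} {h : α → ℝ}
    (hh : Integrable h ν) : MemLp (sqrtAbs h) 2 ν := by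
  rw [memLp_two_iff_integrable_sq_norm]
  · simpa only [norm_sqrtAbs_sq] using hh.abs
  · exact (Complex.continuous_ofReal.comp
      (Real.continuous_sqrt.comp continuous_abs)).comp_aestronglyMeasurable hh.1

theorem Lp.norm_sq_eq_integral {α : Type*} [MeasurableSpace α] {ν : Measure α} (ξ : Lp ℂ 2 ν) :
    ‖ξ‖ ^ 2 = ∫ t, ‖ξ t‖ ^ 2 ∂ν := by
  rw [@norm_sq_eq_re_inner ℂ, L2.inner_def, ← integral_re (L2.integrable_inner ξ ξ)]
  exact integral_congr_ae (.of_forall fun t => (@norm_sq_eq_re_inner ℂ _ _ _ _ (ξ t)).symm)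

variable [LocallyCompactSpace G] [μ.Regular]

theorem continuous_leftTranslateL1 (v : Lp ℝ 1 μ) : Continuous fun s : G => leftTranslateL1 μ s v := by
  let g : C(G, C(G, G)) :=
    (ContinuousMap.mk (fun a : G × G => a.1⁻¹ * a.2) (by fun_prop)).curry
  exact (continuous_const (y := v)).compMeasurePreservingLp g.continuous
    (fun s => measurePreserving_mul_left μ s⁻¹) (by simp)

/-- The representation of `G` on `L¹(G)` by left translation. -/
noncomputable def leftTranslateL1Rep : ContractiveRep G (Lp ℝ 1 μ) where
  toHom :=
    { toFun := fun s => (leftTranslateL1 μ s).toContinuousLinearMap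
      map_one' := by
        ext1 v
        have h := Lp.compMeasurePreserving_id_apply v
        refine Eq.trans ?_ h
        change Lp.compMeasurePreserving _ _ v = _
        congr 2
        ext x
        simp
      map_mul' := fun s t => by
        ext1 v
        have h := Lp.compMeasurePreserving_comp_apply (p := 1) v (measurePreserving_mul_left μ t⁻¹)
          (measurePreserving_mul_left μ s⁻¹)
        refine Eq.trans ?_ h
        change Lp.compMeasurePreserving _ _ v = _
        congr 2
        ext x
        simp [mul_assoc] }
  norm_apply_le s v := ((leftTranslateL1 μ s).norm_map v).le
  continuous_apply := continuous_leftTranslateL1 μ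

/-- Reiter's condition: an amenable group has unit vectors in `L²(G)` which are almost invariant,
uniformly on compact sets. -/
theorem IsAmenableGroup.exists_norm_leftRegular_sub_le (hG : IsAmenableGroup G) {K : Set G}
    (hK : IsCompact K) {ε : ℝ} (hε : 0 < ε) :
    ∃ η : Lp ℂ 2 μ, ‖η‖ = 1 ∧ ∀ s ∈ K, ‖leftRegular μ s η - η‖ ≤ ε := by
  obtain ⟨f, -, -, hf⟩ := exists_compactlySupported_integral_eq_one μ (univ_mem (f := 𝓝 (1 : G)))
  have hfi : Integrable f μ := f.continuous.integrable_of_hasCompactSupport f.hasCompactSupport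
  obtain ⟨h, hh1, hh⟩ := (leftTranslateL1Rep μ).exists_norm_toHom_sub_le hG μ
    (I := L1.integralCLM' ℝ)
    (fun s v => by
      have := integral_leftTranslateL1 μ s v
      rwa [← L1.integral_eq_integral, ← L1.integral_eq_integral, L1.integral_eq, L1.integral_eq]
        at this)
    ⟨hfi.toL1 f, by
      have := (L1.integral_eq_integral (hfi.toL1 f)).trans
        ((integral_congr_ae hfi.coeFn_toL1).trans hf)
      rwa [L1.integral_eq] at this⟩ hK (ε := ε ^ 2) (by positivity)
  have hhi := L1.integrable_coeFn h
  let ζ : Lp ℂ 2 μ := (memLp_sqrtAbs hhi).toLp _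
  have hζ : ζ =ᵐ[μ] sqrtAbs h := (memLp_sqrtAbs hhi).coeFn_toLp
  -- The function h need not be nonnegative, so ‖ζ‖² = ∫ |h| is only bounded below by ∫ h = 1. That
  -- suffices: normalizing ζ does not increase differences.
  have hζ1 : 1 ≤ ‖ζ‖ := by
    refine one_le_sq_iff_one_le_abs _ |>.1 ?_ |>.trans_eq (abs_norm ζ)
    rw [Lp.norm_sq_eq_integral]
    have h1 : ∫ t, h t ∂μ = 1 := by
      rw [← L1.integral_eq_integral, L1.integral_eq]
      exact hh1
    rw [← h1]
    refine integral_mono_ae hhi ((memLp_two_iff_integrable_sq_norm (Lp.aestronglyMeasurable ζ)).1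
      (Lp.memLp ζ)) ?_
    filter_upwards [hζ] with t ht
    rw [ht, norm_sqrtAbs_sq]
    exact le_abs_self _
  have hζε (s : G) (hs : s ∈ K) : ‖leftRegular μ s ζ - ζ‖ ≤ ε := by
    refine le_of_sq_le_sq ?_ hε.le
    refine le_trans ?_ (hh s hs)
    change _ ≤ ‖leftTranslateL1 μ s h - h‖
    rw [Lp.norm_sq_eq_integral, L1.norm_eq_integral_norm]
    refine integral_mono_ae ((memLp_two_iff_integrable_sq_norm (Lp.aestronglyMeasurable _)).1
      (Lp.memLp _)) (L1.integrable_coeFn _).norm ?_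
    filter_upwards [hζ, coeFn_leftRegular μ s ζ, coeFn_leftTranslateL1 μ s h,
      Lp.coeFn_sub (leftRegular μ s ζ) ζ, Lp.coeFn_sub (leftTranslateL1 μ s h) h,
      (measurePreserving_mul_left μ s⁻¹).quasiMeasurePreserving.ae hζ] with t h1 h2 h3 h4 h5 h6
    rw [h4, h5, Pi.sub_apply, Pi.sub_apply, h2, h3, h1, h6]
    exact norm_sqrtAbs_sub_sq_le h _ _
  refine ⟨((‖ζ‖⁻¹ : ℝ) : ℂ) • ζ, ?_, fun s hs => ?_⟩
  · rw [norm_smul, Complex.norm_real, norm_inv, norm_norm, inv_mul_cancel₀ (by positivity)]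
  · rw [map_smul, ← smul_sub, norm_smul, Complex.norm_real, norm_inv, norm_norm]
    exact (mul_le_of_le_one_left (norm_nonneg _) (inv_le_one_of_one_le₀ hζ1)).trans (hζε s hs)

end Reiter

/-! ### Characters from approximate eigenvectors -/

section ApproxEigen

variable {H : Type*} [NormedAddCommGroup H] [InnerProductSpace ℂ H] {I : Type*}
  {l : Filter I} {η : I → H} {a b : H →L[ℂ] H} {c d : ℂ}

/-- The vectors `η i` are approximate eigenvectors of `a` with approximate eigenvalue `c`. -/
def IsApproxEigen (l : Filter I) (η : I → H) (a : H →L[ℂ] H) (c : ℂ) : Prop :=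
  Tendsto (fun i => a (η i) - c • η i) l (𝓝 0)

namespace IsApproxEigen

theorem add (ha : IsApproxEigen l η a c) (hb : IsApproxEigen l η b d) :
    IsApproxEigen l η (a + b) (c + d) := by
  have := Tendsto.add ha hb
  rw [add_zero] at this
  refine this.congr fun i => ?_
  rw [_root_.add_apply, add_smul]
  abel

theorem smul (z : ℂ) (ha : IsApproxEigen l η a c) : IsApproxEigen l η (z • a) (z * c) := by
  have := Tendsto.const_smul ha z
  rw [smul_zero] at this
  refine this.congr fun i => ?_
  rw [_root_.smul_apply, mul_smul, smul_sub]

theorem zero : IsApproxEigen l η (0 : H →L[ℂ] H) 0 := by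
  refine tendsto_const_nhds.congr fun i => ?_
  simp

theorem mul (ha : IsApproxEigen l η a c) (hb : IsApproxEigen l η b d) :
    IsApproxEigen l η (a * b) (c * d) := by
  have := Tendsto.add ((a.continuous.tendsto 0).comp hb) (Tendsto.const_smul ha d)
  rw [map_zero, smul_zero, add_zero] at this
  refine this.congr fun i => ?_
  simp only [Function.comp_apply, map_sub, map_smul, mul_apply_eq_comp, smul_sub, mul_comm c d,
    mul_smul]
  abel

/-- This bound, applied to differences, makes approximate eigenvalues unique and 1-Lipschitz in the
operator. Uniqueness gives multiplicativity of the character, and the Lipschitz bound gives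
closedness of `approxEigenAlgebra`. -/
theorem norm_le [l.NeBot] (hη : ∀ i, ‖η i‖ = 1) (ha : IsApproxEigen l η a c) : ‖c‖ ≤ ‖a‖ := by
  have h1 : Tendsto (fun i => ‖a‖ + ‖a (η i) - c • η i‖) l (𝓝 ‖a‖) := by
    simpa using tendsto_const_nhds.add (Tendsto.norm ha)
  refine ge_of_tendsto h1 (.of_forall fun i => ?_)
  have h2 : ‖c‖ = ‖c • η i‖ := by rw [norm_smul, hη, mul_one]
  have h3 : ‖a (η i)‖ ≤ ‖a‖ := by simpa [hη] using a.le_opNorm (η i)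
  rw [h2]
  calc ‖c • η i‖ = ‖a (η i) - (a (η i) - c • η i)‖ := by rw [sub_sub_cancel]
    _ ≤ _ := (norm_sub_le _ _).trans (by gcongr)

theorem sub (ha : IsApproxEigen l η a c) (hb : IsApproxEigen l η b d) :
    IsApproxEigen l η (a - b) (c - d) := by
  simpa [sub_eq_add_neg] using ha.add (hb.smul (-1))

theorem unique [l.NeBot] (hη : ∀ i, ‖η i‖ = 1) (ha : IsApproxEigen l η a c)
    (hb : IsApproxEigen l η a d) : c = d := by
  have := (ha.sub hb).norm_le hη
  rwa [sub_self, norm_zero, norm_le_zero_iff, sub_eq_zero] at this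

theorem of_tendsto (hη : ∀ i, ‖η i‖ = 1) {J : Type*} {k : Filter J} [k.NeBot]
    {A : J → H →L[ℂ] H} {C : J → ℂ} (h : ∀ j, IsApproxEigen l η (A j) (C j))
    (hA : Tendsto A k (𝓝 a)) (hC : Tendsto C k (𝓝 c)) : IsApproxEigen l η a c := by
  rw [IsApproxEigen, Metric.tendsto_nhds]
  intro ε hε
  have h1 : Tendsto (fun j => ‖a - A j‖ + ‖C j - c‖) k (𝓝 0) := by
    simpa using ((tendsto_const_nhds (x := a)).sub hA).norm.add
      (hC.sub (tendsto_const_nhds (x := c))).norm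
  obtain ⟨j, hj⟩ := (h1.eventually_lt_const (half_pos hε)).exists
  filter_upwards [(Metric.tendsto_nhds.1 (h j)) (ε / 2) (half_pos hε)] with i hi
  rw [dist_zero_right] at hi ⊢
  have h2 : a (η i) - c • η i =
      (a - A j) (η i) + (C j - c) • η i + (A j (η i) - C j • η i) := by
    rw [_root_.sub_apply, sub_smul]
    abel
  have h3 : ‖(a - A j) (η i)‖ ≤ ‖a - A j‖ := by simpa [hη] using (a - A j).le_opNorm (η i)
  have h4 : ‖(C j - c) • η i‖ = ‖C j - c‖ := by rw [norm_smul, hη, mul_one]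
  rw [h2]
  calc _ ≤ ‖(a - A j) (η i)‖ + ‖(C j - c) • η i‖ + ‖A j (η i) - C j • η i‖ := norm_add₃_le
    _ < ε := by linarith

end IsApproxEigen

variable [CompleteSpace H]

/-- The algebra of the operators for which the vectors `η i` are approximate eigenvectors, together
with their adjoints. -/
noncomputable def approxEigenAlgebra (l : Filter I) (η : I → H) :
    NonUnitalStarSubalgebra ℂ (H →L[ℂ] H) where
  carrier := {a | ∃ c, IsApproxEigen l η a c ∧ IsApproxEigen l η (star a) (star c)}
  add_mem' := fun ⟨c, hc, hc'⟩ ⟨d, hd, hd'⟩ =>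
    ⟨c + d, hc.add hd, by rw [star_add, star_add]; exact hc'.add hd'⟩
  zero_mem' := ⟨0, .zero, by rw [star_zero, star_zero]; exact .zero⟩
  mul_mem' := fun ⟨c, hc, hc'⟩ ⟨d, hd, hd'⟩ =>
    ⟨c * d, hc.mul hd, by rw [star_mul, star_mul]; exact hd'.mul hc'⟩
  smul_mem' := fun z _ ⟨c, hc, hc'⟩ =>
    ⟨z * c, hc.smul z, by rw [star_smul, star_mul, mul_comm]; exact hc'.smul (star z)⟩
  star_mem' := fun ⟨c, hc, hc'⟩ => ⟨star c, hc', by rwa [star_star, star_star]⟩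

theorem isClosed_approxEigenAlgebra [l.NeBot] (hη : ∀ i, ‖η i‖ = 1) :
    IsClosed (approxEigenAlgebra l η : Set (H →L[ℂ] H)) := by
  refine isClosed_of_closure_subset fun a ha => ?_
  obtain ⟨A, hA, hAa⟩ := mem_closure_iff_seq_limit.1 ha
  choose C hC hC' using hA
  have hcau : CauchySeq C := by
    rw [Metric.cauchySeq_iff]
    intro ε hε
    obtain ⟨N, hN⟩ := Metric.cauchySeq_iff.1 hAa.cauchySeq ε hε
    refine ⟨N, fun m hm n hn => lt_of_le_of_lt ?_ (hN m hm n hn)⟩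
    rw [dist_eq_norm, dist_eq_norm]
    exact ((hC m).sub (hC n)).norm_le hη
  obtain ⟨c, hc⟩ := cauchySeq_tendsto_of_complete hcau
  exact ⟨c, .of_tendsto hη hC hAa hc, .of_tendsto hη hC' (hAa.star) hc.star⟩

/-- The approximate eigenvalues of the elements of an algebra. -/
theorem exists_character_isApproxEigen [l.NeBot] (hη : ∀ i, ‖η i‖ = 1)
    {S : NonUnitalStarSubalgebra ℂ (H →L[ℂ] H)} (hS : S ≤ approxEigenAlgebra l η) :
    ∃ χ : S →⋆ₙₐ[ℂ] ℂ, ∀ a : S, IsApproxEigen l η (a : H →L[ℂ] H) (χ a) := by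
  choose χ hχ hχ' using fun a : S => hS a.2
  exact ⟨{
    toFun := χ
    map_smul' := fun z a => (hχ (z • a)).unique hη ((hχ a).smul z)
    map_zero' := (hχ 0).unique hη .zero
    map_add' := fun a b => (hχ (a + b)).unique hη ((hχ a).add (hχ b))
    map_mul' := fun a b => (hχ (a * b)).unique hη ((hχ a).mul (hχ b))
    map_star' := fun a => (hχ (star a)).unique hη (hχ' a) }, hχ⟩

end ApproxEigen

/-! ### The trivial character of C*_r(G) -/

section TrivialCharacter

variable {G : Type u} [Group G] [TopologicalSpace G] [IsTopologicalGroup G]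
  [MeasurableSpace G] [BorelSpace G] (μ : Measure G) [μ.IsHaarMeasure] [LocallyCompactSpace G]
  [μ.Regular]

theorem norm_leftConvolution_le (f : C_c(G, ℂ)) : ‖leftConvolution μ f‖ ≤ ∫ s, ‖f s‖ ∂μ :=
  LinearMap.mkContinuous_norm_le _ (integral_nonneg fun _ => norm_nonneg _) _

theorem norm_leftConvolution_sub_le (f : C_c(G, ℂ)) (ξ : Lp ℂ 2 μ) {ε : ℝ}
    (h : ∀ s, f s ≠ 0 → ‖leftRegular μ s ξ - ξ‖ ≤ ε) :
    ‖leftConvolution μ f ξ - (∫ s, f s ∂μ) • ξ‖ ≤ (∫ s, ‖f s‖ ∂μ) * ε := by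
  have hf : Integrable f μ := f.continuous.integrable_of_hasCompactSupport f.hasCompactSupport
  rw [leftConvolution_apply, ← integral_smul_const, ← integral_sub
    (integrable_smul_leftRegular μ f ξ) (hf.smul_const ξ), ← integral_mul_const]
  refine norm_integral_le_of_norm_le (hf.norm.mul_const _) (.of_forall fun s => ?_)
  rw [← smul_sub, norm_smul]
  by_cases hs : f s = 0
  · simp [hs]
  · gcongr
    exact h s hs

/-- Keeping λ_{s⁻¹} in the integrand, rather than substituting s⁻¹ for s, avoids the modular
function. -/
theorem star_leftConvolution_apply (f : C_c(G, ℂ)) (ξ : Lp ℂ 2 μ) :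
    star (leftConvolution μ f) ξ = ∫ s, star (f s) • leftRegular μ s⁻¹ ξ ∂μ := by
  have hint : Integrable (fun s => star (f s) • leftRegular μ s⁻¹ ξ) μ := by
    refine Continuous.integrable_of_hasCompactSupport
      (f.continuous.star.smul ((continuous_leftRegular μ ξ).comp continuous_inv)) ?_
    exact (f.hasCompactSupport.comp_left (g := star) (star_zero ℂ)).smul_right
  refine ext_inner_left ℂ fun ζ => ?_
  rw [ContinuousLinearMap.star_eq_adjoint, ContinuousLinearMap.adjoint_inner_right,
    ← integral_inner hint, leftConvolution_apply,
    ← inner_conj_symm, ← integral_inner (integrable_smul_leftRegular μ f ζ), ← integral_conj]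
  refine integral_congr_ae (.of_forall fun s => ?_)
  simp only [inner_smul_right, map_mul, inner_conj_symm, inner_leftRegular]
  rfl

theorem norm_star_leftConvolution_sub_le (f : C_c(G, ℂ)) (ξ : Lp ℂ 2 μ) {ε : ℝ}
    (h : ∀ s, f s ≠ 0 → ‖leftRegular μ s ξ - ξ‖ ≤ ε) :
    ‖star (leftConvolution μ f) ξ - star (∫ s, f s ∂μ) • ξ‖ ≤ (∫ s, ‖f s‖ ∂μ) * ε := by
  have hf : Integrable f μ := f.continuous.integrable_of_hasCompactSupport f.hasCompactSupport
  have hf' : Integrable (fun s => star (f s)) μ :=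
    f.continuous.star.integrable_of_hasCompactSupport
      (f.hasCompactSupport.comp_left (g := star) (star_zero ℂ))
  have hint : Integrable (fun s => star (f s) • leftRegular μ s⁻¹ ξ) μ := by
    refine Continuous.integrable_of_hasCompactSupport
      (f.continuous.star.smul ((continuous_leftRegular μ ξ).comp continuous_inv)) ?_
    exact (f.hasCompactSupport.comp_left (g := star) (star_zero ℂ)).smul_right
  have h1 : star (∫ s, f s ∂μ) = ∫ s, star (f s) ∂μ := integral_conj.symm
  rw [star_leftConvolution_apply, h1, ← integral_smul_const, ← integral_sub hint
    (hf'.smul_const ξ), ← integral_mul_const]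
  refine norm_integral_le_of_norm_le (hf.norm.mul_const _) (.of_forall fun s => ?_)
  rw [← smul_sub, norm_smul, norm_star]
  by_cases hs : f s = 0
  · simp [hs]
  · gcongr
    -- As λ_s is isometric, ‖λ_{s⁻¹} ξ - ξ‖ = ‖ξ - λ_s ξ‖, so no hypothesis on inverses is needed.
    rw [← (leftRegular μ s).norm_map, map_sub, leftRegular_apply_inv_apply, norm_sub_rev]
    exact h s hs

omit [μ.Regular] in
/-- Normalized complex-valued bump functions. -/
theorem exists_compactlySupported_complex_integral_eq_one {U : Set G} {x : G} (hU : U ∈ 𝓝 x) :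
    ∃ f : C_c(G, ℂ), (∀ y ∉ U, f y = 0) ∧ ∫ y, f y ∂μ = 1 ∧ ∫ y, ‖f y‖ ∂μ = 1 := by
  obtain ⟨f, hf0, hfU, hf1⟩ := exists_compactlySupported_integral_eq_one μ hU
  refine ⟨⟨⟨fun y => (f y : ℂ), Complex.continuous_ofReal.comp f.continuous⟩,
    f.hasCompactSupport.comp_left (g := fun r : ℝ => (r : ℂ)) Complex.ofReal_zero⟩,
    fun y hy => congrArg Complex.ofReal (hfU y hy), ?_, ?_⟩
  · refine (integral_ofReal (f := f)).trans ?_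
    rw [hf1]
    exact Complex.ofReal_one
  · refine Eq.trans (integral_congr_ae (.of_forall fun y => ?_)) hf1
    exact (Complex.norm_real _).trans (Real.norm_of_nonneg (hf0 y))

/-- A net of unit vectors which is almost invariant, uniformly on compact sets. -/
def IsReiterNet (η : TopologicalSpace.Compacts G × ℕ → Lp ℂ 2 μ) : Prop :=
  ∀ i, ‖η i‖ = 1 ∧ ∀ s ∈ i.1, ‖leftRegular μ s (η i) - η i‖ ≤ 1 / ((i.2 : ℝ) + 1)

theorem IsAmenableGroup.exists_isReiterNet (hG : IsAmenableGroup G) : ∃ η, IsReiterNet μ η := by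
  choose η hη using fun i : TopologicalSpace.Compacts G × ℕ =>
    hG.exists_norm_leftRegular_sub_le μ i.1.isCompact (ε := 1 / ((i.2 : ℝ) + 1)) (by positivity)
  exact ⟨η, hη⟩

variable {μ} {η : TopologicalSpace.Compacts G × ℕ → Lp ℂ 2 μ}

omit [LocallyCompactSpace G] [μ.Regular] in
theorem IsReiterNet.eventually_norm_le (hη : IsReiterNet μ η) {K : Set G} (hK : IsCompact K) {ε : ℝ}
    (hε : 0 < ε) : ∀ᶠ i in atTop, ∀ s ∈ K, ‖leftRegular μ s (η i) - η i‖ ≤ ε := by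
  obtain ⟨n, hn⟩ := exists_nat_one_div_lt hε
  filter_upwards [eventually_ge_atTop ((⟨K, hK⟩ : TopologicalSpace.Compacts G), n)] with i hi s hs
  refine ((hη i).2 s (hi.1 hs)).trans (le_trans ?_ hn.le)
  exact one_div_le_one_div_of_le (by positivity) (by exact_mod_cast Nat.succ_le_succ hi.2)

theorem IsReiterNet.isApproxEigen_leftConvolution (hη : IsReiterNet μ η) (f : C_c(G, ℂ)) :
    IsApproxEigen atTop η (leftConvolution μ f) (∫ s, f s ∂μ) ∧
      IsApproxEigen atTop η (star (leftConvolution μ f)) (star (∫ s, f s ∂μ)) := by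
  have h0 : 0 ≤ ∫ s, ‖f s‖ ∂μ := integral_nonneg fun _ => norm_nonneg _
  have key (ε : ℝ) (hε : 0 < ε) : ∀ᶠ i in atTop, ∀ s, f s ≠ 0 →
      ‖leftRegular μ s (η i) - η i‖ ≤ ε / ((∫ s, ‖f s‖ ∂μ) + 1) :=
    (hη.eventually_norm_le f.hasCompactSupport (by positivity)).mono fun i hi s hs =>
      hi s (subset_tsupport _ hs)
  have hlt (ε : ℝ) (hε : 0 < ε) :
      (∫ s, ‖f s‖ ∂μ) * (ε / ((∫ s, ‖f s‖ ∂μ) + 1)) < ε := by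
    rw [mul_div_assoc', div_lt_iff₀ (by positivity)]
    nlinarith
  constructor
  · refine Metric.tendsto_nhds.2 fun ε hε => (key ε hε).mono fun i hi => ?_
    rw [dist_zero_right]
    exact (norm_leftConvolution_sub_le μ f (η i) hi).trans_lt (hlt ε hε)
  · refine Metric.tendsto_nhds.2 fun ε hε => (key ε hε).mono fun i hi => ?_
    rw [dist_zero_right]
    exact (norm_star_leftConvolution_sub_le μ f (η i) hi).trans_lt (hlt ε hε)

theorem IsReiterNet.reducedCStar_le (hη : IsReiterNet μ η) :
    reducedCStar μ ≤ approxEigenAlgebra atTop η := by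
  refine NonUnitalStarSubalgebra.topologicalClosure_minimal _ (NonUnitalStarAlgebra.adjoin_le ?_)
    (isClosed_approxEigenAlgebra fun i => (hη i).1)
  rintro _ ⟨f, rfl⟩
  exact ⟨_, hη.isApproxEigen_leftConvolution f⟩

/-- The trivial character of the reduced group C⋆-algebra. -/
def IsTrivialCharacter (χ : reducedCStar μ →⋆ₙₐ[ℂ] ℂ) : Prop :=
  ∀ f : C_c(G, ℂ), χ ⟨leftConvolution μ f, leftConvolution_mem_reducedCStar μ f⟩ = ∫ s, f s ∂μ

theorem IsReiterNet.exists_isTrivialCharacter (hη : IsReiterNet μ η) :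
    ∃ χ : reducedCStar μ →⋆ₙₐ[ℂ] ℂ, IsTrivialCharacter χ ∧
      ∀ a : reducedCStar μ, IsApproxEigen atTop η (a : Lp ℂ 2 μ →L[ℂ] Lp ℂ 2 μ) (χ a) := by
  obtain ⟨χ, hχ⟩ := exists_character_isApproxEigen (fun i => (hη i).1) hη.reducedCStar_le
  exact ⟨χ, fun f => (hχ _).unique (fun i => (hη i).1) (hη.isApproxEigen_leftConvolution f).1, hχ⟩

/-- The trivial character is a tracial state. -/
theorem IsTrivialCharacter.exists_isTracialState {χ : reducedCStar μ →⋆ₙₐ[ℂ] ℂ}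
    (hχ : IsTrivialCharacter χ) : ∃ τ : reducedCStar μ →L[ℂ] ℂ, IsTracialState τ := by
  have hle (a : reducedCStar μ) : ‖χ a‖ ≤ 1 * ‖a‖ :=
    (NonUnitalStarAlgHom.norm_apply_le χ a).trans_eq (one_mul _).symm
  let τ : reducedCStar μ →L[ℂ] ℂ := LinearMap.mkContinuous
    { toFun := χ, map_add' := map_add χ, map_smul' := map_smul χ } 1 hle
  refine ⟨τ, fun a => ?_,
    le_antisymm (LinearMap.mkContinuous_norm_le _ zero_le_one _) ?_, fun a b => ?_⟩
  · change 0 ≤ χ (star a * a)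
    rw [map_mul, map_star]
    exact star_mul_self_nonneg _
  -- The norm is at least 1: a normalized bump function satisfies ‖λ(f)‖ ≤ ∫ |f| = 1 and χ(λ(f)) = ∫
  -- f = 1.
  · obtain ⟨f, -, hf, hf'⟩ :=
      exists_compactlySupported_complex_integral_eq_one μ (univ_mem (f := 𝓝 (1 : G)))
    have h1 := τ.le_opNorm
      ⟨leftConvolution μ f, leftConvolution_mem_reducedCStar μ f⟩
    have h2 : ‖(⟨leftConvolution μ f, leftConvolution_mem_reducedCStar μ f⟩ : reducedCStar μ)‖ ≤ 1 :=
      (norm_leftConvolution_le μ f).trans_eq hf'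
    have h3 := hχ f
    rw [hf] at h3
    change ‖χ _‖ ≤ _ at h1
    rw [h3, norm_one] at h1
    exact h1.trans (mul_le_of_le_one_right (norm_nonneg _) h2)
  · change χ (a * b) = χ (b * a)
    rw [map_mul, map_mul, mul_comm]

end TrivialCharacter

/-! ### The bimodule of the trivial character -/

/-- The anti-representation by scalars given by a character. -/
noncomputable def scalarAntiRep {A : Type*} [NonUnitalCStarAlgebra A] (H : Type*)
    [NormedAddCommGroup H] [InnerProductSpace ℂ H] [CompleteSpace H] (χ : A →⋆ₙₐ[ℂ] ℂ) :
    Aᵐᵒᵖ →⋆ₙₐ[ℂ] (H →L[ℂ] H) where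
  toFun a := χ a.unop • 1
  map_smul' c a := by simp [mul_smul]
  map_zero' := by simp
  map_add' a b := by simp [add_smul]
  map_mul' a b := by rw [unop_mul, map_mul, smul_mul_smul_comm, mul_one, mul_comm]
  map_star' a := by rw [unop_star, map_star, star_smul, star_one]

section TrivialBimodule

variable {G : Type u} [Group G] [TopologicalSpace G] [IsTopologicalGroup G]
  [MeasurableSpace G] [BorelSpace G] (μ : Measure G) [μ.IsHaarMeasure] [LocallyCompactSpace G]
  [μ.Regular]

omit [IsTopologicalGroup G] [LocallyCompactSpace G] [μ.IsHaarMeasure] [Group G] in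
/-- Functions in `ℒ²` are approximated by functions which vanish outside a compact set. -/
theorem exists_compact_eLpNorm_sub_le [R1Space G] {f : G → ℂ} (hf : MemLp f 2 μ) {ε : ℝ≥0∞}
    (hε : ε ≠ 0) : ∃ g : G → ℂ, eLpNorm (f - g) 2 μ ≤ ε ∧ MemLp g 2 μ ∧
      ∃ K : Set G, IsCompact K ∧ ∀ x ∉ K, g x = 0 := by
  refine hf.induction_dense ENNReal.ofNat_ne_top
    (fun g => MemLp g 2 μ ∧ ∃ K : Set G, IsCompact K ∧ ∀ x ∉ K, g x = 0) ?_ ?_ ?_ hε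
  · intro c t ht htμ δ hδ
    obtain ⟨r, hr0, hr⟩ := exists_eLpNorm_indicator_le (μ := μ) (p := 2) ENNReal.ofNat_ne_top c hδ
    obtain ⟨K, hKt, hK, hKc, hKr⟩ := ht.exists_isCompact_isClosed_sdiff_lt htμ.ne
      (ENNReal.coe_pos.2 hr0).ne'
    refine ⟨K.indicator fun _ => c, ?_, memLp_indicator_const 2 hKc.measurableSet c
      (.inr hK.measure_ne_top), K, hK, fun x hx => Set.indicator_of_notMem hx _⟩
    rw [← eLpNorm_neg, neg_sub, ← Set.indicator_sdiff hKt]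
    exact hr _ hKr.le
  · rintro f g ⟨hf, K, hK, hKf⟩ ⟨hg, L, hL, hLg⟩
    refine ⟨hf.add hg, K ∪ L, hK.union hL, fun x hx => ?_⟩
    rw [Set.mem_union, not_or] at hx
    rw [Pi.add_apply, hKf x hx.1, hLg x hx.2, add_zero]
  · exact fun f hf => hf.1.aestronglyMeasurable

omit [LocallyCompactSpace G] in
/-- A vector of `L²(G)` fixed by all translations vanishes if `G` is not compact. -/
theorem eq_zero_of_leftRegular_eq [NoncompactSpace G] {ξ : Lp ℂ 2 μ}
    (hξ : ∀ s, leftRegular μ s ξ = ξ) : ξ = 0 := by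
  refine norm_le_zero_iff.1 (le_of_forall_pos_le_add fun ε hε => ?_)
  rw [zero_add]
  obtain ⟨g, hg, hgm, K, hK, hgK⟩ := exists_compact_eLpNorm_sub_le μ (Lp.memLp ξ)
    (ε := ENNReal.ofReal (ε / 4)) (by simpa using hε)
  let ζ : Lp ℂ 2 μ := hgm.toLp g
  have hζ : ‖ξ - ζ‖ ≤ ε / 4 := by
    rw [← Lp.toLp_coeFn ξ (Lp.memLp ξ), ← MemLp.toLp_sub, Lp.norm_toLp]
    exact ENNReal.toReal_le_of_le_ofReal (by positivity) hg
  -- As K·K⁻¹ is compact and G is not, some translate of ζ has support disjoint from that of ζ.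
  obtain ⟨s, hs⟩ : ∃ s : G, s ∉ (fun p : G × G => p.1 * p.2⁻¹) '' (K ×ˢ K) :=
    (Set.ne_univ_iff_exists_notMem _).1 ((hK.prod hK).image (by fun_prop)).ne_univ
  have horth : inner ℂ (leftRegular μ s ζ) ζ = 0 := by
    rw [L2.inner_def]
    refine integral_eq_zero_of_ae ?_
    have hae := hgm.coeFn_toLp
    filter_upwards [coeFn_leftRegular μ s ζ, hae,
      (measurePreserving_mul_left μ s⁻¹).quasiMeasurePreserving.ae hae] with t h1 h2 h3
    rw [h1, h2, h3]
    by_cases ht : g t = 0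
    · simp [ht]
    · have : g (s⁻¹ * t) = 0 := by
        by_contra h
        exact hs ⟨(t, s⁻¹ * t), ⟨not_imp_comm.1 (hgK t) ht, not_imp_comm.1 (hgK _) h⟩, by simp⟩
      simp [this]
  have h1 : inner ℂ ξ ξ = inner ℂ (leftRegular μ s (ξ - ζ)) ξ +
      inner ℂ (leftRegular μ s ζ) (ξ - ζ) := by
    rw [inner_sub_right, horth, map_sub, inner_sub_left, hξ]
    abel
  have h2 : ‖leftRegular μ s ζ‖ ≤ ‖ξ‖ + ε / 4 := by
    rw [LinearIsometry.norm_map, ← sub_sub_cancel ξ ζ]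
    exact (norm_sub_le _ _).trans (by gcongr)
  have h3 := congrArg norm h1
  rw [inner_self_eq_norm_sq_to_K, norm_pow, RCLike.norm_ofReal, abs_norm] at h3
  have h4 : ‖ξ‖ ^ 2 ≤ ε / 4 * ‖ξ‖ + (‖ξ‖ + ε / 4) * (ε / 4) := by
    rw [h3]
    refine (norm_add_le _ _).trans (add_le_add ?_ ?_)
    · refine (norm_inner_le_norm _ _).trans ?_
      rw [LinearIsometry.norm_map]
      gcongr
    · refine (norm_inner_le_norm _ _).trans ?_
      gcongr
  -- The estimate ‖ξ‖² ≤ (ε/2)‖ξ‖ + ε²/16 is incompatible with ‖ξ‖ > ε.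
  nlinarith [norm_nonneg ξ]

variable {μ}

/-- The bimodule `L²(G)` with left action by convolution and right action by a character. -/
noncomputable def characterBimodule (χ : reducedCStar μ →⋆ₙₐ[ℂ] ℂ) :
    HilbertStarBimodule (reducedCStar μ) (Lp ℂ 2 μ) where
  left := reducedCStarInclusion μ
  right := scalarAntiRep (Lp ℂ 2 μ) χ
  comm a b ξ := ContinuousLinearMap.map_smul (reducedCStarInclusion μ a) (χ b) ξ

theorem characterBimodule_right_apply (χ : reducedCStar μ →⋆ₙₐ[ℂ] ℂ) (a : reducedCStar μ)
    (ξ : Lp ℂ 2 μ) : (characterBimodule χ).right (op a) ξ = χ a • ξ := rfl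

theorem IsTrivialCharacter.exists_eq_one {χ : reducedCStar μ →⋆ₙₐ[ℂ] ℂ}
    (hχ : IsTrivialCharacter χ) : ∃ f : C_c(G, ℂ), ∫ s, f s ∂μ = 1 ∧
      χ ⟨leftConvolution μ f, leftConvolution_mem_reducedCStar μ f⟩ = 1 := by
  obtain ⟨f, -, hf, -⟩ :=
    exists_compactlySupported_complex_integral_eq_one μ (univ_mem (f := 𝓝 (1 : G)))
  exact ⟨f, hf, (hχ f).trans hf⟩

/-- On the left, bump functions near 1 move a given vector arbitrarily little; on the right, an
element with χ-value 1 acts as the identity. -/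
theorem IsTrivialCharacter.nondegenerate {χ : reducedCStar μ →⋆ₙₐ[ℂ] ℂ}
    (hχ : IsTrivialCharacter χ) : (characterBimodule χ).Nondegenerate := by
  constructor
  · refine Metric.dense_iff.2 fun ξ ε hε => ?_
    have hU : {s : G | ‖leftRegular μ s ξ - ξ‖ < ε / 2} ∈ 𝓝 (1 : G) := by
      refine ((continuous_leftRegular μ ξ).sub continuous_const).norm.continuousAt.eventually_lt
        continuousAt_const ?_
      simpa using hε
    obtain ⟨f, hfU, hf, hf'⟩ := exists_compactlySupported_complex_integral_eq_one μ hU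
    refine ⟨leftConvolution μ f ξ, ?_, Submodule.subset_span
      ⟨⟨leftConvolution μ f, leftConvolution_mem_reducedCStar μ f⟩, ξ, rfl⟩⟩
    have h1 := norm_leftConvolution_sub_le μ f ξ (ε := ε / 2) fun s hs => by
      by_contra h
      exact hs (hfU s fun h' => h (le_of_lt h'))
    rw [hf, hf', one_smul, one_mul] at h1
    rw [Metric.mem_ball, dist_eq_norm]
    linarith
  · obtain ⟨f, -, hf⟩ := hχ.exists_eq_one
    refine dense_univ.mono fun ξ _ => Submodule.subset_span
      ⟨⟨leftConvolution μ f, leftConvolution_mem_reducedCStar μ f⟩, ξ, ?_⟩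
    rw [characterBimodule_right_apply, hf, one_smul]

/-- Centrality means λ(f)ξ = (∫ f) ξ. Comparing f with its left translate, which has the same
integral, gives λ_s ξ = ξ, and non-compactness leaves only ξ = 0. -/
theorem IsTrivialCharacter.centralVectors_eq_bot [NoncompactSpace G]
    {χ : reducedCStar μ →⋆ₙₐ[ℂ] ℂ} (hχ : IsTrivialCharacter χ) :
    (characterBimodule χ).centralVectors = ⊥ := by
  refine (Submodule.eq_bot_iff _).2 fun ξ hξ => eq_zero_of_leftRegular_eq μ fun s => ?_
  have h1 (f : C_c(G, ℂ)) : leftConvolution μ f ξ = (∫ t, f t ∂μ) • ξ := by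
    rw [← hχ f]
    exact hξ ⟨leftConvolution μ f, leftConvolution_mem_reducedCStar μ f⟩
  obtain ⟨f, hf, -⟩ := hχ.exists_eq_one
  have h2 : leftConvolution μ f ξ = ξ := by rw [h1, hf, one_smul]
  have h3 : ∫ t, compactLeftTranslate s f t ∂μ = ∫ t, f t ∂μ := integral_mul_left_eq_self f s⁻¹
  have h4 := DFunLike.congr_fun (leftRegularL_mul_leftConvolution μ s f) ξ
  rw [mul_apply_eq_comp, h2, h1, h3, hf, one_smul] at h4
  exact h4

/-- Strictly compact sets of multipliers map to norm-compact sets. -/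
theorem isCompact_image_fst {A : Type*} [NonUnitalCStarAlgebra A] {L : Set 𝓜(ℂ, A)}
    (hL : @IsCompact _ (strictTopology A) L) (a : A) : IsCompact ((fun x => x.fst a) '' L) := by
  refine @IsCompact.image _ _ (strictTopology A) _ L (fun x => x.fst a) hL ?_
  exact continuous_iff_le_induced.2 ((iInf_le _ a).trans inf_le_left)

/-- A strictly compact set is bounded at each a ∈ A, so the uniform boundedness principle applies.
-/
theorem exists_norm_le_of_isCompact_strictTopology {A : Type*} [NonUnitalCStarAlgebra A]
    {L : Set 𝓜(ℂ, A)} (hL : @IsCompact _ (strictTopology A) L) : ∃ C, ∀ x ∈ L, ‖x‖ ≤ C := by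
  obtain ⟨C, hC⟩ := banach_steinhaus (g := fun x : L => (x : 𝓜(ℂ, A)).fst) fun a => by
    obtain ⟨C, hC⟩ := (isCompact_image_fst hL a).isBounded.exists_norm_le
    exact ⟨C, fun x => hC _ ⟨x, x.2, rfl⟩⟩
  exact ⟨C, fun x hx => by simpa [DoubleCentralizer.norm_fst] using hC ⟨x, hx⟩⟩

/-- Pointwise approximate eigenvalues are attained uniformly on compact sets. -/
theorem eventually_norm_sub_smul_le {A H I : Type*} [NonUnitalCStarAlgebra A]
    [NormedAddCommGroup H] [InnerProductSpace ℂ H] [CompleteSpace H] {l : Filter I} {η : I → H}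
    (hη : ∀ i, ‖η i‖ = 1) (φ : A →⋆ₙₐ[ℂ] (H →L[ℂ] H)) (χ : A →⋆ₙₐ[ℂ] ℂ)
    (h : ∀ a, IsApproxEigen l η (φ a) (χ a)) {C : Set A} (hC : IsCompact C) {ε : ℝ} (hε : 0 < ε) :
    ∀ᶠ i in l, ∀ a ∈ C, ‖φ a (η i) - χ a • η i‖ ≤ ε := by
  obtain ⟨t, -, ht, htC⟩ := Metric.totallyBounded_iff.1 hC.totallyBounded (ε / 4) (by positivity)
    |>.imp fun t ht => (⟨trivial, ht.1, ht.2⟩ : True ∧ _ ∧ _)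
  have h1 : ∀ᶠ i in l, ∀ a ∈ t, ‖φ a (η i) - χ a • η i‖ < ε / 2 :=
    (ht.eventually_all).2 fun a _ => by
      have := Metric.tendsto_nhds.1 (h a) (ε / 2) (by positivity)
      simpa only [dist_zero_right] using this
  filter_upwards [h1] with i hi a ha
  obtain ⟨b, hb, hab⟩ := Set.mem_iUnion₂.1 (htC ha)
  rw [Metric.mem_ball, dist_eq_norm] at hab
  have h2 : φ a (η i) - χ a • η i =
      φ (a - b) (η i) - χ (a - b) • η i + (φ b (η i) - χ b • η i) := by
    rw [map_sub, map_sub, _root_.sub_apply, sub_smul]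
    abel
  have h3 : ‖φ (a - b) (η i)‖ ≤ ‖a - b‖ := by
    refine ((φ (a - b)).le_opNorm _).trans ?_
    rw [hη, mul_one]
    exact NonUnitalStarAlgHom.norm_apply_le φ _
  have h4 : ‖χ (a - b) • η i‖ ≤ ‖a - b‖ := by
    rw [norm_smul, hη, mul_one]
    exact NonUnitalStarAlgHom.norm_apply_le χ _
  rw [h2]
  have h5 := hi b hb
  calc _ ≤ ‖φ (a - b) (η i)‖ + ‖χ (a - b) • η i‖ + ‖φ b (η i) - χ b • η i‖ :=
        (norm_add_le _ _).trans (by gcongr; exact norm_sub_le _ _)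
    _ ≤ ε := by linarith

/-- If the right action is given by a character which is approximated by vector states of the left
action, then the corresponding net is almost central. -/
theorem HilbertStarBimodule.isAlmostCentral_of_isApproxEigen {A H I : Type*}
    [NonUnitalCStarAlgebra A] [NormedAddCommGroup H] [InnerProductSpace ℂ H] [CompleteSpace H]
    {X : HilbertStarBimodule A H} (hX : X.Nondegenerate) {χ : A →⋆ₙₐ[ℂ] ℂ}
    (hχ : ∀ a ξ, X.right (op a) ξ = χ a • ξ) {a₀ : A} (ha₀ : χ a₀ = 1) [Preorder I] {η : I → H}
    (hη : ∀ i, ‖η i‖ = 1) (h : ∀ a, IsApproxEigen atTop η (X.left a) (χ a)) :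
    X.IsAlmostCentral η := by
  intro L hL ε hε
  obtain ⟨C, hC⟩ := exists_norm_le_of_isCompact_strictTopology hL
  have h1 := eventually_norm_sub_smul_le hη X.left χ h (isCompact_image_fst hL a₀) (half_pos hε)
  have h2 := Metric.tendsto_nhds.1 (h a₀) (ε / (2 * (|C| + 1))) (by positivity)
  filter_upwards [h1, h2] with i hi1 hi2 x hx
  rw [dist_zero_right, ha₀, one_smul] at hi2
  -- On the right, x acts by the value at x of the extended character; centrality of the pair
  -- (`x.fst`, `x.snd`) shows that χ(x a₀) = χ(a₀ x).
  have hr : X.mulRight x (η i) = χ (x.fst a₀) • η i := by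
    have h3 := mulRight_apply hX x a₀ (η i)
    rw [hχ, hχ, ha₀, one_smul] at h3
    have h4 := congrArg χ (x.central a₀ a₀)
    rw [map_mul, map_mul, ha₀, mul_one, one_mul] at h4
    rw [h3, h4]
  -- Since a₀·η is close to η, the multiplier x may be replaced by x a₀ up to ‖x‖ times a small
  -- error, and these elements range over a norm-compact subset of A.
  have hl : X.mulLeft x (η i) =
      X.left (x.fst a₀) (η i) - X.mulLeft x (X.left a₀ (η i) - η i) := by
    rw [map_sub, mulLeft_apply hX x a₀ (η i), sub_sub_cancel]
  have h5 : ‖X.mulLeft x (X.left a₀ (η i) - η i)‖ ≤ ε / 2 := by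
    refine (ContinuousLinearMap.le_of_opNorm_le _ (norm_mulLeft_le hX x) _).trans ?_
    calc _ ≤ (|C| + 1) * (ε / (2 * (|C| + 1))) := by
          gcongr
          exact (hC x hx).trans ((le_abs_self C).trans (by linarith))
      _ = ε / 2 := by field_simp
  have h6 := hi1 _ ⟨x, hx, rfl⟩
  rw [hr, hl, sub_right_comm]
  refine (norm_sub_le _ _).trans ?_
  linarith

variable (μ)

/-- The reduced C⋆-algebra of an amenable group has a tracial state. -/
theorem IsAmenableGroup.exists_isTracialState (hG : IsAmenableGroup G) :
    ∃ τ : reducedCStar μ →L[ℂ] ℂ, IsTracialState τ := by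
  obtain ⟨η, hη⟩ := hG.exists_isReiterNet μ
  obtain ⟨χ, hχ, -⟩ := hη.exists_isTrivialCharacter
  exact hχ.exists_isTracialState

/-- The reduced C⋆-algebra of a non-compact amenable group does not have Property (T). -/
theorem IsAmenableGroup.not_hasPropertyT [NoncompactSpace G] (hG : IsAmenableGroup G) :
    ¬ HasPropertyT (reducedCStar μ) := by
  intro hT
  obtain ⟨η, hη⟩ := hG.exists_isReiterNet μ
  obtain ⟨χ, hχ, hχη⟩ := hη.exists_isTrivialCharacter
  have hη1 := fun i => (hη i).1
  obtain ⟨f, -, hf⟩ := hχ.exists_eq_one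
  exact hT _ _ hχ.nondegenerate _ η hη1
    (HilbertStarBimodule.isAlmostCentral_of_isApproxEigen hχ.nondegenerate
      (characterBimodule_right_apply χ) hf hη1 hχη) hχ.centralVectors_eq_bot

end TrivialBimodule

/-! ### The equivalences -/

theorem HasStrongPropertyT.hasPropertyT {A : Type u} [NonUnitalCStarAlgebra A]
    (hA : HasStrongPropertyT A) : HasPropertyT A := by
  intro H _ _ _ X hX I _ _ _ ξ hξ hcent hbot
  have h := hA H X hX I ξ hξ hcent
  refine zero_ne_one (tendsto_nhds_unique h ?_)
  refine tendsto_const_nhds.congr fun i => ?_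
  -- Without central vectors the projection is 0, and the distances are constantly 1.
  have h0 : X.centralVectors.starProjection (ξ i) = 0 :=
    (Submodule.eq_bot_iff _).1 hbot _ (X.centralVectors.starProjection_apply_mem (ξ i))
  rw [h0, sub_zero, hξ]

theorem corollary1p5 (G : Type u) [Group G] [TopologicalSpace G] [IsTopologicalGroup G]
    [LocallyCompactSpace G] [T2Space G] [NoncompactSpace G] [MeasurableSpace G] [BorelSpace G]
    (μ : Measure G) [μ.IsHaarMeasure] [μ.Regular] (hnuc : IsNuclear (reducedCStar μ)) :
    List.TFAE [
      ¬ IsAmenableGroup G,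
      ¬ ∃ τ : reducedCStar μ →L[ℂ] ℂ, IsTracialState τ,
      HasPropertyT (reducedCStar μ),
      HasStrongPropertyT (reducedCStar μ)] := by
  tfae_have 1 → 2 := fun h ⟨_, hτ⟩ => h (isAmenableGroup_of_isTracialState μ hnuc hτ)
  tfae_have 2 → 1 := fun h hG => h (hG.exists_isTracialState μ)
  -- Vacuous: an almost central net of unit vectors would make G amenable.
  tfae_have 1 → 4 := fun h _ _ _ _ _ hX _ _ _ _ _ hξ hcent =>
    (h (isAmenableGroup_of_isAlmostCentral μ hnuc hX hξ hcent)).elim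
  tfae_have 4 → 3 := HasStrongPropertyT.hasPropertyT
  tfae_have 3 → 1 := fun h hG => hG.not_hasPropertyT μ h
  tfae_finish
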